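/- Let $n\ge 1$ and let $\phi=(\phi_j)_{j\ge0}\subset\mathscr S(\mathbb R^n)$ be a Littlewood–Paley family: with $\hat g(\xi)=\int g(x)e^{-2\pi i x\cdot\xi}\,dx$, one has $\operatorname{supp}\hat\phi_0\subset B(0,2)$, $\hat\phi_0=1$ in a neighbourhood of $\overline{B(0,1)}$, and $\hat\phi_j(\xi)=\hat\phi_0(2^{-j}\xi)-\hat\phi_0(2^{1-j}\xi)$ for $j\ge1$. For $s\in\mathbb R$ and $0<p,q\le\infty$ let $\mathscr B^s_{pq}(\mathbb R^n)$ and $\mathscr F^s_{pq}(\mathbb R^n)$ be the spaces of all $f\in\mathscr S'(\mathbb R^n)$ for which the following quasi-norms are finite: $$\|f\|_{\mathscr B^s_{pq}}=\big\|(2^{js}\phi_j*f)_{j\ge0}\big\|_{\ell^q(L^p(\mathbb R^n))},\qquad \|f\|_{\mathscr F^s_{pq}}=\big\|(2^{js}\phi_j*f)_{j\ge0}\big\|_{L^p(\mathbb R^n;\ell^q)}\ (p<\infty),$$ $$\|f\|_{\mathscr F^s_{\infty q}}=\sup_{x\in\mathbb R^n,\,J\in\mathbb Z}2^{Jn/q}\big\|(2^{js}\phi_j*f)_{j\ge\max(J,0)}\big\|_{L^q(B(x,2^{-J});\ell^q)}.$$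 A compatible couple is a pair $(X_0,X_1)$ of complex quasi-Banach spaces contained in a common vector space such that $X_0+X_1$, with the quasi-norm $\inf\{\|a\|_{X_0}+\|b\|_{X_1}: a+b=x\}$, is a quasi-Banach space. An admissible operator $(X_0,X_1)\to(Y_0,Y_1)$ is a bounded linear map $T:X_0+X_1\to Y_0+Y_1$ that restricts to bounded maps $X_i\to Y_i$ for $i=0,1$. Let $\mathfrak C_1$ be the category of complex quasi-Banach spaces and bounded linear maps, and $\mathfrak C_2$ the category of compatible couples and admissible operators. An interpolation functor is a functor $\mathfrak F:\mathfrak C_2\to\mathfrak C_1$ such that $X_0\cap X_1\subseteq\mathfrak F(X_0,X_1)\subseteq X_0+X_1$ with continuous inclusions for every couple $(X_0,X_1)$, and $\mathfrak F(T)=T|_{\mathfrak F(X_0,X_1)}$ for every admissible operator $T:(X_0,X_1)\to(Y_0,Y_1)$. A quasi-normed space $X$ is a set-theoretical interpolation space of $(X_0,X_1)$ if $X_0\cap X_1\subseteq X\subseteq X_0+X_1$ with continuous inclusions and every admissible operator $T:(X_0,X_1)\to(X_0,X_1)$ restricts to a bounded map $X\to X$. Let $s,s_0,s_1\in\mathbb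 R$ and $0<p,q,p_0,q_0,p_1,q_1\le\infty$ with $p\ne q$. Then $(\mathscr B^{s_0}_{p_0q_0}(\mathbb R^n),\mathscr B^{s_1}_{p_1q_1}(\mathbb R^n))$ is a compatible couple, and: (A) there is no interpolation functor $\mathfrak F:\mathfrak C_2\to\mathfrak C_1$ such that $\mathscr F^s_{pq}(\mathbb R^n)=\mathfrak F(\mathscr B^{s_0}_{p_0q_0}(\mathbb R^n),\mathscr B^{s_1}_{p_1q_1}(\mathbb R^n))$, not even as an equality of sets; (B) $\mathscr F^s_{pq}(\mathbb R^n)$ is not a set-theoretical interpolation space of $(\mathscr B^{s_0}_{p_0q_0}(\mathbb R^n),\mathscr B^{s_1}_{p_1q_1}(\mathbb R^n))$. -/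

import Mathlib

open MeasureTheory Filter Topology CategoryTheory
open scoped ENNReal NNReal SchwartzMap FourierTransform

namespace FunctionSpaces

noncomputable section

/-! ### Quasi-Banach spaces, described by extended quasi-norms

A quasi-normed space `X` contained in a complex vector space `V` is described by its extended
quasi-norm `N : V → [0, ∞]`, which is `∞` exactly outside `X`; thus `X = {x | N x < ∞}`. -/

/-- `N` is the extended quasi-norm of a (complete) complex quasi-Banach space
`{x | N x < ∞}` contained in the vector space `V`. -/
structure IsQuasiBanach {V : Type} [AddCommGroup V] [Module ℂ V] (N : V → ℝ≥0∞) : Prop where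
  eq_zero_iff : ∀ x, N x = 0 ↔ x = 0
  smul : ∀ (c : ℂ) (x : V), N (c • x) = ‖c‖ₑ * N x
  add_le : ∃ K : ℝ≥0, ∀ x y, N (x + y) ≤ K * (N x + N y)
  complete : ∀ u : ℕ → V, (∀ k, N (u k) < ∞) →
    (∀ ε : ℝ≥0∞, 0 < ε → ∃ M, ∀ k ≥ M, ∀ l ≥ M, N (u k - u l) < ε) →
    ∃ x, N x < ∞ ∧ Tendsto (fun k => N (u k - x)) atTop (𝓝 0)

/-- An object of the category `𝔠₁`: a complex quasi-Banach space. -/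
structure QuasiBanachSpace : Type 1 where
  carrier : Type
  [addCommGroup : AddCommGroup carrier]
  [module : Module ℂ carrier]
  qnorm : carrier → ℝ≥0
  isQuasiBanach : IsQuasiBanach (fun x => (qnorm x : ℝ≥0∞))

attribute [instance] QuasiBanachSpace.addCommGroup QuasiBanachSpace.module

/-- A morphism of `𝔠₁`: a bounded linear map. -/
@[ext] structure QuasiBanachSpace.Hom (E F : QuasiBanachSpace) : Type where
  toLin : E.carrier →ₗ[ℂ] F.carrier
  bounded : ∃ C : ℝ≥0, ∀ x, F.qnorm (toLin x) ≤ C * E.qnorm x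

instance : Category QuasiBanachSpace where
  Hom E F := QuasiBanachSpace.Hom E F
  id E := ⟨LinearMap.id, 1, fun x => by simp⟩
  comp S T := ⟨T.toLin ∘ₗ S.toLin, by
    obtain ⟨C, hC⟩ := S.bounded
    obtain ⟨D, hD⟩ := T.bounded
    refine ⟨D * C, fun x => (hD _).trans ?_⟩
    rw [mul_assoc]
    exact mul_le_mul_right (hC x) D⟩

/-! ### Compatible couples and admissible operators -/

section Couples

variable {V W : Type} [AddCommGroup V] [Module ℂ V] [AddCommGroup W] [Module ℂ W]

/-- The quasi-norm `inf {‖a‖₀ + ‖b‖₁ : a + b = x}` of the sum `X₀ + X₁`. -/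
def sumNorm (N₀ N₁ : V → ℝ≥0∞) (x : V) : ℝ≥0∞ := ⨅ a : V, N₀ a + N₁ (x - a)

/-- The quasi-norm of the intersection `X₀ ∩ X₁`. -/
def interNorm (N₀ N₁ : V → ℝ≥0∞) (x : V) : ℝ≥0∞ := max (N₀ x) (N₁ x)

/-- The vector space `X₀ + X₁`, i.e. the linear span of `X₀ ∪ X₁`. -/
def sumSpace (N₀ N₁ : V → ℝ≥0∞) : Submodule ℂ V :=
  Submodule.span ℂ {x | N₀ x < ∞ ∨ N₁ x < ∞}

/-- `(X₀, X₁)` is a compatible couple: both are quasi-Banach spaces, and so is `X₀ + X₁`. -/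
structure IsCompatible (N₀ N₁ : V → ℝ≥0∞) : Prop where
  zero : IsQuasiBanach N₀
  one : IsQuasiBanach N₁
  sum : IsQuasiBanach (sumNorm N₀ N₁)

/-- The linear map `T`, defined on a subspace `S` of `V` which contains `X = {N < ∞}`, maps `X`
boundedly into `Y = {M < ∞}`. -/
def MapsBoundedly {S : Submodule ℂ V} {R : Submodule ℂ W} (T : S →ₗ[ℂ] R)
    (N : V → ℝ≥0∞) (M : W → ℝ≥0∞) : Prop :=
  ∃ C : ℝ≥0, ∀ x : S, N x < ∞ → M (T x) ≤ C * N x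

/-- `T : X₀ + X₁ → Y₀ + Y₁` is an admissible operator from `(X₀, X₁)` to `(Y₀, Y₁)`. -/
structure IsAdmissible (N₀ N₁ : V → ℝ≥0∞) (M₀ M₁ : W → ℝ≥0∞)
    (T : sumSpace N₀ N₁ →ₗ[ℂ] sumSpace M₀ M₁) : Prop where
  sum : MapsBoundedly T (sumNorm N₀ N₁) (sumNorm M₀ M₁)
  zero : MapsBoundedly T N₀ M₀
  one : MapsBoundedly T N₁ M₁

end Couples

/-- An object of the category `𝔠₂`: a compatible couple `(X₀, X₁)` of complex quasi-Banach spaces,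
contained in a common vector space `V`. -/
structure Couple : Type 1 where
  V : Type
  [addCommGroup : AddCommGroup V]
  [module : Module ℂ V]
  norm₀ : V → ℝ≥0∞
  norm₁ : V → ℝ≥0∞
  compatible : IsCompatible norm₀ norm₁

attribute [instance] Couple.addCommGroup Couple.module

/-- The sum `X₀ + X₁` of a couple. -/
abbrev Couple.sum (X : Couple) : Submodule ℂ X.V := sumSpace X.norm₀ X.norm₁

/-- A morphism of `𝔠₂`: an admissible operator. -/
@[ext] structure Couple.Hom (X Y : Couple) : Type where
  toLin : X.sum →ₗ[ℂ] Y.sum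
  admissible : IsAdmissible X.norm₀ X.norm₁ Y.norm₀ Y.norm₁ toLin

theorem MapsBoundedly.id {V : Type} [AddCommGroup V] [Module ℂ V] (S : Submodule ℂ V)
    (N : V → ℝ≥0∞) : MapsBoundedly (LinearMap.id : S →ₗ[ℂ] S) N N :=
  ⟨1, fun x _ => by simp⟩

theorem MapsBoundedly.comp {U V W : Type} [AddCommGroup U] [Module ℂ U] [AddCommGroup V]
    [Module ℂ V] [AddCommGroup W] [Module ℂ W] {Q : Submodule ℂ U} {R : Submodule ℂ V}
    {S : Submodule ℂ W} {T₂ : R →ₗ[ℂ] S} {T₁ : Q →ₗ[ℂ] R} {N₁ : U → ℝ≥0∞} {N₂ : V → ℝ≥0∞}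
    {N₃ : W → ℝ≥0∞} (h₂ : MapsBoundedly T₂ N₂ N₃) (h₁ : MapsBoundedly T₁ N₁ N₂) :
    MapsBoundedly (T₂ ∘ₗ T₁) N₁ N₃ := by
  obtain ⟨C, hC⟩ := h₁
  obtain ⟨D, hD⟩ := h₂
  refine ⟨D * C, fun x hx => ?_⟩
  have h := hD (T₁ x) ((hC x hx).trans_lt (ENNReal.mul_lt_top ENNReal.coe_lt_top hx))
  refine h.trans ?_
  rw [ENNReal.coe_mul, mul_assoc]
  exact mul_le_mul_right (hC x hx) _

instance : Category Couple where
  Hom X Y := Couple.Hom X Y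
  id X := ⟨LinearMap.id, MapsBoundedly.id _ _, MapsBoundedly.id _ _, MapsBoundedly.id _ _⟩
  comp S T := ⟨T.toLin ∘ₗ S.toLin, T.admissible.sum.comp S.admissible.sum,
    T.admissible.zero.comp S.admissible.zero, T.admissible.one.comp S.admissible.one⟩

/-! ### Interpolation spaces -/

/-- An interpolation functor: a functor `𝔉 : 𝔠₂ ⥤ 𝔠₁` together with, for every couple
`X = (X₀, X₁)`, a realization of the space `𝔉 X` as a subset of `X₀ + X₁` such that
`X₀ ∩ X₁ ⊆ 𝔉 X ⊆ X₀ + X₁` with continuous inclusions and such that `𝔉 T` is the restriction of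
`T` to `𝔉 X` for every admissible operator `T`. -/
structure InterpolationFunctor where
  functor : Couple ⥤ QuasiBanachSpace
  incl : ∀ X : Couple, (functor.obj X).carrier →ₗ[ℂ] X.sum
  incl_injective : ∀ X, Function.Injective (incl X)
  incl_bounded : ∀ X : Couple, ∃ C : ℝ≥0, ∀ y,
    sumNorm X.norm₀ X.norm₁ (incl X y) ≤ C * ((functor.obj X).qnorm y : ℝ≥0∞)
  inter_subset : ∀ X : Couple, ∃ C : ℝ≥0, ∀ x : X.sum, interNorm X.norm₀ X.norm₁ (x : X.V) < ∞ →
    ∃ y, incl X y = x ∧ ((functor.obj X).qnorm y : ℝ≥0∞) ≤ C * interNorm X.norm₀ X.norm₁ (x : X.V)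
  map_eq_restrict : ∀ {X Y : Couple} (T : X ⟶ Y) (y : (functor.obj X).carrier),
    incl Y ((functor.map T).toLin y) = T.toLin (incl X y)

/-- The subset `𝔉(X₀, X₁)` of the ambient vector space. -/
def InterpolationFunctor.space (𝔉 : InterpolationFunctor) (X : Couple) : Set X.V :=
  Set.range fun y => (𝔉.incl X y : X.V)

section Interpolation

variable {V : Type} [AddCommGroup V] [Module ℂ V]

/-- `Y = {N < ∞}` is a categorical interpolation space of the couple `(X₀, X₁)`, i.e.
`Y = 𝔉(X₀, X₁)` for some interpolation functor `𝔉`. Only equality of the underlying sets is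
required. -/
def IsCategoricalInterpolationSpace (N₀ N₁ N : V → ℝ≥0∞) : Prop :=
  ∃ (h : IsCompatible N₀ N₁) (𝔉 : InterpolationFunctor),
    𝔉.space { V := V, norm₀ := N₀, norm₁ := N₁, compatible := h } = {x | N x < ∞}

/-- `X = {N < ∞}` is a set-theoretical interpolation space of `(X₀, X₁)`: there are continuous
inclusions `X₀ ∩ X₁ ⊆ X ⊆ X₀ + X₁`, and every admissible operator on `(X₀, X₁)` maps `X`
boundedly into itself. -/
structure IsSetTheoreticInterpolationSpace (N₀ N₁ N : V → ℝ≥0∞) : Prop where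
  inter_subset : ∃ C : ℝ≥0, ∀ x, interNorm N₀ N₁ x < ∞ → N x ≤ C * interNorm N₀ N₁ x
  subset_sum : ∃ C : ℝ≥0, ∀ x, N x < ∞ → sumNorm N₀ N₁ x ≤ C * N x
  invariant : ∀ T : sumSpace N₀ N₁ →ₗ[ℂ] sumSpace N₀ N₁, IsAdmissible N₀ N₁ N₀ N₁ T →
    MapsBoundedly T N N

end Interpolation

/-! ### Besov and Triebel-Lizorkin spaces -/

/-- Euclidean space `ℝⁿ`. -/
abbrev Euc (n : ℕ) : Type := EuclideanSpace ℝ (Fin n)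

/-- `φ` is a Littlewood-Paley family on `ℝⁿ`; `𝓕 g ξ = ∫ g x * exp (-2 π i ⟪x, ξ⟫) dx`. -/
structure IsLittlewoodPaley {n : ℕ} (φ : ℕ → 𝓢(Euc n, ℂ)) : Prop where
  tsupport_subset : tsupport (⇑(𝓕 (φ 0) : 𝓢(Euc n, ℂ))) ⊆ Metric.ball 0 2
  eq_one : ∀ᶠ ξ in 𝓝ˢ (Metric.closedBall (0 : Euc n) 1), 𝓕 (φ 0) ξ = 1
  succ : ∀ (j : ℕ) (ξ : Euc n), 1 ≤ j →
    𝓕 (φ j) ξ = 𝓕 (φ 0) ((2 : ℝ) ^ (-(j : ℤ)) • ξ) - 𝓕 (φ 0) ((2 : ℝ) ^ (1 - (j : ℤ)) • ξ)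

/-- The Schwartz function `y ↦ g (x - y)`. -/
def reflectTranslate {n : ℕ} (g : 𝓢(Euc n, ℂ)) (x : Euc n) : 𝓢(Euc n, ℂ) :=
  (SchwartzMap.compCLMOfContinuousLinearEquiv ℂ (ContinuousLinearEquiv.neg ℝ) g).compSubConstCLM
    ℂ x

theorem reflectTranslate_apply {n : ℕ} (g : 𝓢(Euc n, ℂ)) (x y : Euc n) :
    reflectTranslate g x y = g (x - y) := by
  simp [reflectTranslate]

/-- The convolution `g ∗ f` of a Schwartz function `g` and a tempered distribution `f`, which is
the function `x ↦ ⟨f, g (x - ·)⟩`. -/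
def conv {n : ℕ} (g : 𝓢(Euc n, ℂ)) (f : 𝓢'(Euc n, ℂ)) (x : Euc n) : ℂ :=
  f (reflectTranslate g x)

/-- The weight `2 ^ (j s)`. -/
def weight (s : ℝ) (j : ℕ) : ℝ≥0∞ := ENNReal.ofReal ((2 : ℝ) ^ ((j : ℝ) * s))

/-- The quasi-norm of the Besov space `B^s_{pq}(ℝⁿ)`: the `ℓ^q`-norm over `j ≥ 0` of
`2 ^ (j s) ‖φ_j ∗ f‖_{L^p}`. -/
def besovNorm {n : ℕ} (φ : ℕ → 𝓢(Euc n, ℂ)) (s : ℝ) (p q : ℝ≥0∞) (f : 𝓢'(Euc n, ℂ)) : ℝ≥0∞ :=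
  eLpNorm (fun j : ℕ => weight s j * eLpNorm (conv (φ j) f) p volume) q Measure.count

/-- The quasi-norm of the Triebel-Lizorkin space `F^s_{pq}(ℝⁿ)`: for `p < ∞` the
`L^p(ℝⁿ; ℓ^q)`-norm of `(2 ^ (j s) φ_j ∗ f)_{j ≥ 0}`, and for `p = ∞` the supremum over all
`x ∈ ℝⁿ`, `J ∈ ℤ` of `2 ^ (J n / q)` times the `L^q(B(x, 2 ^ (-J)); ℓ^q)`-norm of
`(2 ^ (j s) φ_j ∗ f)_{j ≥ max(J, 0)}`. (For `q = ∞` one has `n / q.toReal = 0`, as it should be.) -/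
def triebelLizorkinNorm {n : ℕ} (φ : ℕ → 𝓢(Euc n, ℂ)) (s : ℝ) (p q : ℝ≥0∞)
    (f : 𝓢'(Euc n, ℂ)) : ℝ≥0∞ :=
  if p = ∞ then
    ⨆ (x : Euc n) (J : ℤ), ENNReal.ofReal ((2 : ℝ) ^ ((J : ℝ) * (n / q.toReal))) *
      eLpNorm (fun y => eLpNorm
          (fun j : ℕ => if J ≤ (j : ℤ) then weight s j * ‖conv (φ j) f y‖ₑ else 0) q Measure.count)
        q (volume.restrict (Metric.ball x ((2 : ℝ) ^ (-J))))
  else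
    eLpNorm (fun y => eLpNorm (fun j : ℕ => weight s j * ‖conv (φ j) f y‖ₑ) q Measure.count)
      p volume

end

end FunctionSpaces

open FunctionSpaces

/-! A Besov norm takes the `L^p` norm of each dyadic piece `φ_j ∗ f` before the pieces are combined,
so it cannot see independent translations of the pieces. A Triebel-Lizorkin norm with `p ≠ q`
combines the pieces at each point first and feels their relative position. One linear operator `T`
therefore settles both (A) and (B): it cuts a frequency window out of each annulus and translates
the piece of order `j + 1` by a vector `w_j`.

The test distributions have weighted pieces `a_j η(x - z_j)`, up to unimodular factors, with one
fixed Schwartz function `η`. If all `z_j` vanish, the size of the norm is governed by the `ℓ^q` norm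
of `a`; if the `z_j` are spaced along a line, it is governed by the `ℓ^p` norm. The sequence `a_j =
(j + 1) ^ (-1 / r)` with `r = min p q` lies in `ℓ^t` only for `t > r`. For `p < q` the operator
spreads a stacked family, for `q < p` it stacks a spread one; in both cases `f` lies in `F^s_{pq}`
and `T f` does not (`exists_operator_not_mapsTo`). An interpolation space of either kind would be
mapped into itself by `T`.

That `T` is bounded on every Besov space, also for `p < 1` (`exists_translation_operator`), rests on
translation invariance and on a multiplier estimate for band-limited functions whose constant does
not depend on the scale (`exists_conv_bound`); Peetre's argument proves it. The bound `‖w_j‖ ≤ 2 ^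
(j + 1)` keeps the symbol of temperate growth, so that `T` acts on all tempered distributions.

Compatibility comes from the continuous embedding of Besov spaces into the tempered distributions
(`exists_enorm_apply_le_besovNorm`). Together with the Fatou property it yields completeness, and
the evaluations at Schwartz functions separate the points of the sum, as `IsQuasiBanach.sumNorm`
requires. -/

namespace FunctionSpaces

set_option linter.unusedSectionVars false

/-! ### Sums of quasi-Banach spaces -/

section SumNorm

variable {V W : Type} [AddCommGroup V] [Module ℂ V] [AddCommGroup W] [Module ℂ W]

namespace IsQuasiBanach

variable {N : V → ℝ≥0∞}

theorem map_zero (h : IsQuasiBanach N) : N 0 = 0 := (h.eq_zero_iff 0).2 rfl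

theorem map_neg (h : IsQuasiBanach N) (x : V) : N (-x) = N x := by
  simpa using h.smul (-1) x

theorem map_sub_comm (h : IsQuasiBanach N) (x y : V) : N (x - y) = N (y - x) := by
  rw [← h.map_neg, neg_sub]

end IsQuasiBanach

/-- A series in a quasi-normed space whose terms decay geometrically, fast compared with the
constant of the quasi-triangle inequality, is bounded by its first term. -/
theorem quasiNorm_sum_range_le {N : V → ℝ≥0∞} {K : ℝ≥0∞} (h0 : N 0 = 0)
    (hK : ∀ x y, N (x + y) ≤ K * (N x + N y)) {a : ℕ → V} {ε : ℕ → ℝ≥0∞}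
    (ha : ∀ i, N (a i) ≤ ε i) (hε : ∀ i, 2 * K * ε (i + 1) ≤ ε i) (m l : ℕ) :
    N (∑ i ∈ Finset.range l, a (m + i)) ≤ 2 * K * ε m := by
  induction l generalizing m with
  | zero => simp [h0]
  | succ l ih =>
    -- Splitting off the first term, not the last, leaves a tail starting at `m + 1`, whose
    -- inductive bound `2 * K * ε (m + 1)` is at most `ε m`; so the constant `K` does not
    -- accumulate.
    rw [Finset.sum_range_succ']
    have h1 : ∑ i ∈ Finset.range l, a (m + (i + 1)) = ∑ i ∈ Finset.range l, a (m + 1 + i) := by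
      refine Finset.sum_congr rfl fun i _ => ?_
      congr 1; ring
    rw [h1]
    calc _ ≤ K * (N (∑ i ∈ Finset.range l, a (m + 1 + i)) + N (a (m + 0))) := hK _ _
      _ ≤ K * (ε m + ε m) := by
        gcongr
        · exact (ih (m + 1)).trans (hε m)
        · exact ha m
      _ = 2 * K * ε m := by ring

theorem sumNorm_le_left {N₀ N₁ : V → ℝ≥0∞} (h : N₁ 0 = 0) (x : V) : sumNorm N₀ N₁ x ≤ N₀ x :=
  (iInf_le _ x).trans (by simp [h])

theorem sumNorm_add_le_of_le {N₀ N₁ : V → ℝ≥0∞} (a b : V) :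
    sumNorm N₀ N₁ (a + b) ≤ N₀ a + N₁ b :=
  (iInf_le _ a).trans (by simp)

theorem exists_of_sumNorm_lt {N₀ N₁ : V → ℝ≥0∞} {x : V} {ε : ℝ≥0∞} (h : sumNorm N₀ N₁ x < ε) :
    ∃ a b, a + b = x ∧ N₀ a + N₁ b < ε := by
  obtain ⟨a, ha⟩ := iInf_lt_iff.1 h
  exact ⟨a, x - a, by abel, ha⟩

theorem sumNorm_add_le {N₀ N₁ : V → ℝ≥0∞} {K : ℝ≥0}
    (h₀ : ∀ x y, N₀ (x + y) ≤ K * (N₀ x + N₀ y)) (h₁ : ∀ x y, N₁ (x + y) ≤ K * (N₁ x + N₁ y))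
    (x y : V) : sumNorm N₀ N₁ (x + y) ≤ K * (sumNorm N₀ N₁ x + sumNorm N₀ N₁ y) := by
  unfold sumNorm
  rw [mul_add, ENNReal.mul_iInf (by simp), ENNReal.mul_iInf (by simp)]
  refine ENNReal.le_iInf_add_iInf fun a b => (iInf_le _ (a + b)).trans ?_
  calc N₀ (a + b) + N₁ (x + y - (a + b)) = N₀ (a + b) + N₁ ((x - a) + (y - b)) := by
        congr 2; abel
    _ ≤ K * (N₀ a + N₀ b) + K * (N₁ (x - a) + N₁ (y - b)) := add_le_add (h₀ _ _) (h₁ _ _)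
    _ = _ := by ring

theorem sumNorm_smul_le {N₀ N₁ : V → ℝ≥0∞} (h₀ : ∀ (c : ℂ) x, N₀ (c • x) = ‖c‖ₑ * N₀ x)
    (h₁ : ∀ (c : ℂ) x, N₁ (c • x) = ‖c‖ₑ * N₁ x) (c : ℂ) (x : V) :
    sumNorm N₀ N₁ (c • x) ≤ ‖c‖ₑ * sumNorm N₀ N₁ x := by
  unfold sumNorm
  rw [ENNReal.mul_iInf (by simp)]
  refine le_iInf fun a => (iInf_le _ (c • a)).trans ?_
  rw [← smul_sub, h₀, h₁, mul_add]

/-- The sum of two quasi-Banach spaces whose elements are separated by linear functionals which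
are bounded on both spaces is a quasi-Banach space. -/
theorem IsQuasiBanach.sumNorm {N₀ N₁ : V → ℝ≥0∞} (h₀ : IsQuasiBanach N₀) (h₁ : IsQuasiBanach N₁)
    (hsep : ∀ x : V, x ≠ 0 → ∃ (ℓ : V →ₗ[ℂ] ℂ) (C : ℝ≥0), ℓ x ≠ 0 ∧
      (∀ y, ‖ℓ y‖ₑ ≤ C * N₀ y) ∧ ∀ y, ‖ℓ y‖ₑ ≤ C * N₁ y) :
    IsQuasiBanach (sumNorm N₀ N₁) := by
  obtain ⟨K₀, hK₀⟩ := h₀.add_le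
  obtain ⟨K₁, hK₁⟩ := h₁.add_le
  set K : ℝ≥0 := max 1 (max K₀ K₁) with hK
  have hK1 : (1 : ℝ≥0∞) ≤ K := by exact_mod_cast le_max_left _ _
  have hKa₀ : ∀ x y, N₀ (x + y) ≤ K * (N₀ x + N₀ y) := fun x y => (hK₀ x y).trans (by
    gcongr; exact (le_max_left _ _).trans (le_max_right _ _))
  have hKa₁ : ∀ x y, N₁ (x + y) ≤ K * (N₁ x + N₁ y) := fun x y => (hK₁ x y).trans (by
    gcongr; exact (le_max_right _ _).trans (le_max_right _ _))
  have hadd := sumNorm_add_le hKa₀ hKa₁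
  refine ⟨fun x => ⟨fun hx => ?_, fun hx => ?_⟩, fun c x => ?_, ⟨K, hadd⟩, fun u hu hc => ?_⟩
  · by_contra hne
    obtain ⟨ℓ, C, hℓ, hℓ₀, hℓ₁⟩ := hsep x hne
    have h2 : ‖ℓ x‖ₑ ≤ C * FunctionSpaces.sumNorm N₀ N₁ x := by
      unfold FunctionSpaces.sumNorm
      rw [ENNReal.mul_iInf (by simp)]
      refine le_iInf fun a => ?_
      calc ‖ℓ x‖ₑ = ‖ℓ a + ℓ (x - a)‖ₑ := by rw [← map_add]; congr 2; abel
        _ ≤ ‖ℓ a‖ₑ + ‖ℓ (x - a)‖ₑ := enorm_add_le _ _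
        _ ≤ C * N₀ a + C * N₁ (x - a) := add_le_add (hℓ₀ _) (hℓ₁ _)
        _ = _ := by ring
    rw [hx, mul_zero, nonpos_iff_eq_zero, enorm_eq_zero] at h2
    exact hℓ h2
  · subst hx
    exact le_antisymm ((sumNorm_le_left h₁.map_zero 0).trans h₀.map_zero.le) bot_le
  · refine le_antisymm (sumNorm_smul_le h₀.smul h₁.smul c x) ?_
    rcases eq_or_ne c 0 with rfl | hne
    · simp
    have h3 := sumNorm_smul_le h₀.smul h₁.smul c⁻¹ (c • x)
    rw [inv_smul_smul₀ hne] at h3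
    calc ‖c‖ₑ * FunctionSpaces.sumNorm N₀ N₁ x
        ≤ ‖c‖ₑ * (‖c⁻¹‖ₑ * FunctionSpaces.sumNorm N₀ N₁ (c • x)) := by gcongr
      _ = _ := by
        rw [← mul_assoc, enorm_inv hne, ENNReal.mul_inv_cancel (by simpa using hne) (by simp),
          one_mul]
  · have hneg : ∀ x, FunctionSpaces.sumNorm N₀ N₁ (-x) ≤ FunctionSpaces.sumNorm N₀ N₁ x := by
      intro x
      simpa using sumNorm_smul_le h₀.smul h₁.smul (-1) x
    -- The ratio `1 / (2 K)` is exactly what `quasiNorm_sum_range_le` needs.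
    set ε : ℕ → ℝ≥0∞ := fun m => (2 * K : ℝ≥0∞)⁻¹ ^ m with hε
    have h2K0 : (2 * K : ℝ≥0∞) ≠ 0 := by
      have : (K : ℝ≥0∞) ≠ 0 := (lt_of_lt_of_le one_pos hK1).ne'
      simp [this]
    have h2Kt : (2 * K : ℝ≥0∞) ≠ ∞ := by finiteness
    have hεpos : ∀ m, 0 < ε m := fun m => ENNReal.pow_pos (ENNReal.inv_pos.2 h2Kt) m
    have hεs : ∀ m, 2 * K * ε (m + 1) ≤ ε m := fun m => by
      simp only [hε, pow_succ]
      rw [mul_comm, mul_assoc, ENNReal.inv_mul_cancel h2K0 h2Kt, mul_one]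
    have hεlim : Tendsto ε atTop (𝓝 0) := by
      refine ENNReal.tendsto_pow_atTop_nhds_zero_of_lt_one ?_
      rw [ENNReal.inv_lt_one]
      calc (1 : ℝ≥0∞) < 2 * 1 := by norm_num
        _ ≤ 2 * K := by gcongr
    choose M hM using fun m => hc (ε m) (hεpos m)
    -- These indices increase, satisfy `M m ≤ k m`, and tend to infinity because of the summand `m`.
    let k : ℕ → ℕ := fun m => m + ∑ i ∈ Finset.range (m + 1), M i
    have hkM : ∀ m, M m ≤ k m := fun m =>
      (Finset.single_le_sum (f := M) (fun _ _ => Nat.zero_le _)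
        (Finset.self_mem_range_succ m)).trans (Nat.le_add_left _ _)
    have hks : ∀ m, k m ≤ k (m + 1) := fun m => by
      simp only [k]; rw [Finset.sum_range_succ _ (m + 1)]; omega
    -- Each increment of the subsequence splits into parts small in `X₀` and in `X₁`; the two series
    -- of parts then converge separately in the two complete spaces.
    have hd : ∀ m, ∃ a b, a + b = u (k (m + 1)) - u (k m) ∧ N₀ a + N₁ b < ε m := fun m =>
      exists_of_sumNorm_lt (hM m _ ((hkM m).trans (hks m)) _ (hkM m))
    choose a b hab hεab using hd
    have ha : ∀ i, N₀ (a i) ≤ ε i := fun i => le_self_add.trans (hεab i).le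
    have hb : ∀ i, N₁ (b i) ≤ ε i := fun i => le_add_self.trans (hεab i).le
    have key : ∀ {N : V → ℝ≥0∞}, IsQuasiBanach N → (∀ x y, N (x + y) ≤ K * (N x + N y)) →
        ∀ {a : ℕ → V}, (∀ i, N (a i) ≤ ε i) → ∃ A, N A < ∞ ∧
          Tendsto (fun m => N (∑ i ∈ Finset.range m, a i - A)) atTop (𝓝 0) := by
      intro N hN hKN a ha
      have hle : ∀ m l, m ≤ l →
          N (∑ i ∈ Finset.range l, a i - ∑ i ∈ Finset.range m, a i) ≤ 2 * K * ε m := by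
        intro m l hml
        obtain ⟨r, rfl⟩ := Nat.exists_eq_add_of_le hml
        rw [Finset.sum_range_add, add_sub_cancel_left]
        exact quasiNorm_sum_range_le hN.map_zero hKN ha hεs m r
      have hlim : Tendsto (fun m => 2 * K * ε m) atTop (𝓝 0) := by
        simpa using ENNReal.Tendsto.const_mul hεlim (Or.inr h2Kt)
      refine hN.complete _ (fun m => ?_) fun δ hδ => ?_
      · have := hle 0 m (Nat.zero_le _)
        simp only [Finset.range_zero, Finset.sum_empty, sub_zero] at this
        exact this.trans_lt (by simp [hε]; finiteness)
      · obtain ⟨m, hm⟩ := eventually_atTop.1 (hlim.eventually (gt_mem_nhds hδ))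
        refine ⟨m, fun p hp q hq => ?_⟩
        rcases le_total q p with h | h
        · exact (hle q p h).trans_lt (hm q hq)
        · rw [hN.map_sub_comm]
          exact (hle p q h).trans_lt (hm p hp)
    obtain ⟨A, hA, hAl⟩ := key h₀ hKa₀ ha
    obtain ⟨B, hB, hBl⟩ := key h₁ hKa₁ hb
    have htel : ∀ m, u (k m) =
        u (k 0) + (∑ i ∈ Finset.range m, a i + ∑ i ∈ Finset.range m, b i) := fun m => by
      rw [← Finset.sum_add_distrib, Finset.sum_congr rfl fun i _ => hab i,
        Finset.sum_range_sub (fun i => u (k i))]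
      abel
    set x := u (k 0) + (A + B) with hx
    have hsub : Tendsto (fun m => FunctionSpaces.sumNorm N₀ N₁ (u (k m) - x)) atTop (𝓝 0) := by
      have h5 : Tendsto (fun m => N₀ (∑ i ∈ Finset.range m, a i - A) +
          N₁ (∑ i ∈ Finset.range m, b i - B)) atTop (𝓝 0) := by simpa using hAl.add hBl
      refine tendsto_of_tendsto_of_tendsto_of_le_of_le tendsto_const_nhds h5
        (fun _ => bot_le) fun m => ?_
      have : u (k m) - x =
          (∑ i ∈ Finset.range m, a i - A) + (∑ i ∈ Finset.range m, b i - B) := by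
        rw [htel m, hx]; abel
      simp only [this]
      exact sumNorm_add_le_of_le _ _
    refine ⟨x, ?_, ?_⟩
    · refine (hadd _ _).trans_lt (ENNReal.mul_lt_top ENNReal.coe_lt_top
        (ENNReal.add_lt_top.2 ⟨hu _, ?_⟩))
      exact (sumNorm_add_le_of_le A B).trans_lt (ENNReal.add_lt_top.2 ⟨hA, hB⟩)
    -- A Cauchy sequence follows its convergent subsequence; `δ / (2 K)` absorbs the quasi-triangle
    -- constant.
    · rw [ENNReal.tendsto_atTop_zero]
      intro δ hδ
      have hη : 0 < δ / (2 * K) := ENNReal.div_pos hδ.ne' h2Kt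
      obtain ⟨P, hP⟩ := hc _ hη
      obtain ⟨m, hm1, hm2⟩ := ((hsub.eventually (gt_mem_nhds hη)).and
        (eventually_ge_atTop P)).exists
      have hmk : P ≤ k m := hm2.trans (Nat.le_add_right _ _)
      refine ⟨P, fun l hl => ?_⟩
      have : u l - x = (u l - u (k m)) + (u (k m) - x) := by abel
      rw [this]
      calc _ ≤ K * (δ / (2 * K) + δ / (2 * K)) :=
            (hadd _ _).trans (by gcongr; exact (hP l hl _ hmk).le)
        _ = (2 * K) * (δ / (2 * K)) := by ring
        _ = δ := ENNReal.mul_div_cancel h2K0 h2Kt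

end SumNorm

/-! ### Inequalities for `L^p` and `ℓ^q` quasi-norms -/

section ELpNorm

variable {α ε : Type*} [MeasurableSpace α] {μ : Measure α}

/-- Jensen's inequality for the weight `w`. -/
theorem lintegral_mul_rpow_le {w a : α → ℝ≥0∞} (hw : AEMeasurable w μ) (ha : AEMeasurable a μ)
    {t : ℝ} (ht : 1 ≤ t) :
    (∫⁻ x, w x * a x ∂μ) ^ t ≤ (∫⁻ x, w x ∂μ) ^ (t - 1) * ∫⁻ x, w x * a x ^ t ∂μ := by
  have ht0 : 0 < t := by linarith
  have h1 : 0 ≤ 1 - t⁻¹ := by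
    have := inv_le_one_of_one_le₀ ht
    linarith
  -- Hölder's inequality for the factorization `w a = w ^ (1 - 1/t) * (w a ^ t) ^ (1/t)`.
  have h2 := ENNReal.lintegral_mul_norm_pow_le (μ := μ) hw (hw.mul (ha.pow_const t)) h1
    (inv_nonneg.2 ht0.le) (by ring)
  have h3 : ∀ x, w x ^ (1 - t⁻¹) * (w x * a x ^ t) ^ t⁻¹ = w x * a x := by
    intro x
    rw [ENNReal.mul_rpow_of_nonneg _ _ (inv_nonneg.2 ht0.le), ← mul_assoc,
      ← ENNReal.rpow_add_of_nonneg _ _ h1 (inv_nonneg.2 ht0.le), ENNReal.rpow_rpow_inv ht0.ne']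
    simp
  simp only [Pi.mul_apply, h3] at h2
  calc _ ≤ ((∫⁻ x, w x ∂μ) ^ (1 - t⁻¹) * (∫⁻ x, w x * a x ^ t ∂μ) ^ t⁻¹) ^ t := by gcongr
    _ = _ := by
      rw [ENNReal.mul_rpow_of_nonneg _ _ ht0.le, ENNReal.rpow_inv_rpow ht0.ne', ← ENNReal.rpow_mul]
      congr 2
      field_simp

theorem eLpNorm_rpow_toReal {p : ℝ≥0∞} (hp0 : p ≠ 0) (hp : p ≠ ∞) {ε : Type*} [TopologicalSpace ε]
    [ContinuousENorm ε] (f : α → ε) :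
    eLpNorm f p μ ^ p.toReal = ∫⁻ x, ‖f x‖ₑ ^ p.toReal ∂μ := by
  rw [eLpNorm_eq_lintegral_rpow_enorm_toReal hp0 hp, ← ENNReal.rpow_mul, one_div,
    inv_mul_cancel₀ (ENNReal.toReal_pos hp0 hp).ne', ENNReal.rpow_one]

theorem eLpNorm_count_rpow_toReal {p : ℝ≥0∞} (hp0 : p ≠ 0) (hp : p ≠ ∞) (a : ℕ → ℝ≥0∞) :
    eLpNorm a p Measure.count ^ p.toReal = ∑' j, a j ^ p.toReal := by
  rw [eLpNorm_rpow_toReal hp0 hp, lintegral_count]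
  simp

theorem eLpNorm_const_mul_ennreal {c : ℝ≥0∞} (hc : c ≠ ∞) (a : α → ℝ≥0∞) (p : ℝ≥0∞) :
    eLpNorm (fun x => c * a x) p μ = c * eLpNorm a p μ := by
  lift c to ℝ≥0 using hc
  have hle : ∀ (c : ℝ≥0) (a : α → ℝ≥0∞), eLpNorm (fun x => c * a x) p μ ≤ c * eLpNorm a p μ :=
    fun c a => eLpNorm_le_nnreal_smul_eLpNorm_of_ae_le_mul' (Eventually.of_forall fun x => by simp) p
  refine le_antisymm (hle c a) ?_
  rcases eq_or_ne c 0 with rfl | hne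
  · simp
  have hne' : (c : ℝ≥0∞) ≠ 0 := by simpa using hne
  have h := hle c⁻¹ fun x => c * a x
  simp only [← mul_assoc, ENNReal.coe_inv hne, ENNReal.inv_mul_cancel hne' ENNReal.coe_ne_top,
    one_mul] at h
  calc _ ≤ (c : ℝ≥0∞) * ((c : ℝ≥0∞)⁻¹ * eLpNorm (fun x => c * a x) p μ) := by gcongr
    _ = _ := by rw [← mul_assoc, ENNReal.mul_inv_cancel hne' ENNReal.coe_ne_top, one_mul]

/-- Fatou's lemma for `ℓ^q`. -/
theorem eLpNorm_count_le_of_le_liminf {q ε : ℝ≥0∞} (hq : q ≠ 0) {b : ℕ → ℝ≥0∞}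
    {u : ℕ → ℕ → ℝ≥0∞} (hb : ∀ j, b j ≤ liminf (fun l => u l j) atTop)
    (hu : ∀ᶠ l in atTop, eLpNorm (u l) q Measure.count ≤ ε) :
    eLpNorm b q Measure.count ≤ ε := by
  rcases eq_or_ne q ∞ with rfl | hqt
  · rw [eLpNorm_exponent_top, eLpNormEssSup_count]
    refine iSup_le fun j => (hb j).trans ?_
    refine liminf_le_of_frequently_le' (Eventually.frequently (hu.mono fun l hl => ?_))
    exact (enorm_le_eLpNorm_count (u l) j (by simp)).trans hl
  · have hq0 := ENNReal.toReal_pos hq hqt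
    rw [← ENNReal.rpow_le_rpow_iff hq0, eLpNorm_count_rpow_toReal hq hqt]
    have h1 : ∀ j, b j ^ q.toReal ≤ liminf (fun l => u l j ^ q.toReal) atTop := fun j => by
      have := (ENNReal.orderIsoRpow q.toReal hq0).liminf_apply (f := atTop) (u := fun l => u l j)
      simp only [ENNReal.orderIsoRpow_apply] at this
      rw [← this]
      gcongr
      exact hb j
    calc ∑' j, b j ^ q.toReal ≤ ∑' j, liminf (fun l => u l j ^ q.toReal) atTop :=
          ENNReal.tsum_le_tsum h1
      _ = ∫⁻ j, liminf (fun l => u l j ^ q.toReal) atTop ∂Measure.count := (lintegral_count _).symm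
      _ ≤ liminf (fun l => ∫⁻ j, u l j ^ q.toReal ∂Measure.count) atTop :=
          lintegral_liminf_le fun l => measurable_of_countable _
      _ ≤ ε ^ q.toReal := by
        refine liminf_le_of_frequently_le' (Eventually.frequently (hu.mono fun l hl => ?_))
        rw [lintegral_count, ← eLpNorm_count_rpow_toReal hq hqt]
        gcongr

end ELpNorm

/-! ### Peetre's inequality for band-limited functions -/

/-- The weight `1 + ‖z‖` as an extended nonnegative number. -/
def wt {E : Type*} [Norm E] (z : E) : ℝ≥0∞ := ENNReal.ofReal (1 + ‖z‖)

/-- A function on a normed space which decays faster than any power of the norm. -/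
def RapidDecay {E : Type*} [Norm E] (k : E → ℝ≥0∞) : Prop :=
  ∀ L : ℕ, ∃ C : ℝ≥0, ∀ z, k z * wt z ^ L ≤ C

theorem rapidDecay_schwartz {n : ℕ} (g : 𝓢(Euc n, ℂ)) : RapidDecay fun z => ‖g z‖ₑ := by
  intro L
  obtain ⟨C, hC⟩ : ∃ C : ℝ, ∀ z, (1 + ‖z‖) ^ L * ‖g z‖ ≤ C :=
    ⟨_, fun z => by
      simpa using SchwartzMap.one_add_le_sup_seminorm_apply (𝕜 := ℂ) (m := (L, 0)) le_rfl le_rfl g z⟩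
  refine ⟨C.toNNReal, fun z => ?_⟩
  simp only [wt]
  rw [← ofReal_norm, ← ENNReal.ofReal_pow (by positivity), ← ENNReal.ofReal_mul (by positivity),
    mul_comm]
  exact ENNReal.ofReal_le_ofReal (hC z)

section Peetre

variable {E : Type*} [NormedAddCommGroup E]

theorem one_le_wt (z : E) : 1 ≤ wt z := by
  unfold wt; rw [ENNReal.one_le_ofReal]; linarith [norm_nonneg z]

theorem one_le_wt_rpow (z : E) {r : ℝ} (hr : 0 ≤ r) : 1 ≤ wt z ^ r := by
  simpa using ENNReal.rpow_le_rpow (one_le_wt z) hr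

theorem wt_ne_zero (z : E) : wt z ≠ 0 := (zero_lt_one.trans_le (one_le_wt z)).ne'

theorem wt_ne_top (z : E) : wt z ≠ ∞ := ENNReal.ofReal_ne_top

theorem wt_zero : wt (0 : E) = 1 := by simp [wt]

theorem wt_sub_comm (x y : E) : wt (x - y) = wt (y - x) := by
  unfold wt; rw [norm_sub_rev]

theorem wt_sub_le (x y z : E) : wt (x - z) ≤ wt (x - y) * wt (y - z) := by
  unfold wt
  rw [← ENNReal.ofReal_mul (by positivity)]
  refine ENNReal.ofReal_le_ofReal ?_
  have := norm_sub_le_norm_sub_add_norm_sub x y z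
  nlinarith [norm_nonneg (x - y), norm_nonneg (y - z)]

variable [MeasurableSpace E] {μ : Measure E}

theorem measurable_wt [BorelSpace E] : Measurable (wt : E → ℝ≥0∞) := by
  unfold wt; fun_prop

/-- The Peetre inequality: a function of polynomial growth which is dominated by its convolution
with a rapidly decaying kernel satisfies a local `L^p` mean value estimate, `p ≤ 1`. -/
theorem rpow_le_of_le_convolution {k : E → ℝ≥0∞} (hk : RapidDecay k) {p : ℝ} (hp0 : 0 < p)
    (hp1 : p ≤ 1) (L : ℕ) : ∃ C : ℝ≥0, ∀ a : E → ℝ≥0∞,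
      (∀ y, a y ≤ ∫⁻ z, k (y - z) * a z ∂μ) → (∃ A : ℝ≥0, ∀ z, a z ≤ A * wt z ^ L) →
      ∀ x y, a y ^ p ≤ C * wt (x - y) ^ (L * p) *
        ∫⁻ z, a z ^ p / wt (x - z) ^ (L * p) ∂μ := by
  obtain ⟨C, hC⟩ := hk L
  refine ⟨C, fun a ha ⟨A, hA⟩ x y => ?_⟩
  set I := ∫⁻ z, a z ^ p / wt (x - z) ^ (L * p) ∂μ with hI
  have hwL0 : ∀ z, wt (x - z) ^ L ≠ 0 := fun z => pow_ne_zero _ (wt_ne_zero _)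
  have hwLt : ∀ z, wt (x - z) ^ L ≠ ∞ := fun z => ENNReal.pow_ne_top (wt_ne_top _)
  have hwp : ∀ z, (wt (x - z) ^ L) ^ p = wt (x - z) ^ (L * p) := fun z => by
    rw [ENNReal.rpow_mul, ENNReal.rpow_natCast]
  -- The Peetre maximal function at `x` is `S = sup v`; the goal is `S ^ p ≤ C * I`.
  set v : E → ℝ≥0∞ := fun z => a z / wt (x - z) ^ L with hv
  have hav : ∀ z, a z = v z * wt (x - z) ^ L := fun z =>
    (ENNReal.div_mul_cancel (hwL0 z) (hwLt z)).symm
  have hvp : ∀ z, v z ^ p = a z ^ p / wt (x - z) ^ (L * p) := fun z => by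
    rw [hv, ENNReal.div_rpow_of_nonneg _ _ hp0.le, hwp]
  set S := ⨆ z, v z with hS
  -- The a priori polynomial growth of `a` enters only here; finiteness of `S` permits the later
  -- division by `S ^ (1 - p)`.
  have hSt : S ≠ ∞ := by
    refine ne_top_of_le_ne_top (b := A * wt x ^ L) ?_ (iSup_le fun z => ?_)
    · exact ENNReal.mul_ne_top ENNReal.coe_ne_top (ENNReal.pow_ne_top (wt_ne_top _))
    · refine ENNReal.div_le_of_le_mul ((hA z).trans ?_)
      rw [mul_assoc, ← mul_pow]
      gcongr
      have := wt_sub_le z x 0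
      rwa [sub_zero, sub_zero, wt_sub_comm z x, mul_comm] at this
  -- The factor `v ^ (1 - p)` of the integrand is replaced by its supremum, and the decay of `k`
  -- pays for moving the weight from `x - z` to `x - y`.
  have hle : ∀ y, v y ≤ C * S ^ (1 - p) * I := by
    intro y
    refine ENNReal.div_le_of_le_mul ((ha y).trans ?_)
    have h1 : ∀ z, k (y - z) * a z ≤
        (C * wt (x - y) ^ L * S ^ (1 - p)) * (a z ^ p / wt (x - z) ^ (L * p)) := by
      intro z
      have h2 : v z ≤ S ^ (1 - p) * v z ^ p := by
        calc v z = v z ^ (1 - p) * v z ^ p := by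
              rw [← ENNReal.rpow_add_of_nonneg _ _ (by linarith) hp0.le]; simp
          _ ≤ _ := by
            gcongr
            exact le_iSup v z
      calc k (y - z) * a z = k (y - z) * (v z * wt (x - z) ^ L) := by rw [← hav]
        _ ≤ k (y - z) * ((S ^ (1 - p) * v z ^ p) * (wt (x - y) * wt (y - z)) ^ L) := by
          gcongr
          exact wt_sub_le _ _ _
        _ = (k (y - z) * wt (y - z) ^ L) * wt (x - y) ^ L * S ^ (1 - p) * v z ^ p := by
          rw [mul_pow]; ring
        _ ≤ _ := by
          rw [← hvp]
          gcongr
          exact hC _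
    calc _ ≤ ∫⁻ z, (C * wt (x - y) ^ L * S ^ (1 - p)) *
          (a z ^ p / wt (x - z) ^ (L * p)) ∂μ := lintegral_mono h1
      _ = (C * wt (x - y) ^ L * S ^ (1 - p)) * I := by
        rw [lintegral_const_mul']
        exact ENNReal.mul_ne_top (ENNReal.mul_ne_top ENNReal.coe_ne_top (hwLt y))
          (ENNReal.rpow_ne_top_of_nonneg (by linarith) hSt)
      _ = _ := by ring
  have hSp : S ^ p ≤ C * I := by
    rcases eq_or_ne S 0 with h0 | h0
    · simp [h0, ENNReal.zero_rpow_of_pos hp0]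
    have h3 : S ≤ S ^ (1 - p) * (C * I) := (iSup_le hle).trans (by ring_nf; rfl)
    have h4 : S = S ^ (1 - p) * S ^ p := by
      rw [← ENNReal.rpow_add _ _ h0 hSt]; simp
    rw [h4] at h3
    have h5 : S ^ (1 - p) ≠ 0 := by simp [h0, hSt]
    have h6 : S ^ (1 - p) ≠ ∞ := ENNReal.rpow_ne_top_of_nonneg (by linarith) hSt
    rw [← h4] at h3
    nth_rewrite 1 [h4] at h3
    exact (ENNReal.mul_le_mul_iff_right h5 h6).1 h3
  calc a y ^ p = v y ^ p * wt (x - y) ^ (L * p) := by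
        conv_lhs => rw [hav y]
        rw [ENNReal.mul_rpow_of_nonneg _ _ hp0.le, hwp]
    _ ≤ C * I * wt (x - y) ^ (L * p) := by
      gcongr
      exact (ENNReal.rpow_le_rpow (le_iSup v y) hp0.le).trans hSp
    _ = _ := by ring

theorem lintegral_rpow_neg_wt_lt_top [BorelSpace E] [μ.HasTemperateGrowth] {r : ℝ}
    (hr : (μ.integrablePower : ℝ) ≤ r) : ∫⁻ z, (wt z ^ r)⁻¹ ∂μ < ∞ := by
  have h := (Measure.integrable_pow_neg_integrablePower μ).lintegral_lt_top
  refine lt_of_le_of_lt (lintegral_mono fun z => ?_) h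
  rw [Real.rpow_neg (by positivity), ENNReal.ofReal_inv_of_pos (by positivity),
    ← ENNReal.ofReal_rpow_of_pos (by positivity)]
  exact ENNReal.inv_le_inv.2 (ENNReal.rpow_le_rpow_of_exponent_le (one_le_wt z) hr)

theorem RapidDecay.lintegral_lt_top [BorelSpace E] [μ.HasTemperateGrowth] {k : E → ℝ≥0∞}
    (hk : RapidDecay k) : ∫⁻ z, k z ∂μ < ∞ := by
  obtain ⟨C, hC⟩ := hk μ.integrablePower
  calc ∫⁻ z, k z ∂μ ≤ ∫⁻ z, C * (wt z ^ (μ.integrablePower : ℝ))⁻¹ ∂μ := by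
        refine lintegral_mono fun z => ?_
        rw [← div_eq_mul_inv, ENNReal.rpow_natCast]
        exact ENNReal.le_div_iff_mul_le (Or.inl (pow_ne_zero _ (wt_ne_zero _)))
          (Or.inl (ENNReal.pow_ne_top (wt_ne_top _))) |>.2 (hC z)
    _ = C * ∫⁻ z, (wt z ^ (μ.integrablePower : ℝ))⁻¹ ∂μ :=
        lintegral_const_mul' _ _ ENNReal.coe_ne_top
    _ < ∞ := ENNReal.mul_lt_top ENNReal.coe_lt_top (lintegral_rpow_neg_wt_lt_top le_rfl)

/-- For `p ≤ 1`, the `p`-th power of a convolution of a band-limited function is dominated by the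
convolution of its `p`-th power with an integrable weight. -/
theorem exists_weight_of_le_one [BorelSpace E] [μ.HasTemperateGrowth] {k k' : E → ℝ≥0∞}
    (hk : RapidDecay k) (hk' : RapidDecay k') {p : ℝ} (hp0 : 0 < p) (hp1 : p ≤ 1) :
    ∃ w : E → ℝ≥0∞, Measurable w ∧ ∫⁻ z, w z ∂μ < ∞ ∧ (∃ C : ℝ≥0, ∀ z, w z ≤ C) ∧
      ∀ a : E → ℝ≥0∞, (∀ y, a y ≤ ∫⁻ z, k (y - z) * a z ∂μ) →
      (∃ (L : ℕ) (A : ℝ≥0), ∀ z, a z ≤ A * wt z ^ L) → ∫⁻ z, a z ^ p ∂μ < ∞ →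
      ∀ x, (∫⁻ z, k' (x - z) * a z ∂μ) ^ p ≤ ∫⁻ z, w (x - z) * a z ^ p ∂μ := by
  -- The exponent `L` makes the weight `wt ^ (-L p)` integrable.
  obtain ⟨L, hL⟩ : ∃ L : ℕ, (μ.integrablePower : ℝ) ≤ L * p := by
    obtain ⟨L, hL⟩ := exists_nat_ge ((μ.integrablePower : ℝ) / p)
    exact ⟨L, by rwa [div_le_iff₀ hp0] at hL⟩
  obtain ⟨C, hC⟩ := rpow_le_of_le_convolution (μ := μ) hk hp0 hp1 L
  obtain ⟨C', hC'⟩ := hk' L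
  have hCt : (C' : ℝ≥0∞) ^ p * (C : ℝ≥0∞) ^ (1 - p) ≠ ∞ :=
    ENNReal.mul_ne_top (ENNReal.rpow_ne_top_of_nonneg hp0.le ENNReal.coe_ne_top)
      (ENNReal.rpow_ne_top_of_nonneg (by linarith) ENNReal.coe_ne_top)
  have hinv1 : ∀ z : E, (wt z ^ (L * p))⁻¹ ≤ 1 := fun z => by
    rw [ENNReal.inv_le_one]
    exact one_le_wt_rpow z (by positivity)
  refine ⟨fun z => (C' : ℝ≥0∞) ^ p * (C : ℝ≥0∞) ^ (1 - p) * (wt z ^ (L * p))⁻¹,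
    ((measurable_wt.pow_const _).inv).const_mul _, ?_, ⟨((C' : ℝ≥0∞) ^ p *
      (C : ℝ≥0∞) ^ (1 - p)).toNNReal, fun z => ?_⟩, fun a ha hg hint x => ?_⟩
  · rw [lintegral_const_mul' _ _ hCt]
    exact ENNReal.mul_lt_top hCt.lt_top (lintegral_rpow_neg_wt_lt_top hL)
  · rw [ENNReal.coe_toNNReal hCt]
    calc _ ≤ (C' : ℝ≥0∞) ^ p * (C : ℝ≥0∞) ^ (1 - p) * 1 := mul_le_mul' le_rfl (hinv1 z)
      _ = _ := mul_one _
  -- Bootstrap: the growth exponent `M` depends on `a`, and so does the constant `D`. Peetre's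
  -- inequality with `M`, taken at `x = y`, shows that `a` is bounded; then the inequality with the
  -- fixed `L` applies and its constant no longer depends on `a`.
  have hbdd : ∃ A : ℝ≥0, ∀ z, a z ≤ A * wt z ^ L := by
    obtain ⟨M, A, hA⟩ := hg
    obtain ⟨D, hD⟩ := rpow_le_of_le_convolution (μ := μ) hk hp0 hp1 M
    have h1 : ∀ y, a y ^ p ≤ D * ∫⁻ z, a z ^ p ∂μ := fun y => by
      refine (hD a ha ⟨A, hA⟩ y y).trans ?_
      rw [sub_self, wt_zero, ENNReal.one_rpow, mul_one]
      gcongr with z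
      refine ENNReal.div_le_of_le_mul (le_mul_of_one_le_right' ?_)
      exact one_le_wt_rpow _ (by positivity)
    have h2 : (D * ∫⁻ z, a z ^ p ∂μ) ^ p⁻¹ ≠ ∞ := ENNReal.rpow_ne_top_of_nonneg
      (inv_nonneg.2 hp0.le) (ENNReal.mul_ne_top ENNReal.coe_ne_top hint.ne)
    refine ⟨((D * ∫⁻ z, a z ^ p ∂μ) ^ p⁻¹).toNNReal, fun z => ?_⟩
    rw [ENNReal.coe_toNNReal h2]
    exact ((ENNReal.le_rpow_inv_iff hp0).2 (h1 z)).trans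
      (le_mul_of_one_le_right' (one_le_pow_of_one_le' (one_le_wt z) L))
  set J := ∫⁻ z, a z ^ p / wt (x - z) ^ (L * p) ∂μ with hJ
  have hJt : J ≠ ∞ := by
    refine ((lintegral_mono fun z => ?_).trans_lt hint).ne
    rw [div_eq_mul_inv]
    exact mul_le_of_le_one_right' (hinv1 _)
  -- In `a = a ^ (1 - p) * a ^ p` the first factor is bounded pointwise by Peetre's inequality and
  -- the second one is integrated. On raising to the power `p`, the powers of `J` combine to `J ^ (1
  -- - p) * J ^ p = J`.
  have hb : ∫⁻ z, k' (x - z) * a z ∂μ ≤ C' * (C * J) ^ ((1 - p) / p) * J := by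
    have hcoef : C' * (C * J) ^ ((1 - p) / p) ≠ ∞ :=
      ENNReal.mul_ne_top ENNReal.coe_ne_top (ENNReal.rpow_ne_top_of_nonneg
        (div_nonneg (by linarith) hp0.le) (ENNReal.mul_ne_top ENNReal.coe_ne_top hJt))
    rw [hJ, ← lintegral_const_mul' _ _ hcoef]
    refine lintegral_mono fun z => ?_
    have h1 := hC a ha hbdd x z
    rw [← hJ] at h1
    have h2 : a z ^ (1 - p) ≤ (C * J) ^ ((1 - p) / p) * wt (x - z) ^ (L * (1 - p)) := by
      calc a z ^ (1 - p) = (a z ^ p) ^ ((1 - p) / p) := by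
            rw [← ENNReal.rpow_mul]; congr 1; field_simp
        _ ≤ (C * wt (x - z) ^ (L * p) * J) ^ ((1 - p) / p) :=
            ENNReal.rpow_le_rpow h1 (div_nonneg (by linarith) hp0.le)
        _ = (C * J) ^ ((1 - p) / p) * (wt (x - z) ^ (L * p)) ^ ((1 - p) / p) := by
            rw [← ENNReal.mul_rpow_of_nonneg _ _ (div_nonneg (by linarith) hp0.le)]
            congr 1; ring
        _ = _ := by
            rw [← ENNReal.rpow_mul]; congr 2; field_simp
    have hw0 := wt_ne_zero (x - z)
    have hwt := wt_ne_top (x - z)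
    calc k' (x - z) * a z = k' (x - z) * (a z ^ (1 - p) * a z ^ p) := by
          rw [← ENNReal.rpow_add_of_nonneg _ _ (by linarith) hp0.le]; simp
      _ ≤ k' (x - z) * (((C * J) ^ ((1 - p) / p) * wt (x - z) ^ (L * (1 - p))) * a z ^ p) := by
          gcongr
      _ = (k' (x - z) * wt (x - z) ^ L) * (C * J) ^ ((1 - p) / p) *
            (a z ^ p / wt (x - z) ^ (L * p)) := by
          have : wt (x - z) ^ (L * (1 - p)) = wt (x - z) ^ L / wt (x - z) ^ (L * p) := by
            rw [← ENNReal.rpow_natCast, ← ENNReal.rpow_sub _ _ hw0 hwt]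
            congr 1; ring
          rw [this]; simp only [div_eq_mul_inv]; ring
      _ ≤ _ := by gcongr; exact hC' _
  calc _ ≤ (C' * (C * J) ^ ((1 - p) / p) * J) ^ p := by gcongr
    _ = (C' : ℝ≥0∞) ^ p * (C : ℝ≥0∞) ^ (1 - p) * J := by
      rw [ENNReal.mul_rpow_of_nonneg _ _ hp0.le, ENNReal.mul_rpow_of_nonneg _ _ hp0.le,
        ← ENNReal.rpow_mul, div_mul_cancel₀ _ hp0.ne',
        ENNReal.mul_rpow_of_nonneg _ _ (by linarith)]
      have : J ^ (1 - p) * J ^ p = J := by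
        rw [← ENNReal.rpow_add_of_nonneg _ _ (by linarith) hp0.le]; simp
      calc _ = (C' : ℝ≥0∞) ^ p * (C : ℝ≥0∞) ^ (1 - p) * (J ^ (1 - p) * J ^ p) := by ring
        _ = _ := by rw [this]
    _ = _ := by
      rw [hJ, ← lintegral_const_mul' _ _ hCt]
      congr 1; ext z; rw [div_eq_mul_inv]; ring

/-- For `p ≥ 1`, the `p`-th power of a convolution is dominated by the convolution of the `p`-th
power with an integrable weight. -/
theorem exists_weight_of_one_le [BorelSpace E] [SecondCountableTopology E] [μ.HasTemperateGrowth]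
    [μ.IsAddLeftInvariant] [μ.IsNegInvariant]
    {k' : E → ℝ≥0∞} (hk' : RapidDecay k') (hm : Measurable k') {p : ℝ} (hp1 : 1 ≤ p) :
    ∃ w : E → ℝ≥0∞, Measurable w ∧ ∫⁻ z, w z ∂μ < ∞ ∧ (∃ C : ℝ≥0, ∀ z, w z ≤ C) ∧
      ∀ a : E → ℝ≥0∞, Measurable a →
      ∀ x, (∫⁻ z, k' (x - z) * a z ∂μ) ^ p ≤ ∫⁻ z, w (x - z) * a z ^ p ∂μ := by
  have hI : (∫⁻ z, k' z ∂μ) ^ (p - 1) ≠ ∞ :=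
    ENNReal.rpow_ne_top_of_nonneg (by linarith) hk'.lintegral_lt_top.ne
  obtain ⟨C, hC⟩ := hk' 0
  refine ⟨fun z => (∫⁻ z, k' z ∂μ) ^ (p - 1) * k' z, hm.const_mul _, ?_,
    ⟨((∫⁻ z, k' z ∂μ) ^ (p - 1)).toNNReal * C, fun z => ?_⟩, fun a ha x => ?_⟩
  · rw [lintegral_const_mul' _ _ hI]
    exact ENNReal.mul_lt_top hI.lt_top hk'.lintegral_lt_top
  · rw [ENNReal.coe_mul, ENNReal.coe_toNNReal hI]
    exact mul_le_mul' le_rfl (by simpa using hC z)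
  · have := lintegral_mul_rpow_le (μ := μ) (w := fun z => k' (x - z)) (a := a)
      (hm.comp (measurable_const.sub measurable_id)).aemeasurable ha.aemeasurable hp1
    rw [lintegral_sub_left_eq_self] at this
    rw [← lintegral_const_mul' _ _ hI] at this
    simpa only [mul_assoc] using this

end Peetre

/-! ### Convolution estimates in `L^p` for all `p > 0` -/

section Convolution

variable {E : Type*} [NormedAddCommGroup E] [MeasurableSpace E] [BorelSpace E]
  [SecondCountableTopology E] {μ : Measure E} [μ.HasTemperateGrowth] [SFinite μ]
  [μ.IsAddLeftInvariant] [μ.IsNegInvariant]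

theorem lintegral_convolution {w b : E → ℝ≥0∞} (hw : Measurable w) (hb : Measurable b) :
    ∫⁻ x, ∫⁻ z, w (x - z) * b z ∂μ ∂μ = (∫⁻ z, w z ∂μ) * ∫⁻ z, b z ∂μ := by
  rw [lintegral_lintegral_swap]
  · have : ∀ z, ∫⁻ x, w (x - z) * b z ∂μ = (∫⁻ x, w x ∂μ) * b z := fun z => by
      rw [lintegral_mul_const _ (by fun_prop), lintegral_sub_right_eq_self (fun x => w x) z]
    simp_rw [this]
    rw [lintegral_const_mul _ hb]
  · have : Measurable fun x : E × E => w (x.1 - x.2) * b x.2 := by fun_prop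
    exact this.aemeasurable

/-- `L^p` and Nikolskii estimates for functions dominated by their convolution with a rapidly
decaying kernel. -/
theorem exists_convolution_bound {k k' : E → ℝ≥0∞} (hk : RapidDecay k) (hk' : RapidDecay k')
    (hm : Measurable k') {p : ℝ≥0∞} (hp : p ≠ 0) :
    ∃ C : ℝ≥0, ∀ a b : E → ℝ≥0∞, Measurable a → (∀ y, a y ≤ ∫⁻ z, k (y - z) * a z ∂μ) →
      (∃ (L : ℕ) (A : ℝ≥0), ∀ z, a z ≤ A * wt z ^ L) →
      (∀ y, b y ≤ ∫⁻ z, k' (y - z) * a z ∂μ) →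
      eLpNorm b p μ ≤ C * eLpNorm a p μ ∧ ∀ x, b x ≤ C * eLpNorm a p μ := by
  rcases eq_or_ne p ∞ with rfl | hpt
  · refine ⟨(∫⁻ z, k' z ∂μ).toNNReal, fun a b ham ha hg hb => ?_⟩
    rw [ENNReal.coe_toNNReal hk'.lintegral_lt_top.ne]
    have h1 : ∀ x, b x ≤ (∫⁻ z, k' z ∂μ) * eLpNorm a ∞ μ := fun x => by
      refine (hb x).trans ?_
      calc _ ≤ ∫⁻ z, k' (x - z) * eLpNorm a ∞ μ ∂μ := by
            refine lintegral_mono_ae ?_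
            filter_upwards [enorm_ae_le_eLpNormEssSup a μ] with z hz
            rw [eLpNorm_exponent_top]
            exact mul_le_mul' le_rfl hz
        _ = _ := by
            have : Measurable fun z => k' (x - z) := hm.comp (measurable_const.sub measurable_id)
            rw [lintegral_mul_const _ this, lintegral_sub_left_eq_self]
    refine ⟨?_, h1⟩
    rw [eLpNorm_exponent_top (f := b)]
    exact eLpNormEssSup_le_of_ae_enorm_bound (Eventually.of_forall h1)
  have hp0 : 0 < p.toReal := ENNReal.toReal_pos hp hpt
  obtain ⟨w, hwm, hwi, ⟨D, hwD⟩, hw⟩ : ∃ w : E → ℝ≥0∞, Measurable w ∧ ∫⁻ z, w z ∂μ < ∞ ∧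
      (∃ C : ℝ≥0, ∀ z, w z ≤ C) ∧ ∀ a : E → ℝ≥0∞, Measurable a →
      (∀ y, a y ≤ ∫⁻ z, k (y - z) * a z ∂μ) →
      (∃ (L : ℕ) (A : ℝ≥0), ∀ z, a z ≤ A * wt z ^ L) → ∫⁻ z, a z ^ p.toReal ∂μ < ∞ →
      ∀ x, (∫⁻ z, k' (x - z) * a z ∂μ) ^ p.toReal ≤ ∫⁻ z, w (x - z) * a z ^ p.toReal ∂μ := by
    rcases le_total p.toReal 1 with h1 | h1
    · obtain ⟨w, h2, h3, h4, h5⟩ := exists_weight_of_le_one (μ := μ) hk hk' hp0 h1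
      exact ⟨w, h2, h3, h4, fun a _ => h5 a⟩
    · obtain ⟨w, h2, h3, h4, h5⟩ := exists_weight_of_one_le (μ := μ) hk' hm h1
      exact ⟨w, h2, h3, h4, fun a ha _ _ _ => h5 a ha⟩
  -- The integral `I` of the weight serves the `L^p` bound through Tonelli, its supremum `D` serves
  -- the pointwise bound.
  set I := ∫⁻ z, w z ∂μ with hI
  have hIt : (I + D) ^ p.toReal⁻¹ ≠ ∞ :=
    ENNReal.rpow_ne_top_of_nonneg (inv_nonneg.2 hp0.le) (by finiteness)
  -- The summand `1` makes the constant nonzero, so that its product with an infinite norm is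
  -- infinite.
  refine ⟨((I + D) ^ p.toReal⁻¹).toNNReal + 1, fun a b ham ha hg hb => ?_⟩
  rcases eq_or_ne (eLpNorm a p μ) ∞ with htop | htop
  · rw [htop, ENNReal.mul_top (by simp)]
    exact ⟨le_top, fun _ => le_top⟩
  have hint : ∫⁻ z, a z ^ p.toReal ∂μ = eLpNorm a p μ ^ p.toReal := by
    rw [eLpNorm_rpow_toReal hp hpt]; simp
  have h6 := hw a ham ha hg (by rw [hint]; exact ENNReal.rpow_lt_top_of_nonneg hp0.le htop)
  have h7 : ∀ x, b x ^ p.toReal ≤ ∫⁻ z, w (x - z) * a z ^ p.toReal ∂μ := fun x =>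
    (ENNReal.rpow_le_rpow (hb x) hp0.le).trans (h6 x)
  have hfin : ∀ c : ℝ≥0∞, c ^ p.toReal ≤ (I + D) * eLpNorm a p μ ^ p.toReal →
      c ≤ (((I + D) ^ p.toReal⁻¹).toNNReal + 1 : ℝ≥0) * eLpNorm a p μ := fun c hc => by
    calc c ≤ (I + D) ^ p.toReal⁻¹ * eLpNorm a p μ := by
          rw [← ENNReal.rpow_le_rpow_iff hp0, ENNReal.mul_rpow_of_nonneg _ _ hp0.le,
            ENNReal.rpow_inv_rpow hp0.ne']
          exact hc
      _ ≤ _ := by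
          rw [ENNReal.coe_add, ENNReal.coe_toNNReal hIt]
          gcongr
          exact le_self_add
  refine ⟨hfin _ ?_, fun x => hfin _ ?_⟩
  · rw [eLpNorm_rpow_toReal hp hpt, ← hint]
    calc _ ≤ ∫⁻ x, ∫⁻ z, w (x - z) * a z ^ p.toReal ∂μ ∂μ := lintegral_mono h7
      _ = I * ∫⁻ z, a z ^ p.toReal ∂μ := lintegral_convolution hwm (ham.pow_const _)
      _ ≤ _ := by gcongr; exact le_self_add
  · rw [← hint]
    calc _ ≤ ∫⁻ z, w (x - z) * a z ^ p.toReal ∂μ := h7 x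
      _ ≤ ∫⁻ z, D * a z ^ p.toReal ∂μ := by gcongr; exact hwD _
      _ = D * ∫⁻ z, a z ^ p.toReal ∂μ := lintegral_const_mul' _ _ ENNReal.coe_ne_top
      _ ≤ _ := by gcongr; exact le_add_self

end Convolution

/-! ### Scaling of the estimates -/

section Dilation

variable {n : ℕ}

theorem map_inv_smul_volume {t : ℝ} (ht : 0 < t) :
    Measure.map (t⁻¹ • ·) (volume : Measure (Euc n)) = ENNReal.ofReal (t ^ n) • volume := by
  rw [Measure.map_addHaar_smul _ (inv_ne_zero ht.ne'), finrank_euclideanSpace_fin, inv_pow,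
    inv_inv, abs_of_pos (by positivity)]

theorem measurableEmbedding_inv_smul {t : ℝ} (ht : 0 < t) :
    MeasurableEmbedding (fun x : Euc n => t⁻¹ • x) :=
  (Homeomorph.smulOfNeZero _ (inv_ne_zero ht.ne')).measurableEmbedding

theorem lintegral_comp_inv_smul {t : ℝ} (ht : 0 < t) (f : Euc n → ℝ≥0∞) :
    ∫⁻ x, f (t⁻¹ • x) = ENNReal.ofReal (t ^ n) * ∫⁻ x, f x := by
  rw [← (measurableEmbedding_inv_smul ht).lintegral_map, map_inv_smul_volume ht,
    lintegral_smul_measure, smul_eq_mul]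

theorem eLpNorm_comp_inv_smul {t : ℝ} (ht : 0 < t) (p : ℝ≥0∞) {F : Type*} [NormedAddCommGroup F]
    (f : Euc n → F) :
    eLpNorm (fun x => f (t⁻¹ • x)) p volume =
      ENNReal.ofReal (t ^ (n / p.toReal)) * eLpNorm f p volume := by
  have h := (measurableEmbedding_inv_smul ht).eLpNorm_map_measure (μ := volume) (g := f) (p := p)
  rw [map_inv_smul_volume ht, eLpNorm_smul_measure_of_ne_zero
    (by rw [ne_eq, ENNReal.ofReal_eq_zero, not_le]; positivity)] at h
  rw [Function.comp_def] at h
  rw [← h, smul_eq_mul, ENNReal.ofReal_rpow_of_pos (by positivity), ENNReal.toReal_div,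
    ← Real.rpow_natCast, ← Real.rpow_mul ht.le]
  simp [div_eq_mul_inv]

/-- Scale invariant form of `exists_convolution_bound`. -/
theorem exists_bandlimited_bound (κ κ' : 𝓢(Euc n, ℂ)) {p : ℝ≥0∞} (hp : p ≠ 0) :
    ∃ C : ℝ≥0, ∀ (t : ℝ) (h g : Euc n → ℂ), 0 < t → Continuous h →
      (∃ (L : ℕ) (A : ℝ≥0), ∀ z, ‖h z‖ₑ ≤ A * wt z ^ L) →
      (∀ x, ‖h x‖ₑ ≤ ENNReal.ofReal (t ^ n) * ∫⁻ y, ‖κ (t • (x - y))‖ₑ * ‖h y‖ₑ) →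
      (∀ x, ‖g x‖ₑ ≤ ENNReal.ofReal (t ^ n) * ∫⁻ y, ‖κ' (t • (x - y))‖ₑ * ‖h y‖ₑ) →
      eLpNorm g p volume ≤ C * eLpNorm h p volume ∧
      ∀ x, ‖g x‖ₑ ≤ C * ENNReal.ofReal (t ^ (n / p.toReal)) * eLpNorm h p volume := by
  obtain ⟨C, hC⟩ := exists_convolution_bound (μ := (volume : Measure (Euc n)))
    (rapidDecay_schwartz κ) (rapidDecay_schwartz κ') κ'.continuous.enorm.measurable hp
  refine ⟨C, fun t h g ht hc ⟨L, A, hA⟩ hh hg => ?_⟩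
  have hconv : ∀ (κ : 𝓢(Euc n, ℂ)) (x : Euc n),
      ENNReal.ofReal (t ^ n) * ∫⁻ y, ‖κ (t • (t⁻¹ • x - y))‖ₑ * ‖h y‖ₑ =
        ∫⁻ z, ‖κ (x - z)‖ₑ * ‖h (t⁻¹ • z)‖ₑ := fun κ x => by
    rw [← lintegral_comp_inv_smul ht fun y => ‖κ (t • (t⁻¹ • x - y))‖ₑ * ‖h y‖ₑ]
    refine lintegral_congr fun z => ?_
    rw [smul_sub, smul_inv_smul₀ ht.ne', smul_inv_smul₀ ht.ne']
  -- After dilation by `t` the kernels have scale one, hence the constant does not depend on `t`.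
  obtain ⟨h1, h2⟩ := hC (fun x => ‖h (t⁻¹ • x)‖ₑ) (fun x => ‖g (t⁻¹ • x)‖ₑ)
    (hc.comp (continuous_const_smul _)).enorm.measurable (fun x => by rw [← hconv]; exact hh _)
    (by
      refine ⟨L, A * (ENNReal.ofReal (max 1 t⁻¹) ^ L).toNNReal, fun z => (hA _).trans ?_⟩
      rw [ENNReal.coe_mul, ENNReal.coe_toNNReal (by finiteness), mul_assoc, ← mul_pow]
      gcongr
      unfold wt
      rw [← ENNReal.ofReal_mul (by positivity)]
      refine ENNReal.ofReal_le_ofReal ?_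
      rw [norm_smul, Real.norm_of_nonneg (by positivity)]
      nlinarith [le_max_left 1 t⁻¹, le_max_right 1 t⁻¹, norm_nonneg z])
    (fun x => by rw [← hconv]; exact hg _)
  have hct : ENNReal.ofReal (t ^ (n / p.toReal)) ≠ 0 := by
    rw [ne_eq, ENNReal.ofReal_eq_zero, not_le]; positivity
  rw [eLpNorm_enorm, eLpNorm_comp_inv_smul ht] at h1 h2
  rw [eLpNorm_enorm, eLpNorm_comp_inv_smul ht] at h1
  -- The factor `t ^ (n / p)` occurs on both sides of the `L^p` bound and cancels; in the pointwise
  -- bound it stays as the Nikolskii factor.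
  refine ⟨?_, fun x => ?_⟩
  · rw [mul_left_comm] at h1
    exact (ENNReal.mul_le_mul_iff_right hct ENNReal.ofReal_ne_top).1 h1
  · have := h2 (t • x)
    rwa [inv_smul_smul₀ ht.ne', ← mul_assoc] at this

end Dilation

/-! ### Translation in the Schwartz space; continuity and growth of `conv` -/

section Translation

variable {n : ℕ}

theorem exists_one_add_pow_mul_iteratedFDeriv_le (g : 𝓢(Euc n, ℂ)) (k l : ℕ) :
    ∃ C : ℝ, 0 ≤ C ∧ ∀ z, (1 + ‖z‖) ^ k * ‖iteratedFDeriv ℝ l g z‖ ≤ C :=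
  ⟨_, by positivity, fun z =>
    SchwartzMap.one_add_le_sup_seminorm_apply (𝕜 := ℂ) (m := (k, l)) le_rfl le_rfl g z⟩

theorem iteratedFDeriv_compSubConstCLM (g : 𝓢(Euc n, ℂ)) (l : ℕ) (y x : Euc n) :
    iteratedFDeriv ℝ l (g.compSubConstCLM ℂ y) x = iteratedFDeriv ℝ l g (x - y) :=
  iteratedFDeriv_comp_sub (f := g) l y x

theorem exists_seminorm_compSubConstCLM_le (g : 𝓢(Euc n, ℂ)) (k l : ℕ) :
    ∃ C : ℝ, 0 ≤ C ∧ ∀ y, SchwartzMap.seminorm ℂ k l (g.compSubConstCLM ℂ y) ≤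
      C * (1 + ‖y‖) ^ k := by
  obtain ⟨C, hC0, hC⟩ := exists_one_add_pow_mul_iteratedFDeriv_le g k l
  refine ⟨C, hC0, fun y => SchwartzMap.seminorm_le_bound ℂ k l _ (by positivity) fun x => ?_⟩
  rw [iteratedFDeriv_compSubConstCLM]
  calc ‖x‖ ^ k * ‖iteratedFDeriv ℝ l g (x - y)‖
      ≤ ((1 + ‖x - y‖) * (1 + ‖y‖)) ^ k * ‖iteratedFDeriv ℝ l g (x - y)‖ := by
        gcongr
        have : ‖x‖ ≤ ‖x - y‖ + ‖y‖ := by simpa using norm_add_le (x - y) y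
        nlinarith [norm_nonneg (x - y), norm_nonneg y]
    _ = (1 + ‖x - y‖) ^ k * ‖iteratedFDeriv ℝ l g (x - y)‖ * (1 + ‖y‖) ^ k := by
        rw [mul_pow]; ring
    _ ≤ _ := by gcongr; exact hC _

/-- Mean value inequality on the segment from `x - y₀` to `x - y`. Since `‖y - y₀‖ ≤ 1`, its points
`z` satisfy `1 + ‖x‖ ≤ (1 + ‖z‖) * (2 + ‖y₀‖)`, so the decay of the next derivative at `z` is decay
in `x`. -/
theorem exists_seminorm_compSubConstCLM_sub_le (g : 𝓢(Euc n, ℂ)) (k l : ℕ) (y₀ : Euc n) :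
    ∃ C : ℝ, 0 ≤ C ∧ ∀ y, ‖y - y₀‖ ≤ 1 →
      SchwartzMap.seminorm ℂ k l (g.compSubConstCLM ℂ y - g.compSubConstCLM ℂ y₀) ≤
        C * ‖y - y₀‖ := by
  obtain ⟨C, hC0, hC⟩ := exists_one_add_pow_mul_iteratedFDeriv_le g k (l + 1)
  refine ⟨C * (2 + ‖y₀‖) ^ k, by positivity, fun y hy =>
    SchwartzMap.seminorm_le_bound ℂ k l _ (by positivity) fun x => ?_⟩
  have hsub : iteratedFDeriv ℝ l (⇑(g.compSubConstCLM ℂ y - g.compSubConstCLM ℂ y₀)) x =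
      iteratedFDeriv ℝ l g (x - y) - iteratedFDeriv ℝ l g (x - y₀) := by
    rw [← iteratedFDeriv_compSubConstCLM, ← iteratedFDeriv_compSubConstCLM]
    exact iteratedFDeriv_sub_apply ((SchwartzMap.smooth _ _).contDiffAt)
      ((SchwartzMap.smooth _ _).contDiffAt)
  rw [hsub]
  have hmv : ‖iteratedFDeriv ℝ l g (x - y) - iteratedFDeriv ℝ l g (x - y₀)‖ ≤
      C * (2 + ‖y₀‖) ^ k / (1 + ‖x‖) ^ k * ‖(x - y) - (x - y₀)‖ := by
    refine (convex_segment (𝕜 := ℝ) (x - y₀) (x - y)).norm_image_sub_le_of_norm_fderiv_le (𝕜 := ℝ)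
      (fun z _ => ((g.smooth (l + 1)).differentiable_iteratedFDeriv (m := l)
        (by exact_mod_cast Nat.lt_succ_self l)) z) (fun z hz => ?_)
      (left_mem_segment ℝ _ _) (right_mem_segment ℝ _ _)
    rw [norm_fderiv_iteratedFDeriv, le_div_iff₀ (by positivity)]
    have hxz : ‖x - z‖ ≤ 1 + ‖y₀‖ := by
      have h1 := norm_sub_le_of_mem_segment hz
      have h2 : (x - y) - (x - y₀) = y₀ - y := by abel
      rw [h2, norm_sub_rev] at h1
      have h3 : x - z = y₀ + (x - y₀ - z) := by abel
      rw [h3]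
      linarith [norm_add_le y₀ (x - y₀ - z), norm_sub_rev y y₀]
    have hx : 1 + ‖x‖ ≤ (1 + ‖z‖) * (2 + ‖y₀‖) := by
      have : ‖x‖ ≤ ‖x - z‖ + ‖z‖ := by simpa using norm_add_le (x - z) z
      nlinarith [norm_nonneg z, norm_nonneg y₀]
    calc ‖iteratedFDeriv ℝ (l + 1) g z‖ * (1 + ‖x‖) ^ k
        ≤ ‖iteratedFDeriv ℝ (l + 1) g z‖ * ((1 + ‖z‖) * (2 + ‖y₀‖)) ^ k := by gcongr
      _ = (1 + ‖z‖) ^ k * ‖iteratedFDeriv ℝ (l + 1) g z‖ * (2 + ‖y₀‖) ^ k := by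
        rw [mul_pow]; ring
      _ ≤ _ := by gcongr; exact hC z
  have h4 : ‖(x - y) - (x - y₀)‖ = ‖y - y₀‖ := by
    rw [← norm_neg]; congr 1; abel
  rw [h4] at hmv
  calc _ ≤ (1 + ‖x‖) ^ k * (C * (2 + ‖y₀‖) ^ k / (1 + ‖x‖) ^ k * ‖y - y₀‖) := by
        gcongr; linarith
    _ = _ := by field_simp

theorem continuous_compSubConstCLM (g : 𝓢(Euc n, ℂ)) :
    Continuous fun y => g.compSubConstCLM ℂ y := by
  rw [continuous_iff_continuousAt]
  intro y₀
  refine ((schwartz_withSeminorms ℂ (Euc n) ℂ).tendsto_nhds _ _).2 fun i ε hε => ?_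
  obtain ⟨C, hC0, hC⟩ := exists_seminorm_compSubConstCLM_sub_le g i.1 i.2 y₀
  have h1 : ∀ᶠ y in 𝓝 y₀, ‖y - y₀‖ < min 1 (ε / (C + 1)) := by
    have : Tendsto (fun y => ‖y - y₀‖) (𝓝 y₀) (𝓝 0) := by
      simpa using (continuous_id.sub (continuous_const (y := y₀))).norm.tendsto y₀
    exact this.eventually (gt_mem_nhds (by positivity))
  filter_upwards [h1] with y hy
  rw [lt_min_iff, lt_div_iff₀ (by positivity)] at hy
  refine (hC y hy.1.le).trans_lt ?_
  nlinarith [norm_nonneg (y - y₀)]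

/-- The Schwartz function `y ↦ g (-y)`. -/
noncomputable def reflect (g : 𝓢(Euc n, ℂ)) : 𝓢(Euc n, ℂ) :=
  SchwartzMap.compCLMOfContinuousLinearEquiv ℂ (ContinuousLinearEquiv.neg ℝ) g

theorem reflectTranslate_eq (g : 𝓢(Euc n, ℂ)) (x : Euc n) :
    reflectTranslate g x = (reflect g).compSubConstCLM ℂ x := rfl

theorem continuous_reflectTranslate (g : 𝓢(Euc n, ℂ)) : Continuous (reflectTranslate g) :=
  continuous_compSubConstCLM (reflect g)

theorem exists_norm_le_sum_seminorm (f : 𝓢'(Euc n, ℂ)) :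
    ∃ (s : Finset (ℕ × ℕ)) (C : ℝ), 0 ≤ C ∧
      ∀ g, ‖f g‖ ≤ C * ∑ i ∈ s, SchwartzMap.seminorm ℂ i.1 i.2 g := by
  have hf : Continuous f := f.continuous
  obtain ⟨s, C, -, hC⟩ := Seminorm.bound_of_continuous (schwartz_withSeminorms ℂ (Euc n) ℂ)
    ((normSeminorm ℂ ℂ).comp f.toLinearMap) (continuous_norm.comp hf)
  refine ⟨s, C, C.2, fun g => (hC g).trans ?_⟩
  rw [smul_apply, NNReal.smul_def, smul_eq_mul]
  gcongr
  refine (Seminorm.finset_sup_le_sum _ s g).trans_eq ?_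
  simp only [sum_apply]
  rfl

theorem continuous_conv (g : 𝓢(Euc n, ℂ)) (f : 𝓢'(Euc n, ℂ)) : Continuous (conv g f) :=
  f.continuous.comp (continuous_reflectTranslate g)

theorem exists_sum_seminorm_reflectTranslate_le (g : 𝓢(Euc n, ℂ)) (s : Finset (ℕ × ℕ)) :
    ∃ (C : ℝ) (L : ℕ), 0 ≤ C ∧
      ∀ y, ∑ i ∈ s, SchwartzMap.seminorm ℂ i.1 i.2 (reflectTranslate g y) ≤
        C * (1 + ‖y‖) ^ L := by
  choose C hC0 hC using fun i : ℕ × ℕ => exists_seminorm_compSubConstCLM_le (reflect g) i.1 i.2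
  refine ⟨∑ i ∈ s, C i, ∑ i ∈ s, i.1, Finset.sum_nonneg fun i _ => hC0 i, fun y => ?_⟩
  rw [Finset.sum_mul]
  refine Finset.sum_le_sum fun i hi => (hC i y).trans ?_
  refine mul_le_mul_of_nonneg_left (pow_le_pow_right₀ ?_ ?_) (hC0 i)
  · linarith [norm_nonneg y]
  · exact Finset.single_le_sum (f := fun i : ℕ × ℕ => i.1) (fun _ _ => Nat.zero_le _) hi

/-- This supplies the a priori growth bound in Peetre's argument. -/
theorem exists_norm_conv_le (g : 𝓢(Euc n, ℂ)) (f : 𝓢'(Euc n, ℂ)) :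
    ∃ (C : ℝ) (L : ℕ), 0 ≤ C ∧ ∀ y, ‖conv g f y‖ ≤ C * (1 + ‖y‖) ^ L := by
  obtain ⟨s, C, hC0, hC⟩ := exists_norm_le_sum_seminorm f
  obtain ⟨D, L, hD0, hD⟩ := exists_sum_seminorm_reflectTranslate_le g s
  refine ⟨C * D, L, by positivity, fun y => (hC _).trans ?_⟩
  rw [mul_assoc]
  gcongr
  exact hD y

theorem exists_enorm_conv_le (g : 𝓢(Euc n, ℂ)) (f : 𝓢'(Euc n, ℂ)) :
    ∃ (L : ℕ) (A : ℝ≥0), ∀ z, ‖conv g f z‖ₑ ≤ A * wt z ^ L := by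
  obtain ⟨C, L, hC0, hC⟩ := exists_norm_conv_le g f
  refine ⟨L, C.toNNReal, fun z => ?_⟩
  unfold wt
  rw [← ofReal_norm, ← ENNReal.ofReal_pow (by positivity)]
  change _ ≤ ENNReal.ofReal C * _
  rw [← ENNReal.ofReal_mul hC0]
  exact ENNReal.ofReal_le_ofReal (hC z)

end Translation

/-! ### Exchanging a tempered distribution with an integral -/

noncomputable section Exchange

variable {n : ℕ}

/-- The index set for the embedding of the Schwartz space, with finitely many seminorms, into a
space of bounded families. -/
abbrev JetIndex (n : ℕ) (s : Finset (ℕ × ℕ)) : Type :=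
  Σ i : s, Euc n × (Fin i.1.2 → Euc n)

/-- The weighted and normalized derivatives of a Schwartz function. -/
def jetFun {s : Finset (ℕ × ℕ)} (g : 𝓢(Euc n, ℂ)) (j : JetIndex n s) : ℂ :=
  ((‖j.2.1‖ ^ j.1.1.1 * (∏ a, ‖j.2.2 a‖)⁻¹ : ℝ) : ℂ) * iteratedFDeriv ℝ j.1.1.2 g j.2.1 j.2.2

theorem norm_jetFun_le {s : Finset (ℕ × ℕ)} (g : 𝓢(Euc n, ℂ)) (j : JetIndex n s) :
    ‖jetFun g j‖ ≤ SchwartzMap.seminorm ℂ j.1.1.1 j.1.1.2 g := by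
  obtain ⟨i, x, m⟩ := j
  refine le_trans ?_ (SchwartzMap.le_seminorm ℂ i.1.1 i.1.2 g x)
  simp only [jetFun]
  rw [norm_mul, Complex.norm_real, Real.norm_of_nonneg (by positivity), mul_assoc]
  gcongr
  have h := (iteratedFDeriv ℝ i.1.2 g x).le_opNorm m
  -- For a vanishing direction the normalizing factor is `0⁻¹ = 0`.
  rcases eq_or_ne (∏ a, ‖m a‖) 0 with h0 | h0
  · simp [h0]
  · have : 0 < ∏ a, ‖m a‖ := lt_of_le_of_ne (by positivity) h0.symm
    rwa [inv_mul_le_iff₀ this, mul_comm]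

theorem norm_jetFun_le_sum {s : Finset (ℕ × ℕ)} (g : 𝓢(Euc n, ℂ)) (j : JetIndex n s) :
    ‖jetFun g j‖ ≤ ∑ i ∈ s, SchwartzMap.seminorm ℂ i.1 i.2 g :=
  (norm_jetFun_le g j).trans (Finset.single_le_sum
    (f := fun i : ℕ × ℕ => SchwartzMap.seminorm ℂ i.1 i.2 g) (fun _ _ => apply_nonneg _ _) j.1.2)

/-- The Schwartz space maps to a space of bounded families by recording weighted derivatives. -/
def jet (n : ℕ) (s : Finset (ℕ × ℕ)) : 𝓢(Euc n, ℂ) →ₗ[ℂ] lp (fun _ : JetIndex n s => ℂ) ∞ where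
  toFun g := ⟨jetFun g, memℓp_infty ⟨_, by
    rintro _ ⟨j, rfl⟩
    exact norm_jetFun_le_sum g j⟩⟩
  map_add' g h := by
    ext j
    simp only [jetFun, lp.coeFn_add, Pi.add_apply]
    rw [show (⇑(g + h) : Euc n → ℂ) = ⇑g + ⇑h from rfl,
      iteratedFDeriv_add_apply (g.smooth _).contDiffAt (h.smooth _).contDiffAt]
    simp [mul_add]
  map_smul' c g := by
    ext j
    simp only [jetFun, lp.coeFn_smul, Pi.smul_apply, RingHom.id_apply]
    rw [show (⇑(c • g) : Euc n → ℂ) = c • ⇑g from rfl,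
      iteratedFDeriv_const_smul_apply (g.smooth _).contDiffAt]
    simp [mul_left_comm]

theorem jet_apply {s : Finset (ℕ × ℕ)} (g : 𝓢(Euc n, ℂ)) (j : JetIndex n s) :
    jet n s g j = jetFun g j := rfl

theorem norm_jet_le {s : Finset (ℕ × ℕ)} (g : 𝓢(Euc n, ℂ)) :
    ‖jet n s g‖ ≤ ∑ i ∈ s, SchwartzMap.seminorm ℂ i.1 i.2 g :=
  lp.norm_le_of_forall_le (Finset.sum_nonneg fun _ _ => apply_nonneg _ _)
    fun j => norm_jetFun_le_sum g j

theorem seminorm_le_norm_jet {s : Finset (ℕ × ℕ)} (g : 𝓢(Euc n, ℂ)) {i : ℕ × ℕ} (hi : i ∈ s) :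
    SchwartzMap.seminorm ℂ i.1 i.2 g ≤ ‖jet n s g‖ := by
  refine SchwartzMap.seminorm_le_bound ℂ _ _ _ (norm_nonneg _) fun x => ?_
  have h1 : ‖(‖x‖ ^ i.1 : ℝ) • iteratedFDeriv ℝ i.2 g x‖ ≤ ‖jet n s g‖ := by
    refine ContinuousMultilinearMap.opNorm_le_bound (norm_nonneg _) fun m => ?_
    have h2 := lp.norm_apply_le_norm (by simp) (jet n s g) ⟨⟨i, hi⟩, x, m⟩
    rw [jet_apply] at h2
    simp only [jetFun] at h2
    rw [norm_mul, Complex.norm_real, Real.norm_of_nonneg (by positivity)] at h2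
    rcases eq_or_ne (∏ a, ‖m a‖) 0 with h0 | h0
    · obtain ⟨a, -, ha⟩ := Finset.prod_eq_zero_iff.1 h0
      rw [ContinuousMultilinearMap.map_coord_zero _ a (norm_eq_zero.1 ha)]
      simp [h0]
    · have hpos : 0 < ∏ a, ‖m a‖ := lt_of_le_of_ne (by positivity) h0.symm
      rw [smul_apply, norm_smul, Real.norm_of_nonneg (by positivity)]
      rw [mul_right_comm, ← div_eq_mul_inv, div_le_iff₀ hpos] at h2
      exact h2
  rwa [norm_smul, Real.norm_of_nonneg (by positivity)] at h1

theorem continuous_jet (s : Finset (ℕ × ℕ)) : Continuous (jet n s) := by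
  refine WithSeminorms.continuous_normedSpace_rng _ (schwartz_withSeminorms ℂ (Euc n) ℂ) _
    ⟨s, s.card, ?_⟩
  intro g
  rw [Seminorm.comp_apply, coe_normSeminorm, smul_apply, NNReal.smul_def]
  refine (norm_jet_le g).trans ?_
  rw [smul_eq_mul]
  refine (Finset.sum_le_card_nsmul _ _ _ fun i hi => ?_).trans_eq (nsmul_eq_mul _ _)
  exact Finset.le_sup (f := schwartzSeminormFamily ℂ (Euc n) ℂ) hi g

/-- A tempered distribution extends to a bounded functional on a Banach space of jets. -/
theorem exists_extension_jet (f : 𝓢'(Euc n, ℂ)) :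
    ∃ (s : Finset (ℕ × ℕ)) (F : lp (fun _ : JetIndex n s => ℂ) ∞ →L[ℂ] ℂ),
      ∀ g, F (jet n s g) = f g := by
  obtain ⟨s, C, hC0, hC⟩ := exists_norm_le_sum_seminorm f
  have hb : ∀ g, ‖f g‖ ≤ (C * s.card) * ‖jet n s g‖ := fun g => by
    refine (hC g).trans ?_
    rw [mul_assoc]
    gcongr
    exact (Finset.sum_le_card_nsmul _ _ _ fun i hi => seminorm_le_norm_jet g hi).trans_eq
      (nsmul_eq_mul _ _)
  -- A distribution is controlled by finitely many seminorms, hence by the norm of the jet, and so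
  -- factors through the range of `jet`; Hahn-Banach then extends it to the whole Banach space.
  have hwell : ∀ g h, jet n s g = jet n s h → f g = f h := fun g h hgh => by
    have := hb (g - h)
    rw [map_sub, map_sub, hgh, sub_self, norm_zero, mul_zero] at this
    exact sub_eq_zero.1 (norm_le_zero_iff.1 this)
  have hr : ∀ r : LinearMap.range (jet n s), ∃ g, jet n s g = r := fun r => r.2
  choose c hc using hr
  let F₀ : LinearMap.range (jet n s) →ₗ[ℂ] ℂ :=
    { toFun := fun r => f (c r)
      map_add' := fun a b => by
        rw [← map_add]
        exact hwell _ _ (by rw [map_add, hc, hc, hc]; rfl)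
      map_smul' := fun a b => by
        rw [RingHom.id_apply, ← map_smul]
        exact hwell _ _ (by rw [map_smul, hc, hc]; rfl) }
  let F₁ := F₀.mkContinuous (C * s.card) fun r => by
    have := hb (c r)
    rwa [hc] at this
  obtain ⟨F, hF, -⟩ := exists_extension_norm_eq (LinearMap.range (jet n s)) F₁
  refine ⟨s, F, fun g => ?_⟩
  have := hF ⟨jet n s g, LinearMap.mem_range_self _ g⟩
  rw [this]
  exact hwell _ _ (hc _)

/-- A tempered distribution commutes with the integral of a family of Schwartz functions. -/
theorem apply_eq_integral (f : 𝓢'(Euc n, ℂ)) {G : Euc n → 𝓢(Euc n, ℂ)} (hG : Continuous G)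
    (hgrowth : ∀ s : Finset (ℕ × ℕ), ∃ (C : ℝ) (L : ℕ), 0 ≤ C ∧
      ∀ y, ∑ i ∈ s, SchwartzMap.seminorm ℂ i.1 i.2 (G y) ≤ C * (1 + ‖y‖) ^ L)
    (u g : 𝓢(Euc n, ℂ))
    (hg : ∀ (l : ℕ) (x : Euc n) (m : Fin l → Euc n),
      iteratedFDeriv ℝ l g x m = ∫ y, u y * iteratedFDeriv ℝ l (G y) x m) :
    f g = ∫ y, u y * f (G y) := by
  obtain ⟨s, F, hF⟩ := exists_extension_jet f
  obtain ⟨C, L, hC0, hC⟩ := hgrowth s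
  -- Bochner integrability: the jets of `G y` grow polynomially, against the rapid decay of `u`.
  have hint : Integrable fun y => u y • jet n s (G y) := by
    have h1 : Integrable fun y => C * 2 ^ L * ((1 + ‖y‖ ^ L) * ‖u y‖) := by
      refine Integrable.const_mul ?_ _
      simp only [add_mul, one_mul]
      exact u.integrable.norm.add (u.integrable_pow_mul volume L)
    refine h1.mono' ((u.continuous.smul ((continuous_jet s).comp hG)).aestronglyMeasurable)
      (Eventually.of_forall fun y => ?_)
    rw [norm_smul]
    have h2 : (1 + ‖y‖) ^ L ≤ 2 ^ L * (1 + ‖y‖ ^ L) := by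
      have := add_pow_le (zero_le_one) (norm_nonneg y) L
      rw [one_pow] at this
      refine this.trans ?_
      gcongr
      · norm_num
      · omega
    calc ‖u y‖ * ‖jet n s (G y)‖ ≤ ‖u y‖ * (C * (2 ^ L * (1 + ‖y‖ ^ L))) := by
          gcongr
          exact (norm_jet_le _).trans ((hC y).trans (by gcongr))
      _ = _ := by ring
  -- An identity of bounded families can be checked at each index, where it is the hypothesis on the
  -- derivatives of `g`.
  have hj : jet n s g = ∫ y, u y • jet n s (G y) := by
    ext j
    have h3 := (lp.evalCLM ℂ (fun _ : JetIndex n s => ℂ) ∞ j).integral_comp_comm hint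
    change _ = lp.evalCLM ℂ (fun _ : JetIndex n s => ℂ) ∞ j _
    rw [← h3]
    change jetFun g j = ∫ y, u y * jetFun (G y) j
    simp only [jetFun]
    rw [hg, ← integral_const_mul]
    congr 1; ext y; ring
  rw [← hF, hj, ← F.integral_comp_comm hint]
  congr 1; ext y
  rw [map_smul, hF, smul_eq_mul]

end Exchange

/-! ### Convolution theorems and scale-invariant multiplier estimates -/

noncomputable section FourierSide

variable {n : ℕ}

/-- The character `ξ ↦ exp (2 π i ⟪x, ξ⟫)`. -/
def chr (x ξ : Euc n) : ℂ := Complex.exp (↑(2 * Real.pi * inner ℝ x ξ) * Complex.I)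

theorem chr_comm (x ξ : Euc n) : chr x ξ = chr ξ x := by
  unfold chr; rw [real_inner_comm]

theorem chr_add (x y ξ : Euc n) : chr (x + y) ξ = chr x ξ * chr y ξ := by
  unfold chr
  rw [← Complex.exp_add, inner_add_left]
  congr 1; push_cast; ring

theorem chr_smul (t : ℝ) (x ξ : Euc n) : chr (t • x) ξ = chr x (t • ξ) := by
  unfold chr; rw [inner_smul_left, inner_smul_right]; simp

theorem norm_chr (x ξ : Euc n) : ‖chr x ξ‖ = 1 := Complex.norm_exp_ofReal_mul_I _

theorem fourierInv_apply (g : 𝓢(Euc n, ℂ)) (ξ : Euc n) :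
    𝓕⁻ g ξ = ∫ v, chr v ξ * g v := by
  rw [SchwartzMap.fourierInv_coe, Real.fourierInv_eq']
  rfl

theorem chr_neg_left (x ξ : Euc n) : chr (-x) ξ = chr x (-ξ) := by
  unfold chr; rw [inner_neg_left, inner_neg_right]

theorem fourier_apply (g : 𝓢(Euc n, ℂ)) (ξ : Euc n) : 𝓕 g ξ = ∫ v, chr (-v) ξ * g v := by
  rw [SchwartzMap.fourier_coe, Real.fourier_eq']
  congr 1; ext v
  unfold chr
  rw [inner_neg_left, smul_eq_mul]
  congr 3; push_cast; ring

theorem fourier_fourierInv (g : 𝓢(Euc n, ℂ)) : 𝓕 (𝓕⁻ g : 𝓢(Euc n, ℂ)) = g :=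
  FourierTransform.fourier_fourierInv_eq g

theorem fourierInv_fourier (g : 𝓢(Euc n, ℂ)) : 𝓕⁻ (𝓕 g : 𝓢(Euc n, ℂ)) = g :=
  FourierTransform.fourierInv_fourier_eq g

theorem fourierInv_compSubConstCLM (g : 𝓢(Euc n, ℂ)) (y ξ : Euc n) :
    𝓕⁻ (g.compSubConstCLM ℂ y) ξ = chr y ξ * 𝓕⁻ g ξ := by
  rw [fourierInv_apply, fourierInv_apply, ← integral_const_mul,
    ← integral_sub_right_eq_self (fun v => chr y ξ * (chr v ξ * g v)) y]
  congr 1; ext v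
  rw [SchwartzMap.compSubConstCLM_apply, ← mul_assoc, ← chr_add, add_sub_cancel]

theorem fourierInv_reflect (g : 𝓢(Euc n, ℂ)) (ξ : Euc n) : 𝓕⁻ (reflect g) ξ = 𝓕 g ξ := by
  rw [fourierInv_apply, fourier_apply, ← integral_neg_eq_self]
  congr 1; ext v
  change _ * g (- -v) = _
  rw [neg_neg]

theorem fourierInv_reflectTranslate (g : 𝓢(Euc n, ℂ)) (y ξ : Euc n) :
    𝓕⁻ (reflectTranslate g y) ξ = chr y ξ * 𝓕 g ξ := by
  rw [reflectTranslate_eq, fourierInv_compSubConstCLM, fourierInv_reflect]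

theorem fourier_compSubConstCLM (g : 𝓢(Euc n, ℂ)) (y ξ : Euc n) :
    𝓕 (g.compSubConstCLM ℂ y) ξ = chr (-y) ξ * 𝓕 g ξ := by
  rw [fourier_apply, fourier_apply, ← integral_const_mul,
    ← integral_sub_right_eq_self (fun v => chr (-y) ξ * (chr (-v) ξ * g v)) y]
  congr 1; ext v
  rw [SchwartzMap.compSubConstCLM_apply, ← mul_assoc, ← chr_add]
  congr 2; abel

theorem eq_of_fourierInv_eq {g h : 𝓢(Euc n, ℂ)} (H : ∀ ξ, 𝓕⁻ g ξ = 𝓕⁻ h ξ) : g = h := by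
  have : (𝓕⁻ g : 𝓢(Euc n, ℂ)) = 𝓕⁻ h := SchwartzMap.ext H
  rw [← fourier_fourierInv g, this, fourier_fourierInv]

/-- The convolution theorem. -/
theorem eq_integral_of_fourierInv_eq_mul {g u h : 𝓢(Euc n, ℂ)}
    (H : ∀ ξ, 𝓕⁻ g ξ = 𝓕⁻ u ξ * 𝓕 h ξ) (x : Euc n) : g x = ∫ y, u y * reflectTranslate h y x := by
  set v : 𝓢(Euc n, ℂ) := 𝓕 (h.compSubConstCLM ℂ x) with hv
  have h1 : ∀ ξ, v ξ = chr (-x) ξ * 𝓕 h ξ := fourier_compSubConstCLM h x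
  -- The inverse transform is moved from `u` onto `v`, where it recovers the translate of `h`.
  have h2 := SchwartzMap.integral_fourierInv_mul_eq u v
  have h3 : 𝓕⁻ v = h.compSubConstCLM ℂ x := fourierInv_fourier _
  rw [h3] at h2
  have h4 : g x = ∫ ξ, 𝓕⁻ u ξ * v ξ := by
    conv_lhs => rw [← fourier_fourierInv g]
    rw [fourier_apply]
    congr 1; ext ξ
    rw [H, h1, chr_neg_left, chr_comm]
    ring
  rw [h4, h2]
  congr 1; ext y
  rw [reflectTranslate_apply]; rfl

open LineDeriv in
theorem fourierInv_lineDerivOp_apply (f : 𝓢(Euc n, ℂ)) (m ξ : Euc n) :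
    𝓕⁻ (∂_{m} f) ξ = -(2 * Real.pi * Complex.I * inner ℝ ξ m) * 𝓕⁻ f ξ := by
  rw [SchwartzMap.fourierInv_lineDerivOp_eq, neg_smul]
  have : (inner ℝ · m : Euc n → ℝ).HasTemperateGrowth := by fun_prop
  change -((2 * Real.pi * Complex.I) * (SchwartzMap.smulLeftCLM ℂ (inner ℝ · m : Euc n → ℝ) (𝓕⁻ f)) ξ) = _
  rw [SchwartzMap.smulLeftCLM_apply_apply this]
  simp only [Complex.real_smul]
  ring

open LineDeriv in
theorem fourier_lineDerivOp_apply (f : 𝓢(Euc n, ℂ)) (m ξ : Euc n) :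
    𝓕 (∂_{m} f) ξ = (2 * Real.pi * Complex.I * inner ℝ ξ m) * 𝓕 f ξ := by
  rw [SchwartzMap.fourier_lineDerivOp_eq]
  have : (inner ℝ · m : Euc n → ℝ).HasTemperateGrowth := by fun_prop
  change ((2 * Real.pi * Complex.I) * (SchwartzMap.smulLeftCLM ℂ (inner ℝ · m : Euc n → ℝ) (𝓕 f)) ξ) = _
  rw [SchwartzMap.smulLeftCLM_apply_apply this]
  simp only [Complex.real_smul]
  ring

-- Convolutions are stable under differentiation: the derivatives fall on `h`, each with a minus
-- sign because `h` enters reflected. This verifies the derivative hypothesis of `apply_eq_integral`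
-- in all orders.
open LineDeriv in
theorem exists_iteratedLineDerivOp_eq {g u h : 𝓢(Euc n, ℂ)}
    (H : ∀ ξ, 𝓕⁻ g ξ = 𝓕⁻ u ξ * 𝓕 h ξ) (l : ℕ) (m : Fin l → Euc n) :
    ∃ h' : 𝓢(Euc n, ℂ), (∀ ξ, 𝓕⁻ (∂^{m} g) ξ = 𝓕⁻ u ξ * 𝓕 h' ξ) ∧
      ∀ y, ∂^{m} (reflectTranslate h y) = reflectTranslate h' y := by
  induction l with
  | zero => exact ⟨h, H, fun y => rfl⟩
  | succ l ih =>
    obtain ⟨h', h1, h2⟩ := ih (Fin.tail m)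
    have hF : ∀ ξ, 𝓕 (-∂_{m 0} h') ξ =
        -(2 * Real.pi * Complex.I * inner ℝ ξ (m 0)) * 𝓕 h' ξ := fun ξ => by
      have : 𝓕 (-∂_{m 0} h') = -𝓕 (∂_{m 0} h') := by
        exact map_neg (FourierTransform.fourierCLM ℂ 𝓢(Euc n, ℂ)) (∂_{m 0} h')
      rw [this]
      change -(𝓕 (∂_{m 0} h') ξ) = _
      rw [fourier_lineDerivOp_apply]; ring
    refine ⟨-∂_{m 0} h', fun ξ => ?_, fun y => ?_⟩
    · rw [iteratedLineDerivOp_succ_left, fourierInv_lineDerivOp_apply, h1, hF]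
      ring
    · rw [iteratedLineDerivOp_succ_left, h2]
      refine eq_of_fourierInv_eq fun ξ => ?_
      rw [fourierInv_lineDerivOp_apply, fourierInv_reflectTranslate, fourierInv_reflectTranslate,
        hF]
      ring

/-- The action of a tempered distribution on a convolution. -/
theorem apply_eq_integral_conv (f : 𝓢'(Euc n, ℂ)) {g u h : 𝓢(Euc n, ℂ)}
    (H : ∀ ξ, 𝓕⁻ g ξ = 𝓕⁻ u ξ * 𝓕 h ξ) : f g = ∫ y, u y * conv h f y := by
  refine apply_eq_integral f (continuous_reflectTranslate h)
    (exists_sum_seminorm_reflectTranslate_le h) u g fun l x m => ?_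
  obtain ⟨h', h1, h2⟩ := exists_iteratedLineDerivOp_eq H l m
  rw [← SchwartzMap.iteratedLineDerivOp_eq_iteratedFDeriv, eq_integral_of_fourierInv_eq_mul h1]
  congr 1; ext y
  rw [← SchwartzMap.iteratedLineDerivOp_eq_iteratedFDeriv, h2]

/-- Associativity of the convolution with a tempered distribution. -/
theorem conv_eq_integral (f : 𝓢'(Euc n, ℂ)) {c g h : 𝓢(Euc n, ℂ)}
    (H : ∀ ξ, 𝓕 c ξ = 𝓕 g ξ * 𝓕 h ξ) (x : Euc n) :
    conv c f x = ∫ y, g (x - y) * conv h f y := by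
  rw [conv, apply_eq_integral_conv f (g := reflectTranslate c x) (u := reflectTranslate g x)
    (h := h) fun ξ => by rw [fourierInv_reflectTranslate, fourierInv_reflectTranslate, H]; ring]
  simp only [reflectTranslate_apply]

theorem enorm_conv_le (f : 𝓢'(Euc n, ℂ)) {c g h : 𝓢(Euc n, ℂ)}
    (H : ∀ ξ, 𝓕 c ξ = 𝓕 g ξ * 𝓕 h ξ) (x : Euc n) :
    ‖conv c f x‖ₑ ≤ ∫⁻ y, ‖g (x - y)‖ₑ * ‖conv h f y‖ₑ := by
  rw [conv_eq_integral f H]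
  refine (enorm_integral_le_lintegral_enorm _).trans_eq ?_
  simp only [enorm_mul]

/-- The Schwartz function with Fourier transform `𝓕 κ (t⁻¹ ξ)`, i.e. `t ^ n * κ (t x)`. -/
def dilate (t : ℝ) (ht : t ≠ 0) (κ : 𝓢(Euc n, ℂ)) : 𝓢(Euc n, ℂ) :=
  𝓕⁻ (SchwartzMap.compCLMOfContinuousLinearEquiv ℂ
    (ContinuousLinearEquiv.smulLeft (Units.mk0 t⁻¹ (inv_ne_zero ht))) (𝓕 κ))

theorem fourier_dilate {t : ℝ} (ht : t ≠ 0) (κ : 𝓢(Euc n, ℂ)) (ξ : Euc n) :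
    𝓕 (dilate t ht κ) ξ = 𝓕 κ (t⁻¹ • ξ) := by
  rw [dilate, fourier_fourierInv]
  rfl

theorem dilate_apply {t : ℝ} (ht : 0 < t) (κ : 𝓢(Euc n, ℂ)) (x : Euc n) :
    dilate t ht.ne' κ x = (t ^ n : ℝ) * κ (t • x) := by
  rw [dilate, fourierInv_apply]
  conv_rhs => rw [← fourierInv_fourier κ]
  rw [fourierInv_apply]
  have := Measure.integral_comp_inv_smul_of_nonneg volume (fun v => chr v (t • x) * 𝓕 κ v) ht.le
  rw [finrank_euclideanSpace_fin, Complex.real_smul] at this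
  rw [← this]
  congr 1; ext v
  rw [← chr_smul, smul_inv_smul₀ ht.ne']
  rfl

/-- Scale invariant estimates for multipliers acting on a piece of a tempered distribution which
is reproduced by the kernel `κ`. -/
theorem exists_conv_bound (κ κ' : 𝓢(Euc n, ℂ)) {p : ℝ≥0∞} (hp : p ≠ 0) :
    ∃ C : ℝ≥0, ∀ (t : ℝ) (f : 𝓢'(Euc n, ℂ)) (h c : 𝓢(Euc n, ℂ)), 0 < t →
      (∀ ξ, 𝓕 κ (t⁻¹ • ξ) * 𝓕 h ξ = 𝓕 h ξ) → (∀ ξ, 𝓕 c ξ = 𝓕 κ' (t⁻¹ • ξ) * 𝓕 h ξ) →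
      eLpNorm (conv c f) p volume ≤ C * eLpNorm (conv h f) p volume ∧
      ∀ x, ‖conv c f x‖ₑ ≤
        C * ENNReal.ofReal (t ^ (n / p.toReal)) * eLpNorm (conv h f) p volume := by
  obtain ⟨C, hC⟩ := exists_bandlimited_bound κ κ' hp
  refine ⟨C, fun t f h c ht h1 h2 => hC t (conv h f) (conv c f) ht (continuous_conv h f)
    (exists_enorm_conv_le h f) (fun x => ?_) fun x => ?_⟩
  all_goals
    rw [← lintegral_const_mul' _ _ ENNReal.ofReal_ne_top]
  · refine (enorm_conv_le f (g := dilate t ht.ne' κ) (h := h) (fun ξ => by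
      rw [fourier_dilate, h1]) x).trans_eq (lintegral_congr fun y => ?_)
    rw [dilate_apply ht, enorm_mul, mul_assoc, ← ofReal_norm (((t ^ n : ℝ) : ℂ)), Complex.norm_real,
      Real.norm_of_nonneg (by positivity)]
  · refine (enorm_conv_le f (g := dilate t ht.ne' κ') (h := h) (fun ξ => by
      rw [fourier_dilate, h2]) x).trans_eq (lintegral_congr fun y => ?_)
    rw [dilate_apply ht, enorm_mul, mul_assoc, ← ofReal_norm (((t ^ n : ℝ) : ℂ)), Complex.norm_real,
      Real.norm_of_nonneg (by positivity)]

end FourierSide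

/-! ### Littlewood-Paley families and reconstruction -/

noncomputable section LittlewoodPaley

variable {n : ℕ}

namespace IsLittlewoodPaley

variable {φ : ℕ → 𝓢(Euc n, ℂ)}

/-- Compactness turns the open conditions on `φ 0` into a uniform margin. It makes the symbols
constant on whole annuli and gives the strict room used in the support estimates. -/
theorem exists_margin (hφ : IsLittlewoodPaley φ) :
    ∃ δ : ℝ, 0 < δ ∧ δ < 1 / 4 ∧ (∀ ξ : Euc n, ‖ξ‖ ≤ 1 + δ → 𝓕 (φ 0) ξ = 1) ∧
      ∀ ξ : Euc n, 2 - δ ≤ ‖ξ‖ → 𝓕 (φ 0) ξ = 0 := by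
  obtain ⟨ε, hε, h1⟩ := (isCompact_closedBall (0 : Euc n) 1).exists_cthickening_subset_open
    isOpen_interior (subset_interior_iff_mem_nhdsSet.2 hφ.eq_one)
  rw [cthickening_closedBall hε.le zero_le_one] at h1
  obtain ⟨r, ⟨hr0, hr2⟩, hr⟩ := exists_pos_lt_subset_ball (zero_lt_two' ℝ)
    (isClosed_tsupport _) hφ.tsupport_subset
  refine ⟨min ε (min (2 - r) (1 / 8)), by
    simp only [lt_min_iff]; exact ⟨hε, by linarith, by norm_num⟩, ?_, fun ξ hξ => ?_, fun ξ hξ => ?_⟩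
  · exact ((min_le_right _ _).trans (min_le_right _ _)).trans_lt (by norm_num)
  · refine (interior_subset (h1 ?_) : ξ ∈ {x | 𝓕 (φ 0) x = 1})
    rw [mem_closedBall_zero_iff]
    linarith [min_le_left ε (min (2 - r) (1 / 8))]
  · refine image_eq_zero_of_notMem_tsupport fun h => ?_
    have h2 := hr h
    rw [mem_ball_zero_iff] at h2
    linarith [(min_le_right ε (min (2 - r) (1 / 8))).trans (min_le_left _ _)]

theorem fourier_succ (hφ : IsLittlewoodPaley φ) (j : ℕ) (ξ : Euc n) :
    𝓕 (φ (j + 1)) ξ = 𝓕 (φ 0) (((2 : ℝ) ^ (j + 1))⁻¹ • ξ) - 𝓕 (φ 0) (((2 : ℝ) ^ j)⁻¹ • ξ) := by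
  rw [hφ.succ (j + 1) ξ (by omega)]
  have h1 : (2 : ℝ) ^ (-((j + 1 : ℕ) : ℤ)) = ((2 : ℝ) ^ (j + 1))⁻¹ := by
    rw [zpow_neg, zpow_natCast]
  have h2 : (2 : ℝ) ^ (1 - ((j + 1 : ℕ) : ℤ)) = ((2 : ℝ) ^ j)⁻¹ := by
    rw [← zpow_natCast, ← zpow_neg]; congr 1; push_cast; ring
  rw [h1, h2]

theorem sum_fourier (hφ : IsLittlewoodPaley φ) (J : ℕ) (ξ : Euc n) :
    ∑ j ∈ Finset.range (J + 1), 𝓕 (φ j) ξ = 𝓕 (φ 0) (((2 : ℝ) ^ J)⁻¹ • ξ) := by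
  induction J with
  | zero => simp
  | succ J ih => rw [Finset.sum_range_succ, ih, hφ.fourier_succ]; ring

theorem norm_inv_pow_smul (j : ℕ) (ξ : Euc n) : ‖((2 : ℝ) ^ j)⁻¹ • ξ‖ = ‖ξ‖ / 2 ^ j := by
  rw [norm_smul, Real.norm_of_nonneg (by positivity), inv_mul_eq_div]

theorem fourier_eq_zero_of_le_norm (hφ : IsLittlewoodPaley φ) {j : ℕ} {ξ : Euc n}
    (hξ : 2 ^ (j + 1) ≤ ‖ξ‖) : 𝓕 (φ j) ξ = 0 := by
  obtain ⟨δ, hδ, -, -, h0⟩ := hφ.exists_margin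
  cases j with
  | zero => exact h0 ξ (by norm_num at hξ; linarith)
  | succ j =>
    rw [hφ.fourier_succ, h0, h0, sub_zero]
    all_goals rw [norm_inv_pow_smul, le_div_iff₀ (by positivity)]
    all_goals have : (0 : ℝ) < 2 ^ j := by positivity
    all_goals rw [pow_succ, pow_succ] at hξ
    · nlinarith
    · rw [pow_succ]; nlinarith

theorem fourier_succ_eq_zero_of_norm_le (hφ : IsLittlewoodPaley φ) {j : ℕ} {ξ : Euc n}
    (hξ : ‖ξ‖ ≤ 2 ^ j) : 𝓕 (φ (j + 1)) ξ = 0 := by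
  obtain ⟨δ, hδ, -, h1, -⟩ := hφ.exists_margin
  have : (0 : ℝ) < 2 ^ j := by positivity
  rw [hφ.fourier_succ, h1, h1, sub_self]
  all_goals rw [norm_inv_pow_smul, div_le_iff₀ (by positivity)]
  · nlinarith
  · rw [pow_succ]; nlinarith

/-- Outside the ball of radius `2 ^ (j + 1)` the symbol of `φ j` vanishes, inside it the dilated
symbol of `φ 0` is one. Hence the single kernel `φ 0`, at scale `t = 2 ^ (j + 1)`, reproduces every
piece in `exists_conv_bound`. -/
theorem reproduce (hφ : IsLittlewoodPaley φ) (j : ℕ) (ξ : Euc n) :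
    𝓕 (φ 0) (((2 : ℝ) ^ (j + 1))⁻¹ • ξ) * 𝓕 (φ j) ξ = 𝓕 (φ j) ξ := by
  rcases le_total (2 ^ (j + 1)) ‖ξ‖ with h | h
  · rw [hφ.fourier_eq_zero_of_le_norm h, mul_zero]
  · obtain ⟨δ, hδ, -, h1, -⟩ := hφ.exists_margin
    rw [h1, one_mul]
    rw [norm_inv_pow_smul, div_le_iff₀ (by positivity)]
    have : (0 : ℝ) < 2 ^ (j + 1) := by positivity
    nlinarith

end IsLittlewoodPaley

/-- The pointwise product of two Schwartz functions. -/
def schwartzMul (a b : 𝓢(Euc n, ℂ)) : 𝓢(Euc n, ℂ) := SchwartzMap.smulLeftCLM ℂ a b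

theorem schwartzMul_apply (a b : 𝓢(Euc n, ℂ)) (ξ : Euc n) : schwartzMul a b ξ = a ξ * b ξ := by
  rw [schwartzMul, SchwartzMap.smulLeftCLM_apply_apply a.hasTemperateGrowth, smul_eq_mul]

/-- Smooth frequency cut-offs approximate the identity in the Schwartz space. -/
theorem tendsto_smul_dilated {χ : 𝓢(Euc n, ℂ)} (hχ : ∀ ξ, ‖ξ‖ ≤ 1 → χ ξ = 1)
    {G : 𝓢(Euc n, ℂ)} {H : ℕ → 𝓢(Euc n, ℂ)}
    (hH : ∀ J ξ, H J ξ = χ (((2 : ℝ) ^ J)⁻¹ • ξ) * G ξ) : Tendsto H atTop (𝓝 G) := by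
  refine ((schwartz_withSeminorms ℂ (Euc n) ℂ).tendsto_nhds _ _).2 fun ⟨k, l⟩ ε hε => ?_
  choose D hD0 hD using fun i => exists_one_add_pow_mul_iteratedFDeriv_le χ 0 i
  choose A hA0 hA using fun i => exists_one_add_pow_mul_iteratedFDeriv_le G (k + 1) i
  simp only [pow_zero, one_mul] at hD
  set r : ℕ → Euc n → ℂ := fun J ξ => χ (((2 : ℝ) ^ J)⁻¹ • ξ) - 1 with hr
  have hχs : ∀ J (N : ℕ), ContDiff ℝ N fun ξ => χ (((2 : ℝ) ^ J)⁻¹ • ξ) := fun J N =>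
    (χ.smooth N).comp (contDiff_const_smul _)
  have hrs : ∀ J (N : ℕ), ContDiff ℝ N (r J) := fun J N => (hχs J N).sub contDiff_const
  -- The error symbol `r J` vanishes for `‖ξ‖ < 2 ^ J`; elsewhere `1 ≤ 2 ^ (-J) * (1 + ‖ξ‖)`. One
  -- extra power of decay of `G` thus buys the factor `2 ^ (-J)`.
  have hrb : ∀ J i ξ, ‖iteratedFDeriv ℝ i (r J) ξ‖ ≤
      ((2 : ℝ) ^ J)⁻¹ * ((D i + 1) * (1 + ‖ξ‖)) := by
    intro J i ξ
    have h2J : (0 : ℝ) < 2 ^ J := by positivity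
    have hDi := hD0 i
    rcases lt_or_ge ‖ξ‖ (2 ^ J) with h | h
    · have h0 : r J =ᶠ[𝓝 ξ] fun _ => 0 := by
        filter_upwards [continuous_norm.continuousAt.eventually (gt_mem_nhds h)] with ζ hζ
        simp only [hr]
        rw [hχ, sub_self]
        rw [IsLittlewoodPaley.norm_inv_pow_smul, div_le_one h2J]
        exact hζ.le
      rw [(h0.iteratedFDeriv ℝ i).self_of_nhds]
      have : iteratedFDeriv ℝ i (fun _ : Euc n => (0 : ℂ)) ξ = 0 := by
        have := iteratedFDeriv_fun_zero (𝕜 := ℝ) (E := Euc n) (F := ℂ) (n := i)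
        exact congrFun this ξ
      rw [this, norm_zero]
      positivity
    · have h1 : ‖iteratedFDeriv ℝ i (r J) ξ‖ ≤ D i + 1 := by
        rcases Nat.eq_zero_or_pos i with rfl | hi
        · rw [norm_iteratedFDeriv_zero]
          refine (norm_sub_le _ _).trans ?_
          rw [norm_one]
          gcongr
          simpa using hD 0 (((2 : ℝ) ^ J)⁻¹ • ξ)
        · have h3 : iteratedFDeriv ℝ i (r J) ξ =
              (((2 : ℝ) ^ J)⁻¹) ^ i • iteratedFDeriv ℝ i χ (((2 : ℝ) ^ J)⁻¹ • ξ) := by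
            have h4 := iteratedFDeriv_sub_apply (x := ξ) (hχs J i).contDiffAt
              (contDiff_const (c := (1 : ℂ)) (𝕜 := ℝ) (n := i)).contDiffAt
            rw [iteratedFDeriv_const_of_ne hi.ne', iteratedFDeriv_comp_const_smul _ (χ.smooth i)]
              at h4
            exact h4.trans (sub_zero _)
          rw [h3, norm_smul, norm_pow, Real.norm_of_nonneg (by positivity)]
          have h5 : (((2 : ℝ) ^ J)⁻¹) ^ i ≤ 1 :=
            pow_le_one₀ (by positivity) (inv_le_one_of_one_le₀ (one_le_pow₀ (by norm_num)))
          nlinarith [hD i (((2 : ℝ) ^ J)⁻¹ • ξ), norm_nonneg (iteratedFDeriv ℝ i χ (((2 : ℝ) ^ J)⁻¹ • ξ))]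
      refine h1.trans ?_
      rw [inv_mul_eq_div, le_div_iff₀ h2J]
      gcongr
      linarith
  set C : ℝ := ∑ i ∈ Finset.range (l + 1), (l.choose i : ℝ) * (D i + 1) * A (l - i) with hC
  have hC0 : 0 ≤ C := Finset.sum_nonneg fun i _ => by
    have := hD0 i; have := hA0 (l - i); positivity
  have hbound : ∀ J, SchwartzMap.seminorm ℂ k l (H J - G) ≤ C * ((2 : ℝ)⁻¹) ^ J := by
    intro J
    refine SchwartzMap.seminorm_le_bound ℂ k l _ (by positivity) fun ξ => ?_
    have h1 : (⇑(H J - G) : Euc n → ℂ) = fun ξ => r J ξ * G ξ := by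
      ext ξ
      change H J ξ - G ξ = _
      rw [hH, hr]; ring
    rw [h1]
    calc _ ≤ (1 + ‖ξ‖) ^ k * ∑ i ∈ Finset.range (l + 1),
          (l.choose i : ℝ) * ‖iteratedFDeriv ℝ i (r J) ξ‖ * ‖iteratedFDeriv ℝ (l - i) G ξ‖ := by
          gcongr
          · linarith
          · exact norm_iteratedFDeriv_mul_le (hrs J l) (G.smooth l) ξ le_rfl
      _ ≤ C * ((2 : ℝ)⁻¹) ^ J := by
          rw [hC, Finset.mul_sum, Finset.sum_mul]
          refine Finset.sum_le_sum fun i _ => ?_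
          have h6 := hA (l - i) ξ
          have h7 := hrb J i ξ
          have := hD0 i
          calc _ ≤ (1 + ‖ξ‖) ^ k * ((l.choose i : ℝ) * (((2 : ℝ) ^ J)⁻¹ * ((D i + 1) * (1 + ‖ξ‖))) *
                ‖iteratedFDeriv ℝ (l - i) G ξ‖) := by gcongr
            _ = ((l.choose i : ℝ) * (D i + 1) * ((1 + ‖ξ‖) ^ (k + 1) *
                ‖iteratedFDeriv ℝ (l - i) G ξ‖)) * ((2 : ℝ)⁻¹) ^ J := by
                rw [inv_pow]; ring
            _ ≤ _ := by gcongr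
  have hlim : Tendsto (fun J : ℕ => C * ((2 : ℝ)⁻¹) ^ J) atTop (𝓝 0) := by
    simpa using (tendsto_pow_atTop_nhds_zero_of_lt_one (r := (2 : ℝ)⁻¹)
      (by norm_num) (by norm_num)).const_mul C
  filter_upwards [hlim.eventually (gt_mem_nhds hε)] with J hJ
  exact (hbound J).trans_lt hJ

/-- The frequency localization `piece h g` of `g`, for which `𝓕⁻ (piece h g) = 𝓕 h * 𝓕⁻ g`. -/
def piece (h g : 𝓢(Euc n, ℂ)) : 𝓢(Euc n, ℂ) := 𝓕 (schwartzMul (𝓕 h) (𝓕⁻ g))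

theorem fourierInv_piece (h g : 𝓢(Euc n, ℂ)) (ξ : Euc n) :
    𝓕⁻ (piece h g) ξ = 𝓕 h ξ * 𝓕⁻ g ξ := by
  rw [piece, fourierInv_fourier, schwartzMul_apply]

/-- The partial sums of the symbols telescope to a dilated cut-off, to which `tendsto_smul_dilated`
applies on the Fourier side. -/
theorem IsLittlewoodPaley.tendsto_sum_piece {φ : ℕ → 𝓢(Euc n, ℂ)} (hφ : IsLittlewoodPaley φ)
    (f : 𝓢'(Euc n, ℂ)) (g : 𝓢(Euc n, ℂ)) :
    Tendsto (fun J => ∑ j ∈ Finset.range (J + 1), f (piece (φ j) g)) atTop (𝓝 (f g)) := by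
  obtain ⟨δ, hδ, -, h1, -⟩ := hφ.exists_margin
  have h2 : Tendsto (fun J => ∑ j ∈ Finset.range (J + 1), schwartzMul (𝓕 (φ j)) (𝓕⁻ g)) atTop
      (𝓝 (𝓕⁻ g)) := by
    refine tendsto_smul_dilated (χ := 𝓕 (φ 0)) (fun ξ hξ => h1 ξ (by linarith)) fun J ξ => ?_
    rw [sum_apply, ← hφ.sum_fourier, Finset.sum_mul]
    simp only [schwartzMul_apply]
  have h3 : Tendsto _ atTop (𝓝 (f (𝓕 (𝓕⁻ g : 𝓢(Euc n, ℂ))))) := ((f.continuous.comp (FourierTransform.fourierCLM ℂ 𝓢(Euc n, ℂ)).continuous).tendsto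
    (𝓕⁻ g)).comp h2
  rw [fourier_fourierInv] at h3
  refine Tendsto.congr (fun J => ?_) h3
  rw [Function.comp_apply, Function.comp_apply, map_sum]
  exact map_sum f _ _

end LittlewoodPaley

/-! ### Embedding of Besov spaces into the tempered distributions -/

noncomputable section Embedding

variable {n : ℕ}

/-- A Schwartz function whose Fourier transform inverts `‖ξ‖ ^ (2 N)` on the dyadic annulus. -/
theorem exists_fourier_eq_inv_norm_pow {χ : 𝓢(Euc n, ℂ)} (h1 : ∀ ξ : Euc n, ‖ξ‖ ≤ 1 → χ ξ = 1)
    (h0 : ∀ ξ : Euc n, 2 ≤ ‖ξ‖ → χ ξ = 0) (N : ℕ) :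
    ∃ θ : 𝓢(Euc n, ℂ), ∀ ξ : Euc n, 1 / 4 ≤ ‖ξ‖ → ‖ξ‖ ≤ 1 →
      (((‖ξ‖ ^ 2) ^ N : ℝ) : ℂ) * 𝓕 θ ξ = 1 := by
  -- The difference `χ ξ - χ (8 ξ)` equals one for `1/4 ≤ ‖ξ‖ ≤ 1` and vanishes near the origin,
  -- where the negative power is singular.
  set b : Euc n → ℂ := fun ξ => (χ ξ - χ ((8 : ℝ) • ξ)) * ((((‖ξ‖ ^ 2) ^ N)⁻¹ : ℝ) : ℂ) with hb
  have hb0 : ∀ ξ : Euc n, ‖ξ‖ < 1 / 8 → b ξ = 0 := fun ξ hξ => by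
    simp only [hb]
    rw [h1, h1, sub_self, zero_mul]
    · rw [norm_smul, Real.norm_of_nonneg (by norm_num)]; linarith
    · linarith
  have hsm : ContDiff ℝ ((⊤ : ℕ∞) : WithTop ℕ∞) b := by
    rw [contDiff_iff_contDiffAt]
    intro ξ
    rcases eq_or_ne ξ 0 with rfl | hξ
    · refine (contDiffAt_const (c := (0 : ℂ))).congr_of_eventuallyEq ?_
      filter_upwards [Metric.ball_mem_nhds (0 : Euc n) (by norm_num : (0 : ℝ) < 1 / 8)] with ζ hζ
      exact hb0 ζ (mem_ball_zero_iff.1 hζ)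
    · have h3 : ContDiffAt ℝ ((⊤ : ℕ∞) : WithTop ℕ∞) (fun ξ : Euc n => ((‖ξ‖ ^ 2) ^ N)⁻¹) ξ := by
        refine ContDiffAt.inv ?_ (by positivity)
        exact ((contDiff_norm_sq ℝ).pow N).contDiffAt
      refine ContDiffAt.mul ?_ (Complex.ofRealCLM.contDiff.contDiffAt.comp ξ h3)
      exact ((χ.smooth _).sub ((χ.smooth _).comp (contDiff_const_smul _))).contDiffAt
  have hcs : HasCompactSupport b := by
    refine HasCompactSupport.intro (isCompact_closedBall (0 : Euc n) 2) fun ξ hξ => ?_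
    rw [mem_closedBall_zero_iff, not_le] at hξ
    simp only [hb]
    rw [h0 _ hξ.le, h0, sub_self, zero_mul]
    rw [norm_smul, Real.norm_of_nonneg (by norm_num)]; linarith
  refine ⟨𝓕⁻ (hcs.toSchwartzMap hsm), fun ξ hξ1 hξ2 => ?_⟩
  rw [fourier_fourierInv]
  change _ * b ξ = 1
  simp only [hb]
  have hpos : (0 : ℝ) < ‖ξ‖ := by linarith
  rw [h1 ξ hξ2, h0, sub_zero, one_mul, ← Complex.ofReal_mul, mul_inv_cancel₀ (by positivity)]
  · simp
  · rw [norm_smul, Real.norm_of_nonneg (by norm_num)]; linarith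

/-- The multiplier `‖ξ‖ ^ (2 N)` on the Schwartz space. -/
def normPowMultiplier (n N : ℕ) : 𝓢(Euc n, ℂ) →L[ℂ] 𝓢(Euc n, ℂ) :=
  (FourierTransform.fourierCLM ℂ 𝓢(Euc n, ℂ)) ∘L
    (SchwartzMap.smulLeftCLM ℂ fun ξ : Euc n => (((‖ξ‖ ^ 2) ^ N : ℝ) : ℂ)) ∘L
    (FourierTransform.fourierInvCLM ℂ 𝓢(Euc n, ℂ))

theorem fourierInv_normPowMultiplier (N : ℕ) (g : 𝓢(Euc n, ℂ)) (ξ : Euc n) :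
    𝓕⁻ (normPowMultiplier n N g) ξ = (((‖ξ‖ ^ 2) ^ N : ℝ) : ℂ) * 𝓕⁻ g ξ := by
  change 𝓕⁻ (𝓕 (SchwartzMap.smulLeftCLM ℂ (fun ξ : Euc n => (((‖ξ‖ ^ 2) ^ N : ℝ) : ℂ))
    (𝓕⁻ g : 𝓢(Euc n, ℂ))) : 𝓢(Euc n, ℂ)) ξ = _
  rw [fourierInv_fourier, SchwartzMap.smulLeftCLM_apply_apply, smul_eq_mul]
  exact Complex.ofRealCLM.hasTemperateGrowth.comp
    ((Function.hasTemperateGrowth_norm_sq (H := Euc n)).pow N)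

theorem weight_ne_zero (s : ℝ) (j : ℕ) : weight s j ≠ 0 := by
  unfold weight
  rw [ne_eq, ENNReal.ofReal_eq_zero, not_le]; positivity

theorem weight_ne_top (s : ℝ) (j : ℕ) : weight s j ≠ ∞ := ENNReal.ofReal_ne_top

theorem weight_mul_eLpNorm_le_besovNorm (φ : ℕ → 𝓢(Euc n, ℂ)) (s : ℝ) (p : ℝ≥0∞) {q : ℝ≥0∞}
    (hq : q ≠ 0) (f : 𝓢'(Euc n, ℂ)) (j : ℕ) :
    weight s j * eLpNorm (conv (φ j) f) p volume ≤ besovNorm φ s p q f := by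
  have := enorm_le_eLpNorm_count
    (fun j : ℕ => weight s j * eLpNorm (conv (φ j) f) p volume) j hq
  simpa [besovNorm] using this

theorem eLpNorm_conv_le_besovNorm (φ : ℕ → 𝓢(Euc n, ℂ)) (s : ℝ) (p : ℝ≥0∞) {q : ℝ≥0∞}
    (hq : q ≠ 0) (f : 𝓢'(Euc n, ℂ)) (j : ℕ) :
    eLpNorm (conv (φ j) f) p volume ≤ (weight s j)⁻¹ * besovNorm φ s p q f := by
  rw [← ENNReal.div_eq_inv_mul, ENNReal.le_div_iff_mul_le (Or.inl (weight_ne_zero s j))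
    (Or.inl (weight_ne_top s j)), mul_comm]
  exact weight_mul_eLpNorm_le_besovNorm φ s p hq f j

/-- Duality of `L^1` and `L^∞`: the pointwise Nikolskii bound on a piece becomes a bound on its
pairing with a test function. -/
theorem enorm_apply_le (f : 𝓢'(Euc n, ℂ)) {g u c : 𝓢(Euc n, ℂ)}
    (H : ∀ ξ, 𝓕⁻ g ξ = 𝓕⁻ u ξ * 𝓕 c ξ) {M : ℝ≥0∞} (hM : ∀ x, ‖conv c f x‖ₑ ≤ M) :
    ‖f g‖ₑ ≤ eLpNorm u 1 volume * M := by
  rw [apply_eq_integral_conv f H, eLpNorm_one_eq_lintegral_enorm]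
  refine (enorm_integral_le_lintegral_enorm _).trans ?_
  rw [← lintegral_mul_const _ u.continuous.enorm.measurable]
  refine lintegral_mono fun y => ?_
  rw [enorm_mul]
  exact mul_le_mul' le_rfl (hM y)

/-- The Besov spaces are continuously embedded into the tempered distributions. -/
theorem exists_enorm_apply_le_besovNorm {φ : ℕ → 𝓢(Euc n, ℂ)} (hφ : IsLittlewoodPaley φ)
    (s : ℝ) {p q : ℝ≥0∞} (hp : p ≠ 0) (hq : q ≠ 0) :
    ∃ P : 𝓢(Euc n, ℂ) → ℝ≥0, Continuous P ∧ P 0 = 0 ∧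
      ∀ f g, ‖f g‖ₑ ≤ P g * besovNorm φ s p q f := by
  obtain ⟨δ, hδ, -, h1, h0⟩ := hφ.exists_margin
  -- With `2 N ≥ n / p - s + 1` the high-frequency pieces decay like `2 ^ (-j)`, despite the
  -- Nikolskii loss and the weight.
  obtain ⟨N, hN⟩ := exists_nat_ge ((n / p.toReal - s + 1) / 2)
  obtain ⟨θ, hθ⟩ := exists_fourier_eq_inv_norm_pow (χ := 𝓕 (φ 0))
    (fun ξ hξ => h1 ξ (by linarith)) (fun ξ hξ => h0 ξ (by linarith)) N
  obtain ⟨C₀, hC₀⟩ := exists_conv_bound (φ 0) (φ 0) hp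
  obtain ⟨C₁, hC₁⟩ := exists_conv_bound (φ 0) θ hp
  set d : ℝ := n / p.toReal with hd
  set A : ℝ := 2 ^ (d - 2 * N) with hA
  have hA0 : 0 ≤ A := by positivity
  -- the low frequency piece
  have hlow : ∀ (f : 𝓢'(Euc n, ℂ)) (g : 𝓢(Euc n, ℂ)), ‖f (piece (φ 0) g)‖ₑ ≤
      (C₀ * ENNReal.ofReal (2 ^ d)) * (eLpNorm g 1 volume * besovNorm φ s p q f) := fun f g => by
    have h2 := (hC₀ 2 f (φ 0) (φ 0) (by norm_num) (fun ξ => by simpa using hφ.reproduce 0 ξ)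
      (fun ξ => by simpa using (hφ.reproduce 0 ξ).symm)).2
    have h3 := eLpNorm_conv_le_besovNorm φ s p hq f 0
    rw [show weight s 0 = 1 by simp [weight], inv_one, one_mul] at h3
    refine (enorm_apply_le f (u := g) (c := φ 0) (fun ξ => ?_) h2).trans ?_
    · rw [fourierInv_piece, mul_comm]
    · calc _ ≤ eLpNorm g 1 volume * (C₀ * ENNReal.ofReal (2 ^ d) * besovNorm φ s p q f) := by
            gcongr
        _ = _ := by ring
  have hhigh : ∀ (f : 𝓢'(Euc n, ℂ)) (g : 𝓢(Euc n, ℂ)) (j : ℕ), ‖f (piece (φ (j + 1)) g)‖ₑ ≤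
      (C₁ * ENNReal.ofReal A) * (eLpNorm (normPowMultiplier n N g) 1 volume *
        besovNorm φ s p q f) * (2⁻¹) ^ j := by
    intro f g j
    -- Division by `t` carries the annulus `2 ^ j < ‖ξ‖ < 2 ^ (j + 2)` into `1/4 < ‖ξ‖ < 1`, where
    -- `θ` inverts the power of the norm.
    set t : ℝ := 2 ^ (j + 2) with ht
    have ht0 : 0 < t := by positivity
    set c : 𝓢(Euc n, ℂ) := 𝓕⁻ (schwartzMul (𝓕 (dilate t ht0.ne' θ)) (𝓕 (φ (j + 1)))) with hc
    have hcF : ∀ ξ, 𝓕 c ξ = 𝓕 θ (t⁻¹ • ξ) * 𝓕 (φ (j + 1)) ξ := fun ξ => by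
      rw [hc, fourier_fourierInv, schwartzMul_apply, fourier_dilate]
    have h2 := (hC₁ t f (φ (j + 1)) c ht0 (fun ξ => hφ.reproduce (j + 1) ξ) hcF).2
    have h3 := eLpNorm_conv_le_besovNorm φ s p hq f (j + 1)
    -- The multiplier `‖ξ‖ ^ (2 N)` is put on `g` and its inverse, through `θ`, on `f`; rescaling
    -- gains `t ^ (-2 N)`.
    refine (enorm_apply_le f (u := ((t ^ (2 * N))⁻¹ : ℂ) • normPowMultiplier n N g) (c := c)
      (fun ξ => ?_) h2).trans ?_
    · rw [fourierInv_piece, hcF]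
      by_cases h4 : 𝓕 (φ (j + 1)) ξ = 0
      · rw [h4]; ring
      have h5 : (2 : ℝ) ^ j < ‖ξ‖ := by
        by_contra! h
        exact h4 (hφ.fourier_succ_eq_zero_of_norm_le h)
      have h6 : ‖ξ‖ < t := by
        by_contra! h
        exact h4 (hφ.fourier_eq_zero_of_le_norm h)
      have h7 : ‖t⁻¹ • ξ‖ = ‖ξ‖ / t := IsLittlewoodPaley.norm_inv_pow_smul _ _
      have h8 := hθ (t⁻¹ • ξ) (by
        rw [h7, le_div_iff₀ ht0, ht, pow_add]; linarith) (by
        rw [h7, div_le_one ht0]; exact h6.le)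
      have h9 : 𝓕⁻ (((t ^ (2 * N))⁻¹ : ℂ) • normPowMultiplier n N g) ξ =
          ((t ^ (2 * N))⁻¹ : ℂ) * ((((‖ξ‖ ^ 2) ^ N : ℝ) : ℂ) * 𝓕⁻ g ξ) := by
        rw [FourierTransform.fourierInv_smul, smul_apply, smul_eq_mul,
          fourierInv_normPowMultiplier]
      rw [h9, mul_comm (𝓕 (φ (j + 1)) ξ)]
      have h10 : ((t ^ (2 * N))⁻¹ : ℂ) * (((‖ξ‖ ^ 2) ^ N : ℝ) : ℂ) * 𝓕 θ (t⁻¹ • ξ) = 1 := by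
        rw [← h8, h7, ← pow_mul, ← pow_mul, div_pow]
        push_cast
        ring
      calc _ = ((t ^ (2 * N))⁻¹ : ℂ) * (((‖ξ‖ ^ 2) ^ N : ℝ) : ℂ) * 𝓕 θ (t⁻¹ • ξ) *
            (𝓕⁻ g ξ * 𝓕 (φ (j + 1)) ξ) := by rw [h10, one_mul]
        _ = _ := by ring
    · have h5 : eLpNorm (⇑(((t ^ (2 * N))⁻¹ : ℂ) • normPowMultiplier n N g)) 1 volume =
          ENNReal.ofReal ((t ^ (2 * N))⁻¹) * eLpNorm (normPowMultiplier n N g) 1 volume := by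
        change eLpNorm (((t ^ (2 * N))⁻¹ : ℂ) • ⇑(normPowMultiplier n N g)) 1 volume = _
        rw [eLpNorm_const_smul, ← ofReal_norm, ← Complex.ofReal_pow, ← Complex.ofReal_inv,
          Complex.norm_real, Real.norm_of_nonneg (by positivity)]
      have h6 : ENNReal.ofReal ((t ^ (2 * N))⁻¹) * ENNReal.ofReal (t ^ d) * (weight s (j + 1))⁻¹ ≤
          ENNReal.ofReal A * (2⁻¹) ^ j := by
        have e1 : ((2 : ℝ≥0∞)⁻¹) ^ j = ENNReal.ofReal ((2⁻¹ : ℝ) ^ j) := by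
          rw [ENNReal.ofReal_pow (by norm_num), ENNReal.ofReal_inv_of_pos (by norm_num)]
          norm_num
        rw [weight, e1, ← ENNReal.ofReal_inv_of_pos (by positivity),
          ← ENNReal.ofReal_mul (by positivity), ← ENNReal.ofReal_mul (by positivity),
          ← ENNReal.ofReal_mul hA0]
        refine ENNReal.ofReal_le_ofReal ?_
        have e2 : t = (2 : ℝ) ^ ((j : ℝ) + 2) := by
          rw [ht, ← Real.rpow_natCast]; push_cast; rfl
        have e3 : (t ^ (2 * N))⁻¹ = (2 : ℝ) ^ (-(((j : ℝ) + 2) * (2 * N))) := by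
          rw [e2, ← Real.rpow_natCast, ← Real.rpow_mul (by norm_num), Real.rpow_neg (by norm_num)]
          push_cast; rfl
        have e4 : t ^ d = (2 : ℝ) ^ (((j : ℝ) + 2) * d) := by
          rw [e2, ← Real.rpow_mul (by norm_num)]
        have e5 : ((2 : ℝ)⁻¹) ^ j = (2 : ℝ) ^ (-(j : ℝ)) := by
          rw [Real.rpow_neg (by norm_num), Real.rpow_natCast, inv_pow]
        rw [e3, e4, e5, hA, ← Real.rpow_neg (by norm_num), ← Real.rpow_add (by norm_num),
          ← Real.rpow_add (by norm_num), ← Real.rpow_add (by norm_num)]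
        refine Real.rpow_le_rpow_of_exponent_le (by norm_num) ?_
        push_cast
        rw [div_le_iff₀ (by norm_num)] at hN
        have hj : (0 : ℝ) ≤ j := by positivity
        nlinarith
      rw [h5]
      calc _ ≤ ENNReal.ofReal ((t ^ (2 * N))⁻¹) * eLpNorm (normPowMultiplier n N g) 1 volume *
            (C₁ * ENNReal.ofReal (t ^ d) * ((weight s (j + 1))⁻¹ * besovNorm φ s p q f)) := by
            gcongr
        _ = (ENNReal.ofReal ((t ^ (2 * N))⁻¹) * ENNReal.ofReal (t ^ d) * (weight s (j + 1))⁻¹) *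
            (C₁ * (eLpNorm (normPowMultiplier n N g) 1 volume * besovNorm φ s p q f)) := by ring
        _ ≤ (ENNReal.ofReal A * (2⁻¹) ^ j) *
            (C₁ * (eLpNorm (normPowMultiplier n N g) 1 volume * besovNorm φ s p q f)) := by gcongr
        _ = _ := by ring
  set L := SchwartzMap.toLpCLM ℂ ℂ (E := Euc n) 1 volume with hL
  -- The factor `2` is the sum of `2 ^ (-j)`. Writing the `L^1` norms through the continuous map `L`
  -- makes the bound continuous in `g`.
  refine ⟨fun g => C₀ * Real.toNNReal (2 ^ d) * ‖L g‖₊ +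
    2 * (C₁ * Real.toNNReal A * ‖L (normPowMultiplier n N g)‖₊), ?_, ?_, fun f g => ?_⟩
  · fun_prop
  · simp
  have hLn : ∀ g, ((‖L g‖₊ : ℝ≥0) : ℝ≥0∞) = eLpNorm g 1 volume := fun g => by
    rw [← enorm_eq_nnnorm, hL, SchwartzMap.toLpCLM_apply, SchwartzMap.toLp, Lp.enorm_toLp]
  set B := besovNorm φ s p q f
  push_cast
  rw [hLn, hLn]
  change ‖f g‖ₑ ≤ (C₀ * ENNReal.ofReal (2 ^ d) * eLpNorm g 1 volume +
    2 * (C₁ * ENNReal.ofReal A * eLpNorm (normPowMultiplier n N g) 1 volume)) * B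
  refine le_of_tendsto (hφ.tendsto_sum_piece f g).enorm (Eventually.of_forall fun J => ?_)
  rw [Finset.sum_range_succ', add_comm]
  refine (enorm_add_le _ _).trans ?_
  rw [add_mul]
  refine add_le_add ((hlow f g).trans_eq (by ring)) ?_
  calc _ ≤ ∑ j ∈ Finset.range J, ‖f (piece (φ (j + 1)) g)‖ₑ := enorm_sum_le _ _
    _ ≤ ∑ j ∈ Finset.range J, (C₁ * ENNReal.ofReal A) *
        (eLpNorm (normPowMultiplier n N g) 1 volume * B) * (2⁻¹) ^ j :=
        Finset.sum_le_sum fun j _ => hhigh f g j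
    _ ≤ ∑' j, (C₁ * ENNReal.ofReal A) *
        (eLpNorm (normPowMultiplier n N g) 1 volume * B) * (2⁻¹) ^ j := ENNReal.sum_le_tsum _
    _ = _ := by
      rw [ENNReal.tsum_mul_left, ENNReal.tsum_geometric, ENNReal.one_sub_inv_two, inv_inv]; ring

end Embedding

/-! ### Completeness of Besov spaces and compatibility -/

noncomputable section BesovQuasiBanach

variable {n : ℕ} {φ : ℕ → 𝓢(Euc n, ℂ)} {s : ℝ} {p q : ℝ≥0∞}

theorem conv_add (g : 𝓢(Euc n, ℂ)) (f₁ f₂ : 𝓢'(Euc n, ℂ)) :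
    conv g (f₁ + f₂) = conv g f₁ + conv g f₂ := rfl

theorem conv_smul (g : 𝓢(Euc n, ℂ)) (c : ℂ) (f : 𝓢'(Euc n, ℂ)) :
    conv g (c • f) = c • conv g f := rfl

theorem besovNorm_smul (φ : ℕ → 𝓢(Euc n, ℂ)) (s : ℝ) (p q : ℝ≥0∞) (c : ℂ) (f : 𝓢'(Euc n, ℂ)) :
    besovNorm φ s p q (c • f) = ‖c‖ₑ * besovNorm φ s p q f := by
  unfold besovNorm
  rw [← eLpNorm_const_mul_ennreal enorm_ne_top]
  congr 1
  ext j
  rw [conv_smul, eLpNorm_const_smul]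
  ring

theorem exists_besovNorm_add_le (φ : ℕ → 𝓢(Euc n, ℂ)) (s : ℝ) (p q : ℝ≥0∞) :
    ∃ K : ℝ≥0, ∀ f₁ f₂, besovNorm φ s p q (f₁ + f₂) ≤
      K * (besovNorm φ s p q f₁ + besovNorm φ s p q f₂) := by
  have hKp : p.LpAddConst ≠ ∞ := (ENNReal.LpAddConst_lt_top p).ne
  have hKq : q.LpAddConst ≠ ∞ := (ENNReal.LpAddConst_lt_top q).ne
  refine ⟨(p.LpAddConst * q.LpAddConst).toNNReal, fun f₁ f₂ => ?_⟩
  rw [ENNReal.coe_toNNReal (ENNReal.mul_ne_top hKp hKq)]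
  unfold besovNorm
  set a₁ : ℕ → ℝ≥0∞ := fun j => weight s j * eLpNorm (conv (φ j) f₁) p volume
  set a₂ : ℕ → ℝ≥0∞ := fun j => weight s j * eLpNorm (conv (φ j) f₂) p volume
  calc _ ≤ eLpNorm (fun j => p.LpAddConst * (a₁ + a₂) j) q Measure.count := by
        refine eLpNorm_mono_enorm fun j => ?_
        rw [enorm_eq_self, enorm_eq_self, conv_add]
        calc _ ≤ weight s j * (p.LpAddConst *
              (eLpNorm (conv (φ j) f₁) p volume + eLpNorm (conv (φ j) f₂) p volume)) := by
              gcongr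
              exact eLpNorm_add_le' (continuous_conv _ _).aestronglyMeasurable
                (continuous_conv _ _).aestronglyMeasurable p
          _ = _ := by simp only [a₁, a₂, Pi.add_apply]; ring
    _ = p.LpAddConst * eLpNorm (a₁ + a₂) q Measure.count := eLpNorm_const_mul_ennreal hKp _ _
    _ ≤ p.LpAddConst * (q.LpAddConst *
        (eLpNorm a₁ q Measure.count + eLpNorm a₂ q Measure.count)) := by
        gcongr
        exact eLpNorm_add_le' (measurable_of_countable _).aestronglyMeasurable
          (measurable_of_countable _).aestronglyMeasurable q
    _ = _ := by ring

/-- The Fatou property of the Besov quasi-norms. -/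
theorem besovNorm_le_of_tendsto (hq : q ≠ 0) {u : ℕ → 𝓢'(Euc n, ℂ)} {f : 𝓢'(Euc n, ℂ)}
    (hu : ∀ g, Tendsto (fun l => u l g) atTop (𝓝 (f g))) {ε : ℝ≥0∞}
    (hε : ∀ᶠ l in atTop, besovNorm φ s p q (u l) ≤ ε) : besovNorm φ s p q f ≤ ε := by
  refine eLpNorm_count_le_of_le_liminf hq
    (u := fun l j => weight s j * eLpNorm (conv (φ j) (u l)) p volume) (fun j => ?_) hε
  rw [ENNReal.liminf_const_mul_of_ne_top (weight_ne_top s j)]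
  gcongr
  exact Lp.eLpNorm_lim_le_liminf_eLpNorm (fun l => (continuous_conv _ _).aestronglyMeasurable) _
    (Eventually.of_forall fun x => hu _)

/-- The Besov spaces are quasi-Banach spaces. -/
theorem isQuasiBanach_besovNorm (hφ : IsLittlewoodPaley φ) (s : ℝ) (hp : p ≠ 0) (hq : q ≠ 0) :
    IsQuasiBanach (besovNorm φ s p q) := by
  obtain ⟨P, hPc, hP0, hP⟩ := exists_enorm_apply_le_besovNorm hφ s hp hq
  obtain ⟨K, hK⟩ := exists_besovNorm_add_le φ s p q
  refine ⟨fun f => ⟨fun h => ?_, ?_⟩, besovNorm_smul φ s p q, ⟨K, hK⟩, fun u hu hC => ?_⟩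
  · ext g
    have := hP f g
    rw [h, mul_zero, nonpos_iff_eq_zero, enorm_eq_zero] at this
    exact this
  · rintro rfl
    have := besovNorm_smul φ s p q (0 : ℂ) (0 : 𝓢'(Euc n, ℂ))
    rwa [enorm_zero, zero_mul, show (0 : ℂ) • (0 : 𝓢'(Euc n, ℂ)) = 0 from by
      ext g; exact mul_zero _] at this
  have hCau : ∀ g, CauchySeq fun k => u k g := by
    intro g
    rw [EMetric.cauchySeq_iff]
    intro ε hε
    obtain ⟨M, hM⟩ := hC (ε / (P g + 1)) (ENNReal.div_pos hε.ne' (by finiteness))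
    refine ⟨M, fun k hk l hl => ?_⟩
    rw [edist_eq_enorm_sub]
    have h1 := hM k hk l hl
    rw [ENNReal.lt_div_iff_mul_lt (Or.inl (by positivity)) (Or.inl (by finiteness))] at h1
    refine lt_of_le_of_lt ?_ h1
    refine (hP (u k - u l) g).trans ?_
    rw [mul_comm]
    gcongr
    exact le_self_add
  choose x hx using fun g => cauchySeq_tendsto_of_complete (hCau g)
  let L : 𝓢(Euc n, ℂ) →ₗ[ℂ] ℂ :=
    { toFun := x
      map_add' := fun g₁ g₂ => tendsto_nhds_unique (hx _) (by
        simpa only [map_add] using (hx g₁).add (hx g₂))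
      map_smul' := fun c g => tendsto_nhds_unique (hx _) (by
        simpa only [map_smul, RingHom.id_apply] using (hx g).const_smul c) }
  obtain ⟨M, hM⟩ := hC 1 one_pos
  -- The right side is continuous in `g` and vanishes at `0`, so the pointwise limit is again a
  -- tempered distribution.
  have hLb : ∀ g, ‖L g‖ ≤ ‖u M g‖ + P g := by
    intro g
    refine le_of_tendsto (hx g).norm ?_
    filter_upwards [eventually_ge_atTop M] with k hk
    have h1 : ‖(u k - u M) g‖ₑ ≤ P g :=
      (hP _ _).trans (by simpa using mul_le_mul_right (hM k hk M le_rfl).le (P g : ℝ≥0∞))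
    have h2 : ‖u k g - u M g‖ ≤ P g := by
      rw [enorm_le_coe] at h1
      exact_mod_cast h1
    calc ‖u k g‖ = ‖u M g + (u k g - u M g)‖ := by rw [add_sub_cancel]
      _ ≤ _ := (norm_add_le _ _).trans (by gcongr)
  have hLc : Continuous L := by
    refine continuous_of_continuousAt_zero L ?_
    rw [ContinuousAt, map_zero]
    refine squeeze_zero_norm hLb ?_
    have h1 : Continuous fun g => ‖u M g‖ + (P g : ℝ) := by fun_prop
    simpa [hP0] using h1.tendsto 0
  let X : 𝓢'(Euc n, ℂ) := (⟨L, hLc⟩ : 𝓢(Euc n, ℂ) →L[ℂ] ℂ)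
  -- The Fatou property applied to `u k - u l` as `l → ∞` upgrades pointwise to norm convergence.
  have hlim : ∀ ε > 0, ∃ M, ∀ k ≥ M, besovNorm φ s p q (u k - X) ≤ ε := by
    intro ε hε
    obtain ⟨M, hM⟩ := hC ε hε
    refine ⟨M, fun k hk => besovNorm_le_of_tendsto hq (f := u k - X)
      (u := fun l => u k - u l) (fun g => (hx g).const_sub (u k g)) ?_⟩
    filter_upwards [eventually_ge_atTop M] with l hl using (hM k hk l hl).le
  refine ⟨X, ?_, ?_⟩
  · obtain ⟨M, hM⟩ := hlim 1 one_pos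
    have h1 : X = u M + (-1 : ℂ) • (u M - X) := by
      rw [show (-1 : ℂ) • (u M - X) = -(u M - X) from by
        ext g; exact neg_one_mul _]
      abel
    rw [h1]
    refine (hK _ _).trans_lt ?_
    rw [besovNorm_smul]
    have h2 : besovNorm φ s p q (u M - X) ≠ ∞ := ((hM M le_rfl).trans_lt ENNReal.one_lt_top).ne
    have h3 := (hu M).ne
    finiteness
  · rw [ENNReal.tendsto_atTop_zero]
    exact hlim

/-- Two Besov spaces form a compatible couple. -/
theorem isCompatible_besovNorm (hφ : IsLittlewoodPaley φ) (s₀ s₁ : ℝ) {p₀ q₀ p₁ q₁ : ℝ≥0∞}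
    (hp₀ : p₀ ≠ 0) (hq₀ : q₀ ≠ 0) (hp₁ : p₁ ≠ 0) (hq₁ : q₁ ≠ 0) :
    IsCompatible (besovNorm φ s₀ p₀ q₀) (besovNorm φ s₁ p₁ q₁) := by
  have h₀ := isQuasiBanach_besovNorm hφ s₀ hp₀ hq₀
  have h₁ := isQuasiBanach_besovNorm hφ s₁ hp₁ hq₁
  refine ⟨h₀, h₁, h₀.sumNorm h₁ fun f hf => ?_⟩
  obtain ⟨P₀, -, -, hP₀⟩ := exists_enorm_apply_le_besovNorm hφ s₀ hp₀ hq₀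
  obtain ⟨P₁, -, -, hP₁⟩ := exists_enorm_apply_le_besovNorm hφ s₁ hp₁ hq₁
  obtain ⟨g, hg⟩ : ∃ g, f g ≠ 0 := by
    by_contra! h
    exact hf (by ext g; exact h g)
  refine ⟨{ toFun := fun f => f g, map_add' := fun _ _ => rfl, map_smul' := fun _ _ => rfl },
    max (P₀ g) (P₁ g), hg, fun f => (hP₀ f g).trans ?_, fun f => (hP₁ f g).trans ?_⟩
  · gcongr; exact le_max_left _ _
  · gcongr; exact le_max_right _ _

end BesovQuasiBanach

/-! ### Symbols assembled from dyadic blocks -/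

noncomputable section DyadicMultiplier

variable {n : ℕ}

theorem contDiff_chr (w : Euc n) {N : WithTop ℕ∞} : ContDiff ℝ N (chr w) := by
  unfold chr
  have : ContDiff ℝ N fun ξ : Euc n => 2 * Real.pi * inner ℝ w ξ :=
    contDiff_const.mul (contDiff_const.inner ℝ contDiff_id)
  exact ((Complex.ofRealCLM.contDiff.comp this).mul contDiff_const).cexp

/-- The character is the exponential of a linear map of norm at most `2 π ‖w‖`, and each derivative
costs one such factor. -/
theorem norm_iteratedFDeriv_chr_le (w : Euc n) (i : ℕ) (ξ : Euc n) :
    ‖iteratedFDeriv ℝ i (chr w) ξ‖ ≤ (2 * Real.pi * ‖w‖) ^ i := by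
  set L : Euc n →L[ℝ] ℂ :=
    (2 * Real.pi * Complex.I) • Complex.ofRealCLM.comp (innerSL ℝ w) with hL
  have hLn : ‖L‖ ≤ 2 * Real.pi * ‖w‖ := by
    refine ContinuousLinearMap.opNorm_le_bound _ (by positivity) fun v => ?_
    have : L v = (2 * Real.pi * Complex.I) * ((inner ℝ w v : ℝ) : ℂ) := rfl
    rw [this, norm_mul, Complex.norm_real]
    have h1 : ‖(2 * Real.pi * Complex.I : ℂ)‖ = 2 * Real.pi := by
      simp [abs_of_pos Real.pi_pos]
    rw [h1, mul_assoc (2 * Real.pi)]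
    exact mul_le_mul_of_nonneg_left (norm_inner_le_norm (𝕜 := ℝ) w v) (by positivity)
  have hd : fderiv ℝ (chr w) = ((ContinuousLinearMap.lsmul ℝ ℂ).flip L : ℂ →L[ℝ] _) ∘ chr w := by
    ext1 ζ
    refine HasFDerivAt.fderiv ?_
    have h1 : HasFDerivAt (fun ζ : Euc n => (2 * Real.pi * inner ℝ w ζ : ℝ))
        ((2 * Real.pi) • innerSL ℝ w) ζ :=
      (innerSL ℝ w).hasFDerivAt.const_mul (2 * Real.pi)
    have h2 := ((Complex.ofRealCLM.hasFDerivAt.comp ζ h1).mul_const Complex.I).cexp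
    refine h2.congr_fderiv ?_
    ext v
    simp [hL, chr]
    ring
  induction i with
  | zero => simp [norm_chr]
  | succ i ih =>
    rw [← norm_iteratedFDeriv_fderiv, hd]
    refine (ContinuousLinearMap.norm_iteratedFDeriv_comp_left _
      (contDiff_chr w (N := i)).contDiffAt le_rfl).trans ?_
    rw [pow_succ, mul_comm]
    gcongr
    refine le_trans (ContinuousLinearMap.opNorm_le_bound _ (norm_nonneg L) fun c => ?_) hLn
    rw [ContinuousLinearMap.flip_apply, ContinuousLinearMap.lsmul_apply, norm_smul, mul_comm]

/-- Every frequency lies well inside a dyadic annulus, away from all the others. -/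
theorem exists_dyadic_annulus (ξ : Euc n) :
    ∃ j : ℕ, ‖ξ‖ < 3 / 2 * 2 ^ (j + 1) ∧ (j = 0 ∨ 5 / 8 * 2 ^ (j + 1) < ‖ξ‖) := by
  have hex : ∃ j : ℕ, ‖ξ‖ < 3 / 2 * 2 ^ (j + 1) := by
    obtain ⟨j, hj⟩ := pow_unbounded_of_one_lt ‖ξ‖ (one_lt_two (α := ℝ))
    refine ⟨j, hj.trans_le ?_⟩
    rw [pow_succ]
    have : (0 : ℝ) < 2 ^ j := by positivity
    linarith
  classical
  refine ⟨Nat.find hex, Nat.find_spec hex, ?_⟩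
  rcases Nat.eq_zero_or_pos (Nat.find hex) with h | h
  · exact Or.inl h
  · right
    have h1 := Nat.find_min hex (Nat.sub_lt h one_pos)
    rw [not_lt, show Nat.find hex - 1 + 1 = Nat.find hex from Nat.sub_add_cancel h] at h1
    rw [pow_succ]
    have : (0 : ℝ) < 2 ^ Nat.find hex := by positivity
    linarith

variable {A : ℕ → Euc n → ℂ} {c : ℕ → ℂ} {w : ℕ → Euc n}

/-- The symbol `∑ c_j A_j(ξ) exp (-2 π i ⟪w_j, ξ⟫)`. -/
def dyadicSymbol (A : ℕ → Euc n → ℂ) (c : ℕ → ℂ) (w : ℕ → Euc n) (ξ : Euc n) : ℂ :=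
  ∑' j, c j * (A j ξ * chr (-w j) ξ)

/-- For the index `j` of `exists_dyadic_annulus`, the strict inequalities exclude the supports of
all other terms and persist near `ξ`. Locally the series is thus a single term, and no convergence
question arises. -/
theorem dyadicSymbol_eventuallyEq
    (h0 : ∀ j ξ, A j ξ ≠ 0 → 3 / 4 * 2 ^ (j + 1) ≤ ‖ξ‖ ∧ ‖ξ‖ ≤ 5 / 4 * 2 ^ (j + 1)) (ξ : Euc n) :
    ∃ j, dyadicSymbol A c w =ᶠ[𝓝 ξ] fun ζ => c j * (A j ζ * chr (-w j) ζ) := by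
  obtain ⟨j, hj1, hj2⟩ := exists_dyadic_annulus ξ
  refine ⟨j, ?_⟩
  have e2 : ∀ᶠ ζ in 𝓝 ξ, j = 0 ∨ 5 / 8 * 2 ^ (j + 1) < ‖ζ‖ := by
    rcases hj2 with h | h
    · exact Eventually.of_forall fun _ => Or.inl h
    · exact (continuous_norm.continuousAt.eventually (lt_mem_nhds h)).mono fun _ => Or.inr
  filter_upwards [continuous_norm.continuousAt.eventually (gt_mem_nhds hj1), e2] with ζ h1 h2
  refine tsum_eq_single j fun i hi => ?_
  have h3 : A i ζ = 0 := by
    by_contra h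
    obtain ⟨h4, h5⟩ := h0 i ζ h
    rcases lt_or_gt_of_ne hi with h6 | h6
    · rcases h2 with h2 | h2
      · omega
      · have : (2 : ℝ) ^ (i + 1 + 1) ≤ 2 ^ (j + 1) := by gcongr <;> norm_num; omega
        rw [pow_succ _ (i + 1)] at this
        linarith
    · have : (2 : ℝ) ^ (j + 1 + 1) ≤ 2 ^ (i + 1) := by gcongr <;> norm_num; omega
      rw [pow_succ _ (j + 1)] at this
      linarith
  rw [h3]; ring

/-- Derivatives of the characters and the coefficients `c j` cost only powers of `2 ^ (j + 1)`,
which is at most `2 * (1 + ‖ξ‖)` where the block `A j` can be nonzero. -/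
theorem hasTemperateGrowth_dyadicSymbol (hA : ∀ j, ContDiff ℝ ((⊤ : ℕ∞) : WithTop ℕ∞) (A j))
    (hD : ∀ i, ∃ D, ∀ j ξ, ‖iteratedFDeriv ℝ i (A j) ξ‖ ≤ D)
    (h0 : ∀ j ξ, A j ξ ≠ 0 → 3 / 4 * 2 ^ (j + 1) ≤ ‖ξ‖ ∧ ‖ξ‖ ≤ 5 / 4 * 2 ^ (j + 1))
    (hw : ∀ j, ‖w j‖ ≤ 2 ^ (j + 1)) {M : ℕ} (hc : ∀ j, ‖c j‖ ≤ (2 ^ (j + 1)) ^ M) :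
    (dyadicSymbol A c w).HasTemperateGrowth := by
  have hs : ∀ j, ContDiff ℝ ((⊤ : ℕ∞) : WithTop ℕ∞) fun ζ => c j * (A j ζ * chr (-w j) ζ) :=
    fun j => contDiff_const.mul ((hA j).mul (contDiff_chr _))
  refine ⟨contDiff_iff_contDiffAt.2 fun ξ => ?_, fun N => ?_⟩
  · obtain ⟨j, hj⟩ := dyadicSymbol_eventuallyEq (c := c) (w := w) h0 ξ
    exact (hs j).contDiffAt.congr_of_eventuallyEq hj
  choose D hD using hD
  have hD0 : ∀ i, 0 ≤ D i := fun i => (norm_nonneg _).trans (hD i 0 0)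
  set C : ℝ := ∑ i ∈ Finset.range (N + 1), (N.choose i : ℝ) * D i * (2 * Real.pi) ^ (N - i) with hC
  have hC0 : 0 ≤ C := Finset.sum_nonneg fun i _ => by have := hD0 i; positivity
  refine ⟨M + N, C * 2 ^ (M + N), fun ξ => ?_⟩
  obtain ⟨j, hj⟩ := dyadicSymbol_eventuallyEq (c := c) (w := w) h0 ξ
  rw [(hj.iteratedFDeriv ℝ N).self_of_nhds]
  set R : ℝ := 2 ^ (j + 1) with hR
  have hR1 : 1 ≤ R := one_le_pow₀ (by norm_num)
  rcases lt_or_ge ‖ξ‖ (3 / 4 * R) with h | h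
  · have h1 : (fun ζ => c j * (A j ζ * chr (-w j) ζ)) =ᶠ[𝓝 ξ] fun _ => 0 := by
      filter_upwards [continuous_norm.continuousAt.eventually (gt_mem_nhds h)] with ζ hζ
      have : A j ζ = 0 := by
        by_contra h2
        exact absurd (h0 j ζ h2).1 (not_le.2 hζ)
      rw [this]; ring
    rw [(h1.iteratedFDeriv ℝ N).self_of_nhds]
    have : iteratedFDeriv ℝ N (fun _ : Euc n => (0 : ℂ)) ξ = 0 :=
      congrFun (iteratedFDeriv_fun_zero (𝕜 := ℝ) (E := Euc n) (F := ℂ) (n := N)) ξ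
    rw [this, norm_zero]
    positivity
  · have h1 : ‖iteratedFDeriv ℝ N (fun ζ => c j * (A j ζ * chr (-w j) ζ)) ξ‖ ≤
        ‖c j‖ * ‖iteratedFDeriv ℝ N (fun ζ => A j ζ * chr (-w j) ζ) ξ‖ := by
      have h2 := iteratedFDeriv_const_smul_apply' (a := c j) (x := ξ) (i := N)
        (((hA j).mul (contDiff_chr (-w j))).of_le (mod_cast le_top)).contDiffAt
      simp only [smul_eq_mul] at h2
      rw [h2, norm_smul]
    have h3 : ‖iteratedFDeriv ℝ N (fun ζ => A j ζ * chr (-w j) ζ) ξ‖ ≤ C * R ^ N := by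
      refine (norm_iteratedFDeriv_mul_le (hA j) (contDiff_chr _) ξ (mod_cast le_top)).trans ?_
      rw [hC, Finset.sum_mul]
      refine Finset.sum_le_sum fun i _ => ?_
      have h4 : ‖iteratedFDeriv ℝ (N - i) (chr (-w j)) ξ‖ ≤ (2 * Real.pi) ^ (N - i) * R ^ N := by
        refine (norm_iteratedFDeriv_chr_le _ _ _).trans ?_
        rw [norm_neg, mul_pow]
        gcongr
        exact (pow_le_pow_left₀ (norm_nonneg _) (hw j) _).trans
          (pow_le_pow_right₀ hR1 (Nat.sub_le _ _))
      have := hD0 i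
      calc _ ≤ (N.choose i : ℝ) * D i * ((2 * Real.pi) ^ (N - i) * R ^ N) := by
            gcongr
            exact hD i j ξ
        _ = _ := by ring
    calc _ ≤ R ^ M * (C * R ^ N) := h1.trans (mul_le_mul (hc j) h3 (norm_nonneg _) (by positivity))
      _ = C * R ^ (M + N) := by ring
      _ ≤ C * (2 * (1 + ‖ξ‖)) ^ (M + N) := by
        gcongr
        linarith [norm_nonneg ξ]
      _ = _ := by rw [mul_pow]; ring

end DyadicMultiplier

/-! ### The operator translating dyadic pieces -/

noncomputable section TranslationOperator

variable {n : ℕ} {φ : ℕ → 𝓢(Euc n, ℂ)}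

/-- The Littlewood-Paley functions are constant on narrow dyadic annuli. -/
theorem IsLittlewoodPaley.exists_annulus (hφ : IsLittlewoodPaley φ) :
    ∃ ρ : ℝ, 0 < ρ ∧ ρ ≤ 1 / 4 ∧ ∀ (k j : ℕ) (ξ : Euc n), (1 - ρ) * 2 ^ (j + 1) ≤ ‖ξ‖ →
      ‖ξ‖ ≤ (1 + ρ) * 2 ^ (j + 1) → 𝓕 (φ k) ξ = if k = j + 1 then 1 else 0 := by
  obtain ⟨δ, hδ, hδ', h1, h0⟩ := hφ.exists_margin
  have key1 : ∀ (i j : ℕ) (ξ : Euc n), ‖ξ‖ ≤ (1 + δ / 2) * 2 ^ (j + 1) → j + 1 ≤ i →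
      𝓕 (φ 0) (((2 : ℝ) ^ i)⁻¹ • ξ) = 1 := fun i j ξ hξ hi => by
    refine h1 _ ?_
    rw [norm_inv_pow_smul, div_le_iff₀ (by positivity)]
    have : (2 : ℝ) ^ (j + 1) ≤ 2 ^ i := by gcongr; norm_num
    have h3 : (0 : ℝ) < 2 ^ (j + 1) := by positivity
    nlinarith
  have key0 : ∀ (i j : ℕ) (ξ : Euc n), (1 - δ / 2) * 2 ^ (j + 1) ≤ ‖ξ‖ → i ≤ j →
      𝓕 (φ 0) (((2 : ℝ) ^ i)⁻¹ • ξ) = 0 := fun i j ξ hξ hi => by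
    refine h0 _ ?_
    rw [norm_inv_pow_smul, le_div_iff₀ (by positivity)]
    have : (2 : ℝ) ^ i ≤ 2 ^ j := by gcongr; norm_num
    rw [pow_succ] at hξ
    nlinarith
  refine ⟨δ / 2, by linarith, by linarith, fun k j ξ hl hu => ?_⟩
  rcases k with - | k
  · rw [if_neg (by omega)]
    simpa using key0 0 j ξ hl (Nat.zero_le j)
  · rw [hφ.fourier_succ]
    rcases lt_trichotomy k j with h | rfl | h
    · rw [key0 _ j ξ hl (by omega), key0 _ j ξ hl (by omega), if_neg (by omega), sub_self]
    · rw [key1 _ k ξ hu (by omega), key0 _ k ξ hl (by omega), if_pos rfl, sub_zero]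
    · rw [key1 _ j ξ hu (by omega), key1 _ j ξ hu (by omega), if_neg (by omega), sub_self]

/-- Translates by `w` the action of a multiplier with symbol `exp (-2 π i ⟪w, ξ⟫) * 𝓕 c / 𝓕 g`. -/
theorem conv_fourierMultiplierCLM {μ : Euc n → ℂ} (hμ : μ.HasTemperateGrowth)
    {g c : 𝓢(Euc n, ℂ)} {w : Euc n} (h : ∀ ξ, μ ξ * 𝓕 g ξ = chr (-w) ξ * 𝓕 c ξ)
    (f : 𝓢'(Euc n, ℂ)) (x : Euc n) :
    conv g (TemperedDistribution.fourierMultiplierCLM ℂ μ f) x = conv c f (x - w) := by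
  unfold conv
  rw [TemperedDistribution.fourierMultiplierCLM_apply_apply]
  congr 1
  refine eq_of_fourierInv_eq fun ξ => ?_
  rw [fourierInv_fourier, SchwartzMap.smulLeftCLM_apply_apply hμ, smul_eq_mul,
    fourierInv_reflectTranslate, fourierInv_reflectTranslate, sub_eq_add_neg, chr_add, mul_left_comm,
    h, mul_assoc]

theorem conv_zero_left (f : 𝓢'(Euc n, ℂ)) (x : Euc n) : conv 0 f x = 0 := by
  unfold conv
  have : reflectTranslate (0 : 𝓢(Euc n, ℂ)) x = 0 := by
    ext y; rw [reflectTranslate_apply]; rfl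
  rw [this, map_zero]

/-- A smooth bump around `v`. -/
theorem exists_schwartz_bump (v : Euc n) {r : ℝ} (hr : 0 < r) :
    ∃ ψ : 𝓢(Euc n, ℂ), (∀ ξ, ‖ξ - v‖ ≤ r / 2 → ψ ξ = 1) ∧ ∀ ξ, ψ ξ ≠ 0 → ‖ξ - v‖ < r := by
  let b : ContDiffBump v := ⟨r / 2, r, by linarith, by linarith⟩
  have hsm : ContDiff ℝ ((⊤ : ℕ∞) : WithTop ℕ∞) fun ξ => (b ξ : ℂ) :=
    Complex.ofRealCLM.contDiff.comp b.contDiff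
  have hcs : HasCompactSupport fun ξ => (b ξ : ℂ) :=
    b.hasCompactSupport.comp_left (g := fun t : ℝ => (t : ℂ)) Complex.ofReal_zero
  refine ⟨hcs.toSchwartzMap hsm, fun ξ hξ => ?_, fun ξ hξ => ?_⟩
  · change (b ξ : ℂ) = 1
    rw [b.one_of_mem_closedBall (mem_closedBall_iff_norm.2 hξ), Complex.ofReal_one]
  · by_contra! h
    refine hξ ?_
    change (b ξ : ℂ) = 0
    rw [b.zero_of_le_dist (by rw [dist_eq_norm]; exact h), Complex.ofReal_zero]

/-- The pieces `2 ^ (k s) φ_k ∗ f` of `f` are, up to unimodular factors, the translates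
`a_j η(x - z_j)`, where `k = j + 1`. -/
structure IsLacunary (φ : ℕ → 𝓢(Euc n, ℂ)) (s : ℝ) (η : 𝓢(Euc n, ℂ)) (a : ℕ → ℝ≥0)
    (z : ℕ → Euc n) (f : 𝓢'(Euc n, ℂ)) : Prop where
  zero : ∀ x, conv (φ 0) f x = 0
  succ : ∀ j x, weight s (j + 1) * ‖conv (φ (j + 1)) f x‖ₑ = a j * ‖η (x - z j)‖ₑ

/-- An operator which translates the `(j + 1)`-st Littlewood-Paley piece by `w_j` is bounded on
all Besov spaces. -/
theorem exists_translation_operator (hφ : IsLittlewoodPaley φ) (hn : 1 ≤ n) :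
    ∃ η : 𝓢(Euc n, ℂ), η ≠ 0 ∧ ∀ w : ℕ → Euc n, (∀ j, ‖w j‖ ≤ 2 ^ (j + 1)) →
      ∃ T : 𝓢'(Euc n, ℂ) →ₗ[ℂ] 𝓢'(Euc n, ℂ),
        (∀ (s : ℝ) (p q : ℝ≥0∞), p ≠ 0 → ∃ C : ℝ≥0, ∀ f,
          besovNorm φ s p q (T f) ≤ C * besovNorm φ s p q f) ∧
        ∀ (s : ℝ) (a : ℕ → ℝ≥0) (z : ℕ → Euc n), (∀ j, a j ≤ 1) → (∀ j, ‖z j‖ ≤ 2 ^ (j + 1)) →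
          ∃ f, IsLacunary φ s η a z f ∧ IsLacunary φ s η a (fun j => z j + w j) (T f) := by
  obtain ⟨ρ, hρ0, hρ4, hρ⟩ := hφ.exists_annulus
  set e : Euc n := EuclideanSpace.single ⟨0, hn⟩ 1 with he
  have hen : ‖e‖ = 1 := by simp [he]
  have hpos : ∀ j : ℕ, (0 : ℝ) < 2 ^ (j + 1) := fun j => by positivity
  have hone : ∀ j : ℕ, (1 : ℝ) ≤ 2 ^ (j + 1) := fun j => one_le_pow₀ (by norm_num)
  have hven : ∀ j : ℕ, ‖(2 : ℝ) ^ (j + 1) • e‖ = 2 ^ (j + 1) := fun j => by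
    rw [norm_smul, hen, mul_one, Real.norm_of_nonneg (hpos j).le]
  -- frequencies close to `2 ^ (j + 1) e` are in the annulus
  have hann : ∀ (j : ℕ) (ξ : Euc n), ‖ξ - (2 : ℝ) ^ (j + 1) • e‖ < ρ * 2 ^ (j + 1) →
      (1 - ρ) * 2 ^ (j + 1) ≤ ‖ξ‖ ∧ ‖ξ‖ ≤ (1 + ρ) * 2 ^ (j + 1) := fun j ξ h => by
    have h1 := abs_norm_sub_norm_le ξ ((2 : ℝ) ^ (j + 1) • e)
    rw [hven, abs_le] at h1
    constructor <;> linarith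
  have hann' : ∀ (j : ℕ) (ξ : Euc n), ‖ξ - (2 : ℝ) ^ (j + 1) • e‖ < ρ * 2 ^ (j + 1) →
      3 / 4 * 2 ^ (j + 1) ≤ ‖ξ‖ ∧ ‖ξ‖ ≤ 5 / 4 * 2 ^ (j + 1) := fun j ξ h => by
    have h1 := hann j ξ h
    have h2 := hpos j
    constructor <;> nlinarith
  -- multiplying a symbol supported there with the Littlewood-Paley functions
  have hsym : ∀ (A : ℕ → Euc n → ℂ) (c : ℕ → ℂ) (w : ℕ → Euc n),
      (∀ j ξ, A j ξ ≠ 0 → ‖ξ - (2 : ℝ) ^ (j + 1) • e‖ < ρ * 2 ^ (j + 1)) → ∀ ξ,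
      (dyadicSymbol A c w ξ * 𝓕 (φ 0) ξ = 0) ∧
      ∀ j, dyadicSymbol A c w ξ * 𝓕 (φ (j + 1)) ξ = c j * (A j ξ * chr (-w j) ξ) := by
    intro A c w hA ξ
    have hk : ∀ k i, c i * (A i ξ * chr (-w i) ξ) * 𝓕 (φ k) ξ =
        if k = i + 1 then c i * (A i ξ * chr (-w i) ξ) else 0 := fun k i => by
      by_cases h : A i ξ = 0
      · simp [h]
      · have := hann i ξ (hA i ξ h)
        rw [hρ k i ξ this.1 this.2]
        split_ifs <;> simp
    constructor
    · rw [dyadicSymbol, ← tsum_mul_right]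
      simp [hk]
    · intro j
      rw [dyadicSymbol, ← tsum_mul_right]
      simp only [hk, add_left_inj]
      rw [tsum_eq_single j fun i hi => if_neg hi.symm, if_pos rfl]
  -- Two kinds of windows around `2 ^ (j + 1) e`. The operator uses `A j`, the bump `χ` dilated by
  -- `2 ^ (j + 2)`, which is the reproducing scale of `φ (j + 1)`. The test distribution uses `B j`,
  -- an undilated translate of `ψ`, so that all its pieces have the same profile `𝓕⁻ ψ` up to a
  -- unimodular factor.
  obtain ⟨χ, hχ1, hχ0⟩ := exists_schwartz_bump ((2 : ℝ)⁻¹ • e) (half_pos hρ0)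
  obtain ⟨ψ, hψ1, hψ0⟩ := exists_schwartz_bump (0 : Euc n) (half_pos hρ0)
  have hscale : ∀ (j : ℕ) (ξ : Euc n), ‖((2 : ℝ) ^ (j + 2))⁻¹ • ξ - (2 : ℝ)⁻¹ • e‖ =
      ‖ξ - (2 : ℝ) ^ (j + 1) • e‖ / 2 ^ (j + 2) := fun j ξ => by
    rw [← IsLittlewoodPaley.norm_inv_pow_smul, smul_sub, smul_smul, pow_succ _ (j + 1), mul_inv_rev, mul_assoc,
      inv_mul_cancel₀ (hpos j).ne', mul_one]
  set A : ℕ → Euc n → ℂ := fun j ξ => χ (((2 : ℝ) ^ (j + 2))⁻¹ • ξ) with hAdef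
  set B : ℕ → Euc n → ℂ := fun j ξ => ψ (ξ - (2 : ℝ) ^ (j + 1) • e) with hBdef
  have hA0 : ∀ j ξ, A j ξ ≠ 0 → ‖ξ - (2 : ℝ) ^ (j + 1) • e‖ < ρ * 2 ^ (j + 1) := fun j ξ h => by
    have h1 := hχ0 _ h
    rw [hscale, div_lt_iff₀ (by positivity)] at h1
    rw [pow_succ _ (j + 1)] at h1
    linarith
  have hB0 : ∀ j ξ, B j ξ ≠ 0 → ‖ξ - (2 : ℝ) ^ (j + 1) • e‖ < ρ / 2 := fun j ξ h => by
    simpa using hψ0 _ h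
  have hB0' : ∀ j ξ, B j ξ ≠ 0 → ‖ξ - (2 : ℝ) ^ (j + 1) • e‖ < ρ * 2 ^ (j + 1) := fun j ξ h => by
    have h1 := hB0 j ξ h
    have h2 := hone j
    nlinarith
  -- The operator's window equals one on the window of the test distribution, whose pieces are
  -- therefore only translated.
  have hAB : ∀ j ξ, B j ξ * A j ξ = B j ξ := fun j ξ => by
    by_cases h : B j ξ = 0
    · rw [h, zero_mul]
    · have h1 : A j ξ = 1 := by
        refine hχ1 _ ?_
        rw [hscale, div_le_iff₀ (by positivity), pow_succ _ (j + 1)]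
        have h1 := hB0 j ξ h
        have h2 := hone j
        nlinarith
      rw [h1, mul_one]
  choose DA hDA0 hDA using fun i => exists_one_add_pow_mul_iteratedFDeriv_le χ 0 i
  choose DB hDB0 hDB using fun i => exists_one_add_pow_mul_iteratedFDeriv_le ψ 0 i
  simp only [pow_zero, one_mul] at hDA hDB
  have hAs : ∀ j, ContDiff ℝ ((⊤ : ℕ∞) : WithTop ℕ∞) (A j) := fun j =>
    (χ.smooth _).comp (contDiff_const_smul _)
  have hBs : ∀ j, ContDiff ℝ ((⊤ : ℕ∞) : WithTop ℕ∞) (B j) := fun j =>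
    (ψ.smooth _).comp (contDiff_id.sub contDiff_const)
  have hAD : ∀ i, ∃ D, ∀ j ξ, ‖iteratedFDeriv ℝ i (A j) ξ‖ ≤ D := fun i => by
    refine ⟨DA i, fun j ξ => ?_⟩
    have h1 := iteratedFDeriv_comp_const_smul (((2 : ℝ) ^ (j + 2))⁻¹) (χ.smooth i)
    rw [hAdef]
    simp only [h1]
    rw [norm_smul, norm_pow, Real.norm_of_nonneg (by positivity)]
    have h5 : (((2 : ℝ) ^ (j + 2))⁻¹) ^ i ≤ 1 :=
      pow_le_one₀ (by positivity) (inv_le_one_of_one_le₀ (one_le_pow₀ (by norm_num)))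
    exact (mul_le_of_le_one_left (norm_nonneg _) h5).trans (hDA i _)
  have hBD : ∀ i, ∃ D, ∀ j ξ, ‖iteratedFDeriv ℝ i (B j) ξ‖ ≤ D := fun i => by
    refine ⟨DB i, fun j ξ => ?_⟩
    rw [hBdef]
    simp only [iteratedFDeriv_comp_sub]
    exact hDB i _
  set κ : 𝓢(Euc n, ℂ) := 𝓕⁻ χ with hκ
  have hκF : 𝓕 κ = χ := fourier_fourierInv χ
  set g : ℕ → 𝓢(Euc n, ℂ) := fun j => dilate (2 ^ (j + 2)) (by positivity) κ with hg
  have hgF : ∀ j ξ, 𝓕 (g j) ξ = A j ξ := fun j ξ => by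
    rw [hg]
    simp only [fourier_dilate, hκF, hAdef]
  refine ⟨𝓕⁻ ψ, fun h => ?_, fun w hw => ?_⟩
  · have h1 : ψ 0 = 1 := hψ1 0 (by simp; linarith)
    rw [← fourier_fourierInv ψ, h] at h1
    rw [fourier_apply] at h1
    simp at h1
  set μ : Euc n → ℂ := dyadicSymbol A (fun _ => 1) w with hμdef
  have hμ : μ.HasTemperateGrowth := hasTemperateGrowth_dyadicSymbol hAs hAD
    (fun j ξ h => hann' j ξ (hA0 j ξ h)) hw (M := 0) (fun j => by simp)
  set T := TemperedDistribution.fourierMultiplierCLM ℂ μ with hT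
  have hTz : ∀ f x, conv (φ 0) (T f) x = 0 := fun f x => by
    rw [hT, conv_fourierMultiplierCLM hμ (c := 0) (w := 0) (fun ξ => ?_), conv_zero_left]
    rw [(hsym A _ w hA0 ξ).1]
    have : 𝓕 (0 : 𝓢(Euc n, ℂ)) ξ = 0 := by simp
    rw [this, mul_zero]
  have hTs : ∀ f j x, conv (φ (j + 1)) (T f) x = conv (g j) f (x - w j) := fun f j x => by
    rw [hT, conv_fourierMultiplierCLM hμ (c := g j) (w := w j) (fun ξ => ?_)]
    rw [(hsym A _ w hA0 ξ).2 j, hgF]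
    ring
  refine ⟨T.toLinearMap, fun s p q hp => ?_, fun s a z ha hz => ?_⟩
  · obtain ⟨C, hC⟩ := exists_conv_bound (φ 0) κ hp
    refine ⟨C, fun f => ?_⟩
    unfold besovNorm
    rw [← eLpNorm_const_mul_ennreal ENNReal.coe_ne_top]
    refine eLpNorm_mono_enorm fun k => ?_
    rw [enorm_eq_self, enorm_eq_self, mul_left_comm]
    gcongr
    change eLpNorm (conv (φ k) (T f)) p volume ≤ _
    rcases k with - | j
    · rw [show conv (φ 0) (T f) = 0 from funext (hTz f), eLpNorm_zero]
      exact zero_le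
    · have h1 : conv (φ (j + 1)) (T f) = conv (g j) f ∘ fun x => x - w j := funext (hTs f j)
      rw [h1, eLpNorm_comp_measurePreserving (continuous_conv _ _).aestronglyMeasurable
        (measurePreserving_sub_right volume (w j))]
      refine (hC (2 ^ (j + 2)) f (φ (j + 1)) (g j) (by positivity)
        (fun ξ => hφ.reproduce (j + 1) ξ) fun ξ => ?_).1
      rw [hgF, hκF]
      by_cases h : A j ξ = 0
      · rw [h, show χ _ = 0 from h, zero_mul]
      · have h2 := hann j ξ (hA0 j ξ h)
        rw [hρ _ j ξ h2.1 h2.2, if_pos rfl, mul_one]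
  -- The power of two cancels the weight `2 ^ ((j + 1) s)`. It grows when `s` is negative, which `M
  -- ≥ -s` accounts for.
  set c : ℕ → ℂ := fun j => ((a j * 2 ^ (-(((j + 1 : ℕ) : ℝ) * s)) : ℝ) : ℂ) with hcdef
  obtain ⟨M, hM⟩ := exists_nat_ge (-s)
  have hcn : ∀ j, ‖c j‖ = a j * 2 ^ (-(((j + 1 : ℕ) : ℝ) * s)) := fun j => by
    rw [hcdef]
    simp only [Complex.norm_real]
    rw [Real.norm_of_nonneg (by positivity)]
  have hcb : ∀ j, ‖c j‖ ≤ (2 ^ (j + 1)) ^ M := fun j => by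
    rw [hcn, ← pow_mul, ← Real.rpow_natCast]
    have h1 : (a j : ℝ) ≤ 1 := by exact_mod_cast ha j
    refine (mul_le_of_le_one_left (by positivity) h1).trans
      (Real.rpow_le_rpow_of_exponent_le (by norm_num) ?_)
    push_cast
    have : (0 : ℝ) ≤ j + 1 := by positivity
    nlinarith
  have hmu : (dyadicSymbol B c z).HasTemperateGrowth := hasTemperateGrowth_dyadicSymbol hBs hBD
    (fun j ξ h => hann' j ξ (hB0' j ξ h)) hz hcb
  set m := dyadicSymbol B c z with hm
  set h : ℕ → 𝓢(Euc n, ℂ) := fun j =>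
    c j • (𝓕⁻ (ψ.compSubConstCLM ℂ ((2 : ℝ) ^ (j + 1) • e)) : 𝓢(Euc n, ℂ)) with hh
  have hhF : ∀ j ξ, 𝓕 (h j) ξ = c j * B j ξ := fun j ξ => by
    rw [hh]
    simp only [FourierTransform.fourier_smul, fourier_fourierInv]
    rfl
  have hhn : ∀ j x, weight s (j + 1) * ‖h j x‖ₑ = a j * ‖𝓕⁻ ψ x‖ₑ := fun j x => by
    have h1 : h j x = c j * (chr ((2 : ℝ) ^ (j + 1) • e) x * 𝓕⁻ ψ x) := by
      rw [← fourierInv_compSubConstCLM]; rfl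
    rw [h1, enorm_mul, enorm_mul, ← ofReal_norm (chr _ _), norm_chr, ENNReal.ofReal_one, one_mul,
      ← mul_assoc, weight, ← ofReal_norm (c j), hcn, ← ENNReal.ofReal_mul (by positivity),
      mul_left_comm, ← Real.rpow_add (by norm_num)]
    push_cast
    rw [add_neg_cancel, Real.rpow_zero, mul_one, ENNReal.ofReal_coe_nnreal]
  have hdelta : ∀ (u : 𝓢(Euc n, ℂ)) x, conv u (TemperedDistribution.delta 0) x = u x :=
    fun u x => by
      unfold conv
      rw [TemperedDistribution.delta_apply, reflectTranslate_apply, sub_zero]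
  -- Convolving with the delta distribution returns the kernel itself, so the multiplier's symbol
  -- directly prescribes the pieces of `f`.
  set f : 𝓢'(Euc n, ℂ) :=
    TemperedDistribution.fourierMultiplierCLM ℂ m (TemperedDistribution.delta 0) with hf
  refine ⟨f, ⟨fun x => ?_, fun j x => ?_⟩, ⟨hTz f, fun j x => ?_⟩⟩
  · rw [hf, conv_fourierMultiplierCLM hmu (c := 0) (w := 0) (fun ξ => ?_), conv_zero_left]
    rw [(hsym B _ z hB0' ξ).1]
    have : 𝓕 (0 : 𝓢(Euc n, ℂ)) ξ = 0 := by simp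
    rw [this, mul_zero]
  · rw [hf, conv_fourierMultiplierCLM hmu (c := h j) (w := z j) (fun ξ => ?_), hdelta, hhn]
    rw [(hsym B _ z hB0' ξ).2 j, hhF]
    ring
  · change weight s (j + 1) * ‖conv (φ (j + 1)) (T f) x‖ₑ = _
    rw [hTs, hf, conv_fourierMultiplierCLM hmu (c := h j) (w := z j) (fun ξ => ?_), hdelta, hhn,
      sub_sub, add_comm]
    rw [hgF]
    have h3 : 𝓕 (φ (j + 1)) ξ * A j ξ = A j ξ := by
      by_cases h4 : A j ξ = 0
      · rw [h4, mul_zero]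
      · have h2 := hann j ξ (hA0 j ξ h4)
        rw [hρ _ j ξ h2.1 h2.2, if_pos rfl, one_mul]
    rw [← h3, ← mul_assoc, (hsym B _ z hB0' ξ).2 j, hhF]
    calc _ = c j * (B j ξ * A j ξ) * chr (-z j) ξ := by ring
      _ = _ := by rw [hAB]; ring

end TranslationOperator

/-! ### Critical sequences and separated translates -/

noncomputable section LacunaryNorms

variable {n : ℕ}

theorem eLpNorm_count_succ {u : ℕ → ℝ≥0∞} (h0 : u 0 = 0) (q : ℝ≥0∞) :
    eLpNorm u q Measure.count = eLpNorm (fun j => u (j + 1)) q Measure.count := by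
  rcases eq_or_ne q 0 with rfl | hq0
  · simp
  rcases eq_or_ne q ∞ with rfl | hq
  · simp only [eLpNorm_exponent_top, eLpNormEssSup, essSup_count, enorm_eq_self]
    rw [← sup_iSup_nat_succ, h0]
    simp
  have hq' := ENNReal.toReal_pos hq0 hq
  refine ENNReal.rpow_left_injective hq'.ne' ?_
  simp only [eLpNorm_count_rpow_toReal hq0 hq]
  rw [tsum_eq_zero_add' ENNReal.summable, h0, ENNReal.zero_rpow_of_pos hq', zero_add]

/-- The sequence `(j + 1) ^ (-1 / r)`, which belongs to `ℓ^q` if and only if `q > r`. -/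
def harmonicRoot (r : ℝ) (j : ℕ) : ℝ≥0 := (((j + 1 : ℕ) : ℝ≥0) ^ r⁻¹)⁻¹

theorem harmonicRoot_le_one {r : ℝ} (hr : 0 < r) (j : ℕ) : harmonicRoot r j ≤ 1 :=
  inv_le_one_of_one_le₀ (NNReal.one_le_rpow (by simp) (inv_nonneg.2 hr.le))

theorem tsum_harmonicRoot_rpow_ne_top_iff {r t : ℝ} (hr : 0 < r) (ht : 0 < t) :
    ∑' j, (harmonicRoot r j : ℝ≥0∞) ^ t ≠ ∞ ↔ r < t := by
  have h1 : ∀ j, (harmonicRoot r j : ℝ≥0∞) ^ t =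
      (((((j + 1 : ℕ) : ℝ≥0) ^ (t / r))⁻¹ : ℝ≥0) : ℝ≥0∞) := fun j => by
    rw [← ENNReal.coe_rpow_of_nonneg _ ht.le, harmonicRoot, NNReal.inv_rpow, ← NNReal.rpow_mul,
      div_eq_inv_mul]
  simp only [h1]
  rw [ENNReal.tsum_coe_ne_top_iff_summable,
    NNReal.summable_nat_add_iff (f := fun j : ℕ => ((j : ℝ≥0) ^ (t / r))⁻¹) 1,
    NNReal.summable_rpow_inv, one_lt_div hr]

theorem eLpNorm_harmonicRoot_lt_top {r : ℝ} (hr : 0 < r) {q : ℝ≥0∞}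
    (hq : ENNReal.ofReal r < q) :
    eLpNorm (fun j => (harmonicRoot r j : ℝ≥0∞)) q Measure.count < ∞ := by
  have hq0 : q ≠ 0 := (zero_le.trans_lt hq).ne'
  rcases eq_or_ne q ∞ with rfl | hqt
  · simp only [eLpNorm_exponent_top, eLpNormEssSup, essSup_count, enorm_eq_self]
    refine lt_of_le_of_lt (iSup_le fun j => ?_) ENNReal.one_lt_top
    exact_mod_cast harmonicRoot_le_one hr j
  · have hq' := ENNReal.toReal_pos hq0 hqt
    rw [← ENNReal.rpow_lt_top_iff_of_pos hq', eLpNorm_count_rpow_toReal hq0 hqt, lt_top_iff_ne_top,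
      tsum_harmonicRoot_rpow_ne_top_iff hr hq']
    exact (ENNReal.ofReal_lt_iff_lt_toReal hr.le hqt).1 hq

theorem eLpNorm_harmonicRoot_eq_top {q : ℝ≥0∞} (hq0 : q ≠ 0) (hq : q ≠ ∞) :
    eLpNorm (fun j => (harmonicRoot q.toReal j : ℝ≥0∞)) q Measure.count = ∞ := by
  have hq' := ENNReal.toReal_pos hq0 hq
  by_contra h
  rw [← ne_eq, ← lt_top_iff_ne_top, ← ENNReal.rpow_lt_top_iff_of_pos hq',
    eLpNorm_count_rpow_toReal hq0 hq, lt_top_iff_ne_top,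
    tsum_harmonicRoot_rpow_ne_top_iff hq' hq'] at h
  exact lt_irrefl _ h

/-- Equally spaced points on a line. -/
def grid (e : Euc n) (j : ℕ) : Euc n := (2 * j : ℝ) • e

theorem norm_grid_le {e : Euc n} (he : ‖e‖ = 1) (j : ℕ) : ‖grid e j‖ ≤ 2 ^ (j + 1) := by
  rw [grid, norm_smul, he, mul_one, Real.norm_of_nonneg (by positivity), pow_succ, mul_comm]
  gcongr
  exact_mod_cast Nat.lt_two_pow_self.le

/-- Distinct grid points are at least `2` apart, so the translated unit balls are disjoint and at
most one term is nonzero. -/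
theorem tsum_indicator_grid_le {e : Euc n} (he : ‖e‖ = 1) {x₀ y : Euc n} {t : ℕ → ℝ≥0∞} {M : ℝ≥0∞}
    (h : ∀ j, y - grid e j ∈ Metric.ball x₀ 1 → t j ≤ M) :
    ∑' j, (Metric.ball x₀ 1).indicator (fun _ => t j) (y - grid e j) ≤ M := by
  by_cases hex : ∃ j, y - grid e j ∈ Metric.ball x₀ 1
  · obtain ⟨j, hj⟩ := hex
    rw [tsum_eq_single j, Set.indicator_of_mem hj]
    · exact h j hj
    · intro i hi
      refine Set.indicator_of_notMem (fun hi' => hi ?_) _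
      have h1 : dist (y - grid e i) (y - grid e j) < 2 := by
        refine (dist_triangle_right _ _ x₀).trans_lt ?_
        rw [Metric.mem_ball] at hi' hj
        linarith
      rw [dist_eq_norm, sub_sub_sub_cancel_left, grid, grid, ← sub_smul, norm_smul, he, mul_one,
        Real.norm_eq_abs, ← mul_sub, abs_mul, abs_two] at h1
      have h2 : |((j : ℤ) - (i : ℤ) : ℤ)| < 1 := by
        have : |(j : ℝ) - i| < 1 := by linarith
        exact_mod_cast this
      rw [Int.abs_lt_one_iff] at h2
      omega
  · push Not at hex
    simp [Set.indicator_of_notMem (hex _)]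

/-- The translates of a Schwartz function to the points of a grid have bounded overlap. -/
theorem exists_tsum_translates_le {e : Euc n} (he : ‖e‖ = 1) (η : 𝓢(Euc n, ℂ)) {r : ℝ}
    (hr : 0 < r) : ∃ C : ℝ≥0, ∀ y, ∑' j, ‖η (y - grid e j)‖ₑ ^ r ≤ C := by
  obtain ⟨L, hL⟩ := exists_nat_ge ((volume : Measure (Euc n)).integrablePower / r : ℝ)
  obtain ⟨C₀, hC₀⟩ := rapidDecay_schwartz η L
  set R : ℝ := L * r with hR
  have hR0 : 0 ≤ R := by positivity
  have hRp : ((volume : Measure (Euc n)).integrablePower : ℝ) ≤ R := by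
    rwa [div_le_iff₀ hr] at hL
  have hI := lintegral_rpow_neg_wt_lt_top (μ := (volume : Measure (Euc n))) hRp
  set I := ∫⁻ z : Euc n, (wt z ^ R)⁻¹ with hIdef
  set v := volume (Metric.ball (0 : Euc n) 1) with hv
  have hv0 : v ≠ 0 := (Metric.measure_ball_pos volume _ one_pos).ne'
  have hvt : v ≠ ∞ := measure_ball_lt_top.ne
  have h2 : (2 : ℝ≥0∞) ^ R ≠ ∞ := by finiteness
  have hηb : ∀ z, ‖η z‖ₑ ^ r ≤ (C₀ : ℝ≥0∞) ^ r * (wt z ^ R)⁻¹ := fun z => by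
    rw [← div_eq_mul_inv, ENNReal.le_div_iff_mul_le
      (Or.inl (zero_lt_one.trans_le (one_le_wt_rpow z hR0)).ne')
      (Or.inl (ENNReal.rpow_ne_top_of_nonneg hR0 (wt_ne_top z))), hR, ENNReal.rpow_mul,
      ENNReal.rpow_natCast, ← ENNReal.mul_rpow_of_nonneg _ _ hr.le]
    exact ENNReal.rpow_le_rpow (hC₀ z) hr.le
  -- The weight varies by a bounded factor on unit balls, so its value at a point can be replaced by
  -- its values on the ball around it.
  have hwb : ∀ z u : Euc n, u ∈ Metric.ball z 1 → (wt z ^ R)⁻¹ ≤ 2 ^ R * (wt u ^ R)⁻¹ := by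
    intro z u hu
    have h3 : wt u ≤ 2 * wt z := by
      have h4 := wt_sub_le u z 0
      simp only [sub_zero] at h4
      refine h4.trans (mul_le_mul_left ?_ _)
      rw [mem_ball_iff_norm] at hu
      unfold wt
      exact (ENNReal.ofReal_le_ofReal (by linarith)).trans_eq (ENNReal.ofReal_ofNat 2)
    have h5 : wt u ^ R ≤ 2 ^ R * wt z ^ R := by
      rw [← ENNReal.mul_rpow_of_nonneg _ _ hR0]
      exact ENNReal.rpow_le_rpow h3 hR0
    have h6 : wt u ^ R ≠ 0 := (zero_lt_one.trans_le (one_le_wt_rpow u hR0)).ne'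
    have h7 : wt z ^ R ≠ 0 := (zero_lt_one.trans_le (one_le_wt_rpow z hR0)).ne'
    have h8 : wt u ^ R ≠ ∞ := ENNReal.rpow_ne_top_of_nonneg hR0 (wt_ne_top u)
    rw [← div_eq_mul_inv, ENNReal.le_div_iff_mul_le (Or.inl h6) (Or.inl h8), mul_comm,
      ← div_eq_mul_inv]
    exact ENNReal.div_le_of_le_mul h5
  have hmeas : Measurable fun u : Euc n => (wt u ^ R)⁻¹ := (measurable_wt.pow_const R).inv
  -- Comparison of the sum with an integral over disjoint unit balls.
  have hsum : ∀ y : Euc n, v * ∑' j, (wt (y - grid e j) ^ R)⁻¹ ≤ 2 ^ R * I := by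
    intro y
    calc v * ∑' j, (wt (y - grid e j) ^ R)⁻¹
        = ∑' j, ∫⁻ u, (Metric.ball (0 : Euc n) 1).indicator
            (fun _ => (wt (y - grid e j) ^ R)⁻¹) u := by
          rw [← ENNReal.tsum_mul_left]
          congr 1; ext j
          rw [lintegral_indicator_const Metric.isOpen_ball.measurableSet, mul_comm]
      _ = ∑' j, ∫⁻ u, (Metric.ball (0 : Euc n) 1).indicator
            (fun _ => (wt (y - grid e j) ^ R)⁻¹) (u - grid e j) := by
          congr 1; ext j
          rw [lintegral_sub_right_eq_self]
      _ ≤ ∑' j, ∫⁻ u, (Metric.ball (0 : Euc n) 1).indicator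
            (fun _ => 2 ^ R * (wt (y - u) ^ R)⁻¹) (u - grid e j) := by
          refine ENNReal.tsum_le_tsum fun j => lintegral_mono fun u => ?_
          refine Set.indicator_le_indicator' fun hu => ?_
          refine hwb _ _ ?_
          rw [mem_ball_zero_iff] at hu
          rw [mem_ball_iff_norm, ← norm_neg]
          convert hu using 2
          abel
      _ = ∫⁻ u, ∑' j, (Metric.ball (0 : Euc n) 1).indicator
            (fun _ => 2 ^ R * (wt (y - u) ^ R)⁻¹) (u - grid e j) := by
          refine (lintegral_tsum fun j => ?_).symm
          have h9 : (fun u => (Metric.ball (0 : Euc n) 1).indicator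
              (fun _ => 2 ^ R * (wt (y - u) ^ R)⁻¹) (u - grid e j)) =
              ((fun u => u - grid e j) ⁻¹' Metric.ball (0 : Euc n) 1).indicator
                fun u => 2 ^ R * (wt (y - u) ^ R)⁻¹ := by
            ext u
            by_cases h : u - grid e j ∈ Metric.ball (0 : Euc n) 1
            · rw [Set.indicator_of_mem h, Set.indicator_of_mem (by exact h)]
            · rw [Set.indicator_of_notMem h, Set.indicator_of_notMem (by exact h)]
          rw [h9]
          refine AEMeasurable.indicator ?_ ((measurable_sub_const _) measurableSet_ball)
          exact ((hmeas.comp (measurable_const.sub measurable_id)).const_mul _).aemeasurable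
      _ ≤ ∫⁻ u, 2 ^ R * (wt (y - u) ^ R)⁻¹ :=
          lintegral_mono fun u => tsum_indicator_grid_le he fun j _ => le_rfl
      _ = 2 ^ R * I := by
          rw [lintegral_const_mul' _ _ h2, lintegral_sub_left_eq_self (fun u => (wt u ^ R)⁻¹) y]
  refine ⟨((C₀ : ℝ≥0∞) ^ r * (2 ^ R * I / v)).toNNReal, fun y => ?_⟩
  rw [ENNReal.coe_toNNReal]
  · calc _ ≤ ∑' j, (C₀ : ℝ≥0∞) ^ r * (wt (y - grid e j) ^ R)⁻¹ :=
          ENNReal.tsum_le_tsum fun j => hηb _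
      _ = (C₀ : ℝ≥0∞) ^ r * ∑' j, (wt (y - grid e j) ^ R)⁻¹ := ENNReal.tsum_mul_left
      _ ≤ _ := by
        gcongr
        rw [ENNReal.le_div_iff_mul_le (Or.inl hv0) (Or.inl hvt), mul_comm]
        exact hsum y
  · have := hI.ne
    exact ENNReal.mul_ne_top (ENNReal.rpow_ne_top_of_nonneg hr.le ENNReal.coe_ne_top)
      (ENNReal.div_ne_top (ENNReal.mul_ne_top h2 this) hv0)

end LacunaryNorms

/-! ### Triebel-Lizorkin norms of stacked and of spread families -/

noncomputable section LacunaryTriebelLizorkin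

variable {n : ℕ} {φ : ℕ → 𝓢(Euc n, ℂ)} {s : ℝ} {η : 𝓢(Euc n, ℂ)} {a : ℕ → ℝ≥0} {z : ℕ → Euc n}
  {f : 𝓢'(Euc n, ℂ)} {p q : ℝ≥0∞} {e : Euc n}

theorem IsLacunary.eLpNorm_eq (h : IsLacunary φ s η a z f) (q : ℝ≥0∞) (y : Euc n) :
    eLpNorm (fun j : ℕ => weight s j * ‖conv (φ j) f y‖ₑ) q Measure.count =
      eLpNorm (fun j => a j * ‖η (y - z j)‖ₑ) q Measure.count := by
  rw [eLpNorm_count_succ (by rw [h.zero, enorm_zero, mul_zero])]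
  simp only [h.succ]

theorem IsLacunary.eLpNorm_eq_of_eq_zero (h : IsLacunary φ s η a (fun _ => 0) f) (q : ℝ≥0∞)
    (y : Euc n) :
    eLpNorm (fun j : ℕ => weight s j * ‖conv (φ j) f y‖ₑ) q Measure.count =
      ‖η y‖ₑ * eLpNorm (fun j => (a j : ℝ≥0∞)) q Measure.count := by
  rw [h.eLpNorm_eq, ← eLpNorm_const_mul_ennreal enorm_ne_top]
  simp only [sub_zero, mul_comm]

theorem eLpNorm_restrict_ball_ne_zero {x₀ : Euc n} (hx₀ : η x₀ ≠ 0) (hp : p ≠ 0) :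
    eLpNorm η p (volume.restrict (Metric.ball x₀ 1)) ≠ 0 := by
  rw [ne_eq, eLpNorm_eq_zero_iff η.continuous.aestronglyMeasurable hp]
  intro h
  have hU : IsOpen {y | η y ≠ 0} := isOpen_ne_fun η.continuous continuous_const
  have h1 : volume ({y | η y ≠ 0} ∩ Metric.ball x₀ 1) = 0 := by
    rw [← Measure.restrict_apply hU.measurableSet]
    exact h
  exact ((hU.inter Metric.isOpen_ball).measure_pos volume
    ⟨x₀, hx₀, Metric.mem_ball_self one_pos⟩).ne' h1

/-- The convention `0 * ∞ = 0` leaves the value `∞` exactly where `η` is nonzero; the proof compares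
with arbitrarily large finite multiples of `‖η‖ₑ`. -/
theorem eLpNorm_enorm_mul_top {μ : Measure (Euc n)} (h : eLpNorm η p μ ≠ 0) :
    eLpNorm (fun y => ‖η y‖ₑ * ∞) p μ = ∞ := by
  refine ENNReal.eq_top_of_forall_nnreal_le fun r => ?_
  by_cases ht : eLpNorm η p μ = ∞
  · refine le_top.trans ((ht.symm.le).trans (eLpNorm_mono_enorm fun y => ?_))
    rw [enorm_eq_self]
    by_cases hy : ‖η y‖ₑ = 0
    · rw [hy]; exact zero_le
    · rw [ENNReal.mul_top hy]; exact le_top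
  · obtain ⟨c, hc⟩ : ∃ c : ℝ≥0∞, c = r / eLpNorm η p μ := ⟨_, rfl⟩
    have hct : c ≠ ∞ := hc ▸ ENNReal.div_ne_top ENNReal.coe_ne_top h
    calc (r : ℝ≥0∞) = c * eLpNorm η p μ := by rw [hc, ENNReal.div_mul_cancel h ht]
      _ = c * eLpNorm (fun y => ‖η y‖ₑ) p μ := by rw [eLpNorm_enorm]
      _ = eLpNorm (fun y => c * ‖η y‖ₑ) p μ := (eLpNorm_const_mul_ennreal hct _ _).symm
      _ ≤ _ := eLpNorm_mono_enorm fun y => by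
        rw [enorm_eq_self, enorm_eq_self, mul_comm]
        gcongr
        exact le_top

/-- All pieces at the same place: finite norm. -/
theorem IsLacunary.triebelLizorkinNorm_lt_top_of_eq_zero (h : IsLacunary φ s η a (fun _ => 0) f)
    (hp : p ≠ ∞) (ha : eLpNorm (fun j => (a j : ℝ≥0∞)) q Measure.count < ∞) :
    triebelLizorkinNorm φ s p q f < ∞ := by
  rw [triebelLizorkinNorm, if_neg hp]
  simp only [h.eLpNorm_eq_of_eq_zero, mul_comm (‖η _‖ₑ)]
  rw [eLpNorm_const_mul_ennreal ha.ne, eLpNorm_enorm]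
  exact ENNReal.mul_lt_top ha (η.memLp p volume).2

/-- All pieces at the same place: infinite norm. -/
theorem IsLacunary.triebelLizorkinNorm_eq_top_of_eq_zero (h : IsLacunary φ s η a (fun _ => 0) f)
    (hη : η ≠ 0) (hp : p ≠ 0) (hq : q ≠ 0)
    (ha : eLpNorm (fun j => (a j : ℝ≥0∞)) q Measure.count = ∞) :
    triebelLizorkinNorm φ s p q f = ∞ := by
  obtain ⟨x₀, hx₀⟩ : ∃ x₀, η x₀ ≠ 0 := by
    by_contra! h
    exact hη (SchwartzMap.ext h)
  unfold triebelLizorkinNorm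
  split_ifs with hpt
  -- One ball suffices for the supremum: `J = 0` gives radius one and keeps all indices `j`.
  · refine top_le_iff.1 (le_iSup_of_le x₀ (le_iSup_of_le 0 ?_))
    simp only [Int.natCast_nonneg, if_true, h.eLpNorm_eq_of_eq_zero, ha]
    simp only [Int.cast_zero, zero_mul, Real.rpow_zero, ENNReal.ofReal_one, one_mul, neg_zero,
      zpow_zero]
    exact (eLpNorm_enorm_mul_top (eLpNorm_restrict_ball_ne_zero hx₀ hq)).ge
  · simp only [h.eLpNorm_eq_of_eq_zero, ha]
    refine eLpNorm_enorm_mul_top fun h0 => eLpNorm_restrict_ball_ne_zero hx₀ hp ?_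
    exact nonpos_iff_eq_zero.1 ((eLpNorm_restrict_le _ _ _ _).trans h0.le)

/-- Separated pieces: infinite norm. -/
theorem IsLacunary.triebelLizorkinNorm_eq_top_of_grid (he : ‖e‖ = 1)
    (h : IsLacunary φ s η a (grid e) f) (hη : η ≠ 0) (hp : p ≠ 0) (hpt : p ≠ ∞) (hq : q ≠ 0)
    (ha : eLpNorm (fun j => (a j : ℝ≥0∞)) p Measure.count = ∞) :
    triebelLizorkinNorm φ s p q f = ∞ := by
  obtain ⟨x₀, hx₀⟩ : ∃ x₀, η x₀ ≠ 0 := by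
    by_contra! h
    exact hη (SchwartzMap.ext h)
  have hp' := ENNReal.toReal_pos hp hpt
  rw [triebelLizorkinNorm, if_neg hpt]
  simp only [h.eLpNorm_eq]
  set r := p.toReal with hr
  -- Restricting `η` to a unit ball makes the translates disjoint; at each point at most one piece
  -- is kept, and the `ℓ^q` norm dominates it whatever `q` is.
  set g : Euc n → ℝ≥0∞ := (Metric.ball x₀ 1).indicator fun y => ‖η y‖ₑ ^ r with hg
  have hgm : Measurable g :=
    ((η.continuous.enorm.measurable).pow_const r).indicator measurableSet_ball
  have hg0 : ∫⁻ y, g y ≠ 0 := by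
    rw [hg, lintegral_indicator measurableSet_ball, ← eLpNorm_rpow_toReal hp hpt]
    exact fun h0 => eLpNorm_restrict_ball_ne_zero hx₀ hp ((ENNReal.rpow_eq_zero_iff_of_pos hp').1 h0)
  rw [← ENNReal.rpow_eq_top_iff_of_pos hp', hr, eLpNorm_rpow_toReal hp hpt, ← hr, ← top_le_iff]
  have hat : ∑' j, (a j : ℝ≥0∞) ^ r = ∞ := by
    rw [hr, ← eLpNorm_count_rpow_toReal hp hpt, ha, ENNReal.top_rpow_of_pos hp']
  calc ∞ = ∑' j, ∫⁻ y, (a j : ℝ≥0∞) ^ r * g (y - grid e j) := by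
        have : ∀ j, ∫⁻ y, (a j : ℝ≥0∞) ^ r * g (y - grid e j) = (a j : ℝ≥0∞) ^ r * ∫⁻ y, g y := by
          intro j
          rw [lintegral_const_mul' _ _ (ENNReal.rpow_ne_top_of_nonneg hp'.le ENNReal.coe_ne_top),
            lintegral_sub_right_eq_self]
        simp only [this]
        rw [ENNReal.tsum_mul_right, hat, ENNReal.top_mul hg0]
    _ = ∫⁻ y, ∑' j, (a j : ℝ≥0∞) ^ r * g (y - grid e j) :=
        (lintegral_tsum fun j => ((hgm.comp (measurable_sub_const _)).const_mul _).aemeasurable).symm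
    _ ≤ _ := by
        refine lintegral_mono fun y => ?_
        have h1 : ∀ j, (a j : ℝ≥0∞) ^ r * g (y - grid e j) = (Metric.ball x₀ 1).indicator
            (fun _ => ((a j : ℝ≥0∞) * ‖η (y - grid e j)‖ₑ) ^ r) (y - grid e j) := fun j => by
          rw [hg]
          by_cases hj : y - grid e j ∈ Metric.ball x₀ 1
          · rw [Set.indicator_of_mem hj, Set.indicator_of_mem hj,
              ENNReal.mul_rpow_of_nonneg _ _ hp'.le]
          · rw [Set.indicator_of_notMem hj, Set.indicator_of_notMem hj, mul_zero]
        simp only [h1]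
        refine tsum_indicator_grid_le he fun j _ => ENNReal.rpow_le_rpow ?_ hp'.le
        exact enorm_le_eLpNorm_count (fun j => (a j : ℝ≥0∞) * ‖η (y - grid e j)‖ₑ) j hq

/-- Separated pieces: finite norm. -/
theorem IsLacunary.triebelLizorkinNorm_lt_top_of_grid (he : ‖e‖ = 1)
    (h : IsLacunary φ s η a (grid e) f) (ha1 : ∀ j, a j ≤ 1) (hq : q ≠ 0) (hqp : q < p)
    (ha : eLpNorm (fun j => (a j : ℝ≥0∞)) p Measure.count < ∞) :
    triebelLizorkinNorm φ s p q f < ∞ := by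
  have hqt : q ≠ ∞ := hqp.ne_top
  have hq' := ENNReal.toReal_pos hq hqt
  set r := q.toReal with hr
  obtain ⟨C, hC⟩ := exists_tsum_translates_le he η hq'
  have hpow : ∀ y, eLpNorm (fun j => (a j : ℝ≥0∞) * ‖η (y - grid e j)‖ₑ) q Measure.count ^ r =
      ∑' j, ‖η (y - grid e j)‖ₑ ^ r * (a j : ℝ≥0∞) ^ r := fun y => by
    rw [hr, eLpNorm_count_rpow_toReal hq hqt, ← hr]
    congr 1; ext j
    rw [ENNReal.mul_rpow_of_nonneg _ _ hq'.le, mul_comm]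
  rcases eq_or_ne p ∞ with rfl | hpt
  -- For `p = ∞` the bound `a j ≤ 1` and the bounded overlap make the pointwise `ℓ^q` norm uniformly
  -- bounded.
  · have hb : ∀ y, eLpNorm (fun j => (a j : ℝ≥0∞) * ‖η (y - grid e j)‖ₑ) q Measure.count ≤
        (C : ℝ≥0∞) ^ r⁻¹ := fun y => by
      rw [ENNReal.le_rpow_inv_iff hq', hpow]
      refine (ENNReal.tsum_le_tsum fun j => ?_).trans (hC y)
      refine mul_le_of_le_one_right' (ENNReal.rpow_le_one (by exact_mod_cast ha1 j) hq'.le)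
    rw [triebelLizorkinNorm, if_pos rfl]
    set B : ℝ≥0∞ := (C : ℝ≥0∞) ^ r⁻¹ * volume (Metric.ball (0 : Euc n) 1) ^ (1 / r) with hB
    have hBt : B < ∞ := by
      refine ENNReal.mul_lt_top ?_ ?_
      · exact ENNReal.rpow_lt_top_of_nonneg (by positivity) ENNReal.coe_ne_top
      · exact ENNReal.rpow_lt_top_of_nonneg (by positivity) measure_ball_lt_top.ne
    refine lt_of_le_of_lt (iSup_le fun x => iSup_le fun J => ?_) hBt
    have h1 : eLpNorm (fun y => eLpNorm (fun j : ℕ => if J ≤ (j : ℤ) then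
        weight s j * ‖conv (φ j) f y‖ₑ else 0) q Measure.count) q
        (volume.restrict (Metric.ball x ((2 : ℝ) ^ (-J)))) ≤
        eLpNorm (fun _ : Euc n => (C : ℝ≥0∞) ^ r⁻¹) q
          (volume.restrict (Metric.ball x ((2 : ℝ) ^ (-J)))) := by
      refine eLpNorm_mono_enorm fun y => ?_
      rw [enorm_eq_self, enorm_eq_self]
      refine le_trans ?_ (hb y)
      rw [← h.eLpNorm_eq]
      refine eLpNorm_mono_enorm fun j => ?_
      rw [enorm_eq_self, enorm_eq_self]
      split_ifs
      · exact le_rfl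
      · exact zero_le
    have h2 : volume (Metric.ball x ((2 : ℝ) ^ (-J))) = ENNReal.ofReal (((2 : ℝ) ^ (-J)) ^ n) *
        volume (Metric.ball (0 : Euc n) 1) := by
      rw [Measure.addHaar_ball_of_pos volume x (by positivity), finrank_euclideanSpace_fin]
    have h3 : volume.restrict (Metric.ball x ((2 : ℝ) ^ (-J))) ≠ 0 := by
      rw [ne_eq, Measure.restrict_eq_zero]
      exact (Metric.measure_ball_pos volume _ (by positivity)).ne'
    rw [eLpNorm_const _ hq h3, enorm_eq_self, Measure.restrict_apply_univ, h2, ← hr,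
      ENNReal.mul_rpow_of_nonneg _ _ (by positivity)] at h1
    refine (mul_le_mul_right h1 _).trans_eq ?_
    -- The normalization `2 ^ (J n / q)` offsets the volume of the ball to the power `1 / q`.
    have h4 : ENNReal.ofReal ((2 : ℝ) ^ ((J : ℝ) * (n / r))) *
        ENNReal.ofReal (((2 : ℝ) ^ (-J)) ^ n) ^ (1 / r) = 1 := by
      rw [ENNReal.ofReal_rpow_of_nonneg (by positivity) (by positivity),
        ← ENNReal.ofReal_mul (by positivity), ← Real.rpow_natCast, ← Real.rpow_intCast,
        ← Real.rpow_mul (by positivity), ← Real.rpow_mul (by norm_num), ← Real.rpow_add (by norm_num)]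
      push_cast
      rw [show (J : ℝ) * (n / r) + -J * (n * (1 / r)) = 0 by ring, Real.rpow_zero, ENNReal.ofReal_one]
    calc _ = (ENNReal.ofReal ((2 : ℝ) ^ ((J : ℝ) * (n / r))) *
        ENNReal.ofReal (((2 : ℝ) ^ (-J)) ^ n) ^ (1 / r)) * B := by rw [hB]; ring
      _ = B := by rw [h4, one_mul]
  · have hp : p ≠ 0 := (zero_le.trans_lt hqp).ne'
    have hp' := ENNReal.toReal_pos hp hpt
    rw [triebelLizorkinNorm, if_neg hpt]
    simp only [h.eLpNorm_eq]
    set t := p.toReal / r with ht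
    have ht1 : 1 ≤ t := by
      rw [ht, one_le_div hq']
      exact ENNReal.toReal_mono hpt hqp.le
    have hrt : r * t = p.toReal := by rw [ht]; field_simp
    rw [← ENNReal.rpow_lt_top_iff_of_pos hp', eLpNorm_rpow_toReal hp hpt]
    -- Jensen's inequality with exponent `t = p / q ≥ 1` and weights `‖η(y - z_j)‖ ^ q`, of total
    -- mass at most `C`; the resulting sum is integrated term by term.
    have hb : ∀ y, eLpNorm (fun j => (a j : ℝ≥0∞) * ‖η (y - grid e j)‖ₑ) q Measure.count ^ p.toReal ≤
        (C : ℝ≥0∞) ^ (t - 1) * ∑' j, ‖η (y - grid e j)‖ₑ ^ r * (a j : ℝ≥0∞) ^ p.toReal := fun y => by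
      rw [← hrt, ENNReal.rpow_mul, hpow]
      have h1 := lintegral_mul_rpow_le (μ := (Measure.count : Measure ℕ))
        (w := fun j => ‖η (y - grid e j)‖ₑ ^ r) (a := fun j => (a j : ℝ≥0∞) ^ r)
        (measurable_of_countable _).aemeasurable (measurable_of_countable _).aemeasurable ht1
      simp only [lintegral_count] at h1
      refine h1.trans ?_
      simp only [← ENNReal.rpow_mul]
      gcongr
      exact hC y
    have hfin : ∫⁻ y, ‖η y‖ₑ ^ r ≠ ∞ := by
      have h1 : eLpNorm η q volume ^ r = ∫⁻ y, ‖η y‖ₑ ^ r := eLpNorm_rpow_toReal hq hqt η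
      rw [← h1]
      exact ENNReal.rpow_ne_top_of_nonneg hq'.le (η.memLp q volume).2.ne
    have hat : ∑' j, (a j : ℝ≥0∞) ^ p.toReal ≠ ∞ := by
      rw [← eLpNorm_count_rpow_toReal hp hpt fun j => (a j : ℝ≥0∞)]
      exact ENNReal.rpow_ne_top_of_nonneg hp'.le ha.ne
    have hCt : (C : ℝ≥0∞) ^ (t - 1) ≠ ∞ :=
      ENNReal.rpow_ne_top_of_nonneg (by linarith) ENNReal.coe_ne_top
    calc _ ≤ ∫⁻ y, (C : ℝ≥0∞) ^ (t - 1) *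
          ∑' j, ‖η (y - grid e j)‖ₑ ^ r * (a j : ℝ≥0∞) ^ p.toReal := lintegral_mono hb
      _ = (C : ℝ≥0∞) ^ (t - 1) * ∑' j, (∫⁻ y, ‖η y‖ₑ ^ r) * (a j : ℝ≥0∞) ^ p.toReal := by
          rw [lintegral_const_mul' _ _ hCt, lintegral_tsum fun j => ?_]
          · congr 2; ext j
            rw [lintegral_mul_const' _ _
              (ENNReal.rpow_ne_top_of_nonneg hp'.le ENNReal.coe_ne_top),
              lintegral_sub_right_eq_self fun y => ‖η y‖ₑ ^ r]
          · exact (((η.continuous.enorm.measurable.comp (measurable_sub_const _)).pow_const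
              r).mul_const _).aemeasurable
      _ < ∞ := by
          rw [ENNReal.tsum_mul_left]
          exact (ENNReal.mul_ne_top hCt (ENNReal.mul_ne_top hfin hat)).lt_top

end LacunaryTriebelLizorkin

/-! ### From a bounded operator to the failure of interpolation -/

section Interpolation

variable {V : Type} [AddCommGroup V] [Module ℂ V] {N₀ N₁ : V → ℝ≥0∞}

theorem mem_sumSpace_of_sumNorm_lt_top {x : V} (hx : sumNorm N₀ N₁ x < ∞) : x ∈ sumSpace N₀ N₁ := by
  obtain ⟨a, b, rfl, hb⟩ := exists_of_sumNorm_lt hx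
  rw [ENNReal.add_lt_top] at hb
  exact add_mem (Submodule.subset_span (Or.inl hb.1)) (Submodule.subset_span (Or.inr hb.2))

/-- A linear operator which is bounded for both quasi-norms of a couple restricts to an admissible
operator. -/
theorem exists_isAdmissible (T : V →ₗ[ℂ] V) (h₀ : ∃ C : ℝ≥0, ∀ x, N₀ (T x) ≤ C * N₀ x)
    (h₁ : ∃ C : ℝ≥0, ∀ x, N₁ (T x) ≤ C * N₁ x) :
    ∃ S : sumSpace N₀ N₁ →ₗ[ℂ] sumSpace N₀ N₁, IsAdmissible N₀ N₁ N₀ N₁ S ∧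
      ∀ x : sumSpace N₀ N₁, (S x : V) = T x := by
  obtain ⟨C₀, hC₀⟩ := h₀
  obtain ⟨C₁, hC₁⟩ := h₁
  have hT : ∀ x ∈ sumSpace N₀ N₁, T x ∈ sumSpace N₀ N₁ := by
    intro x hx
    refine (Submodule.span_le (p := (sumSpace N₀ N₁).comap T)).2 (fun y hy => ?_) hx
    refine Submodule.subset_span ?_
    rcases hy with hy | hy
    · exact Or.inl ((hC₀ y).trans_lt (ENNReal.mul_lt_top ENNReal.coe_lt_top hy))
    · exact Or.inr ((hC₁ y).trans_lt (ENNReal.mul_lt_top ENNReal.coe_lt_top hy))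
  -- The summand `1` makes the constant nonzero, which allows it to be moved inside the infimum.
  refine ⟨T.restrict hT, ⟨⟨max C₀ C₁ + 1, fun x _ => ?_⟩, ⟨C₀, fun x _ => hC₀ x⟩,
    ⟨C₁, fun x _ => hC₁ x⟩⟩, fun _ => rfl⟩
  change sumNorm N₀ N₁ (T x) ≤ _
  unfold sumNorm
  rw [ENNReal.mul_iInf_of_ne (by simp) ENNReal.coe_ne_top]
  refine le_iInf fun b => iInf_le_of_le (T b) ?_
  rw [← map_sub, mul_add]
  gcongr
  · refine (hC₀ b).trans ?_
    gcongr
    exact (le_max_left _ _).trans le_self_add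
  · refine (hC₁ _).trans ?_
    gcongr
    exact (le_max_right _ _).trans le_self_add

/-- The functor is applied to `T` as an endomorphism of the couple. Its image is the restriction of
`T`, so the underlying set is invariant; no comparison of quasi-norms is needed. -/
theorem not_isCategoricalInterpolationSpace {N : V → ℝ≥0∞} (T : V →ₗ[ℂ] V)
    (h₀ : ∃ C : ℝ≥0, ∀ x, N₀ (T x) ≤ C * N₀ x) (h₁ : ∃ C : ℝ≥0, ∀ x, N₁ (T x) ≤ C * N₁ x) {f : V}
    (hf : N f < ∞) (hTf : N (T f) = ∞) : ¬ IsCategoricalInterpolationSpace N₀ N₁ N := by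
  rintro ⟨h, 𝔉, h𝔉⟩
  obtain ⟨S, hS, hST⟩ := exists_isAdmissible T h₀ h₁
  set X : Couple := { V := V, norm₀ := N₀, norm₁ := N₁, compatible := h }
  let S' : X ⟶ X := (⟨S, hS⟩ : Couple.Hom X X)
  have h1 : f ∈ 𝔉.space X := by rw [h𝔉]; exact hf
  obtain ⟨y, rfl⟩ := h1
  have h2 : T (𝔉.incl X y : V) ∈ 𝔉.space X :=
    ⟨(𝔉.functor.map S').toLin y, by
      simp only [𝔉.map_eq_restrict]
      exact hST (𝔉.incl X y)⟩
  rw [h𝔉] at h2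
  exact absurd hTf (ne_of_lt h2)

/-- The inclusion in the sum places `f` in the domain of the admissible operator; boundedness then
contradicts `N (T f) = ∞`. -/
theorem not_isSetTheoreticInterpolationSpace {N : V → ℝ≥0∞} (T : V →ₗ[ℂ] V)
    (h₀ : ∃ C : ℝ≥0, ∀ x, N₀ (T x) ≤ C * N₀ x) (h₁ : ∃ C : ℝ≥0, ∀ x, N₁ (T x) ≤ C * N₁ x) {f : V}
    (hf : N f < ∞) (hTf : N (T f) = ∞) : ¬ IsSetTheoreticInterpolationSpace N₀ N₁ N := by
  intro h
  obtain ⟨S, hS, hST⟩ := exists_isAdmissible T h₀ h₁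
  obtain ⟨C, hC⟩ := h.subset_sum
  have h1 : f ∈ sumSpace N₀ N₁ := mem_sumSpace_of_sumNorm_lt_top
    ((hC f hf).trans_lt (ENNReal.mul_lt_top ENNReal.coe_lt_top hf))
  obtain ⟨D, hD⟩ := h.invariant S hS
  have h2 := hD ⟨f, h1⟩ hf
  rw [hST] at h2
  exact absurd hTf (h2.trans_lt (ENNReal.mul_lt_top ENNReal.coe_lt_top hf)).ne

end Interpolation

/-- Some operator which is bounded on all Besov spaces is not bounded on `F^s_{pq}`, `p ≠ q`. -/
theorem exists_operator_not_mapsTo {n : ℕ} (hn : 1 ≤ n) {φ : ℕ → 𝓢(Euc n, ℂ)}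
    (hφ : IsLittlewoodPaley φ) (s : ℝ) {p q : ℝ≥0∞} (hp : p ≠ 0) (hq : q ≠ 0) (hpq : p ≠ q) :
    ∃ T : 𝓢'(Euc n, ℂ) →ₗ[ℂ] 𝓢'(Euc n, ℂ),
      (∀ (s₀ : ℝ) (p₀ q₀ : ℝ≥0∞), p₀ ≠ 0 → ∃ C : ℝ≥0, ∀ f,
        besovNorm φ s₀ p₀ q₀ (T f) ≤ C * besovNorm φ s₀ p₀ q₀ f) ∧
      ∃ f, triebelLizorkinNorm φ s p q f < ∞ ∧ triebelLizorkinNorm φ s p q (T f) = ∞ := by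
  obtain ⟨η, hη, H⟩ := exists_translation_operator hφ hn
  set e : Euc n := EuclideanSpace.single ⟨0, hn⟩ 1
  have he : ‖e‖ = 1 := by simp [e]
  -- For `p < q` the critical exponent is `p`: the coefficients lie in `ℓ^q` but not in `ℓ^p`, and
  -- `T` spreads a stacked family.
  rcases lt_or_gt_of_ne hpq with h | h
  · have hpt : p ≠ ∞ := h.ne_top
    have hp' := ENNReal.toReal_pos hp hpt
    obtain ⟨T, hT, HT⟩ := H (grid e) (norm_grid_le he)
    obtain ⟨f, hf, hTf⟩ := HT s (harmonicRoot p.toReal) (fun _ => 0) (harmonicRoot_le_one hp')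
      (fun j => by simp)
    refine ⟨T, fun s₀ p₀ q₀ => hT s₀ p₀ q₀, f, ?_, ?_⟩
    · exact hf.triebelLizorkinNorm_lt_top_of_eq_zero hpt
        (eLpNorm_harmonicRoot_lt_top hp' (by rwa [ENNReal.ofReal_toReal hpt]))
    · simp only [zero_add] at hTf
      exact hTf.triebelLizorkinNorm_eq_top_of_grid he hη hp hpt hq
        (eLpNorm_harmonicRoot_eq_top hp hpt)
  -- For `q < p` the roles are exchanged: the coefficients lie in `ℓ^p` but not in `ℓ^q`, and the
  -- opposite translations stack a spread family at the origin.
  · have hqt : q ≠ ∞ := h.ne_top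
    have hq' := ENNReal.toReal_pos hq hqt
    obtain ⟨T, hT, HT⟩ := H (fun j => -grid e j) (fun j => by
      rw [norm_neg]; exact norm_grid_le he j)
    obtain ⟨f, hf, hTf⟩ := HT s (harmonicRoot q.toReal) (grid e) (harmonicRoot_le_one hq')
      (norm_grid_le he)
    refine ⟨T, fun s₀ p₀ q₀ => hT s₀ p₀ q₀, f, ?_, ?_⟩
    · exact hf.triebelLizorkinNorm_lt_top_of_grid he (harmonicRoot_le_one hq') hq h
        (eLpNorm_harmonicRoot_lt_top hq' (by rwa [ENNReal.ofReal_toReal hqt]))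
    · simp only [add_neg_cancel] at hTf
      exact hTf.triebelLizorkinNorm_eq_top_of_eq_zero hη hp hq (eLpNorm_harmonicRoot_eq_top hq hqt)

end FunctionSpaces

theorem corollary2 (n : ℕ) (hn : 1 ≤ n) (φ : ℕ → 𝓢(Euc n, ℂ)) (hφ : IsLittlewoodPaley φ)
    (s : ℝ) (p q : ℝ≥0∞) (hp : 0 < p) (hq : 0 < q) (hpq : p ≠ q)
    (s₀ s₁ : ℝ) (p₀ q₀ p₁ q₁ : ℝ≥0∞) (hp₀ : 0 < p₀) (hq₀ : 0 < q₀) (hp₁ : 0 < p₁) (hq₁ : 0 < q₁) :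
    IsCompatible (besovNorm φ s₀ p₀ q₀) (besovNorm φ s₁ p₁ q₁) ∧
    ¬ IsCategoricalInterpolationSpace (besovNorm φ s₀ p₀ q₀) (besovNorm φ s₁ p₁ q₁)
        (triebelLizorkinNorm φ s p q) ∧
    ¬ IsSetTheoreticInterpolationSpace (besovNorm φ s₀ p₀ q₀) (besovNorm φ s₁ p₁ q₁)
        (triebelLizorkinNorm φ s p q) := by
  obtain ⟨T, hT, f, hf, hTf⟩ := exists_operator_not_mapsTo hn hφ s hp.ne' hq.ne' hpq
  have h₀ := hT s₀ p₀ q₀ hp₀.ne'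
  have h₁ := hT s₁ p₁ q₁ hp₁.ne'
  exact ⟨isCompatible_besovNorm hφ s₀ s₁ hp₀.ne' hq₀.ne' hp₁.ne' hq₁.ne',
    not_isCategoricalInterpolationSpace T h₀ h₁ hf hTf,
    not_isSetTheoreticInterpolationSpace T h₀ h₁ hf hTf⟩
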